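/- Let $\mu$ be the surface measure on the unit sphere $\mathbb S^2\subset\mathbb R^3$ (total mass $4\pi$) and $\lambda_\ell=\ell(\ell+1)$. For each $\ell\ge 0$ let $Y_{\ell,1},\dots,Y_{\ell,2\ell+1}$ be an $L_2(\mathbb S^2)$-orthonormal basis of the real spherical harmonics of degree $\ell$, and for $\ell\ge1$ put $\mathbf y_{\ell,k}=\lambda_\ell^{-1/2}\,\mathbf L_*Y_{\ell,k}$ and $\mathbf z_{\ell,k}=\lambda_\ell^{-1/2}\,\nabla_*Y_{\ell,k}$, where $\nabla_*=(I-xx^\top)\nabla$ is the surface gradient and $\mathbf L_*=x\times\nabla$ the surface curl. For real $\sigma\ge 0$, $\mathbf H^\sigma(\mathbb S^2)$ is the space of square-integrable tangential vector fields $\mathbf f:\mathbb S^2\to\mathbb R^3$ with $$\|\mathbf f\|_{\mathbf H^\sigma}^2=\sum_{\ell=1}^\infty\sum_{k=1}^{2\ell+1}(1+\lambda_\ell)^\sigma\big(|\langle \mathbf f,\mathbf y_{\ell,k}\rangle|^2+|\langle \mathbf f,\mathbf z_{\ell,k}\rangle|^2\big)<\infty,\qquad \langle\mathbf f,\mathbf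 g\rangle=\int_{\mathbb S^2}\mathbf f^\top\mathbf g\,d\mu .$$ Let $\sigma>1$, $0<\rho_0\le1$, $c_1,c_2>0$, and let $(\psi_\rho)_{0<\rho<\rho_0}$ be a family of continuous functions on $[-1,1]$ (zonal kernels $\psi_\rho(x\cdot y)$). With $P_\ell$ the Legendre polynomial normalised by $P_\ell(1)=1$, put $\widehat\psi_\rho(\ell)=2\pi\int_{-1}^1\psi_\rho(t)P_\ell(t)\,dt$ and assume that for all $0<\rho<\rho_0$ $$|1-\widehat\psi_\rho(\ell)|\le c_1(\ell\rho)^\sigma\ \text{ for } 0\le\ell\le\lfloor\rho^{-1}-1\rfloor,\qquad |\widehat\psi_\rho(\ell)|\le c_2\ \text{ for }\ell>\lfloor\rho^{-1}-1\rfloor .$$ Define $$\kappa_\rho(t)=\frac1{4\pi(1-t^2)}\int_{-1}^t\big(1-4\pi\psi_\rho(s)\big)\,ds\qquad(-1<t<1)$$ and, for $x,y\in\mathbb S^2$ with $x\ne\pm y$ and $t=x\cdot y$, the matrix kernel $\Psi_\rho=\Psi_\rho^{\mathrm{div}}+\Psi_\rho^{\mathrm{curl}}$ with $$\Psi_\rho^{\mathrm{div}}(x,y)=-\kappa_\rho'(t)(x\times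 y)(x\times y)^\top+\kappa_\rho(t)\,(tI-yx^\top),$$ $$\Psi_\rho^{\mathrm{curl}}(x,y)=\kappa_\rho'(t)(y-tx)(x-ty)^\top+\kappa_\rho(t)\,(I-xx^\top)(I-yy^\top).$$ Then there is a constant $C>0$, independent of $\rho$ and $\mathbf f$, such that for all $0<\rho<\rho_0$ and all $\mathbf f\in\mathbf H^\sigma(\mathbb S^2)$ the convolution $(\mathcal C_{\Psi_\rho}\mathbf f)(x)=\int_{\mathbb S^2}\Psi_\rho(x,y)\mathbf f(y)\,d\mu(y)$ converges absolutely for every $x\in\mathbb S^2$, $\mathbf f-\mathcal C_{\Psi_\rho}\mathbf f\in\mathbf L_\infty(\mathbb S^2)$, and $$\|\mathbf f-\mathcal C_{\Psi_\rho}\mathbf f\|_{\mathbf L_\infty(\mathbb S^2)}\le C\,\rho^{\sigma-1}\,\|\mathbf f\|_{\mathbf H^\sigma(\mathbb S^2)} .$$ -/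

import Mathlib

open MeasureTheory

noncomputable section

namespace SphereVec

/-- Euclidean three-space. -/
abbrev E3 : Type := EuclideanSpace ℝ (Fin 3)

/-- The unit sphere of Euclidean three-space. -/
abbrev S2 : Type := Metric.sphere (0 : E3) 1

/-- The rotation invariant surface measure on the sphere (total mass `4π`). -/
def surf : Measure S2 := (volume : Measure E3).toSphere

/-- The cross product of two vectors of Euclidean three-space. -/
def cross (x y : E3) : E3 := WithLp.toLp 2 (crossProduct x.ofLp y.ofLp)

/-! ### Scalar and vector spherical harmonics -/

/-- The value of a polynomial in three variables at a point. -/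
def evalAt (p : MvPolynomial (Fin 3) ℝ) (x : E3) : ℝ := MvPolynomial.eval x.ofLp p

/-- The spherical harmonics of degree `ℓ`, each written as the homogeneous harmonic polynomial
of degree `ℓ` whose restriction to the sphere it is. -/
def harmonicSpace (ℓ : ℕ) : Submodule ℝ (MvPolynomial (Fin 3) ℝ) :=
  MvPolynomial.homogeneousSubmodule (Fin 3) ℝ ℓ ⊓
    LinearMap.ker (∑ i : Fin 3,
      (MvPolynomial.pderiv (R := ℝ) i).toLinearMap ∘ₗ (MvPolynomial.pderiv (R := ℝ) i).toLinearMap)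

/-- `Y 0, …, Y (2ℓ)` is an orthonormal basis, in `L₂` of the sphere, of the space of spherical
harmonics of degree `ℓ`. -/
structure IsHarmonicBasis (ℓ : ℕ) (Y : Fin (2 * ℓ + 1) → MvPolynomial (Fin 3) ℝ) : Prop where
  span_eq : Submodule.span ℝ (Set.range Y) = harmonicSpace ℓ
  orthonormal : ∀ j k, ∫ x : S2, evalAt (Y j) x * evalAt (Y k) x ∂surf = if j = k then 1 else 0

/-- The Euclidean gradient of a polynomial. -/
def grad (p : MvPolynomial (Fin 3) ℝ) (x : E3) : E3 :=
  WithLp.toLp 2 fun i => evalAt (MvPolynomial.pderiv i p) x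

/-- The surface gradient `(I - x xᵀ) ∇`. -/
def surfGrad (p : MvPolynomial (Fin 3) ℝ) (x : S2) : E3 :=
  grad p x - inner ℝ (x : E3) (grad p x) • (x : E3)

/-- The surface curl `x × ∇`. -/
def surfCurl (p : MvPolynomial (Fin 3) ℝ) (x : S2) : E3 := cross x (grad p x)

/-- The eigenvalue `ℓ (ℓ + 1)` of the negative Laplace–Beltrami operator. -/
def lam (ℓ : ℕ) : ℝ := ℓ * (ℓ + 1)

/-- The divergence-free vector spherical harmonic built from `p` of degree `ℓ ≥ 1`. -/
def vecDiv (ℓ : ℕ) (p : MvPolynomial (Fin 3) ℝ) (x : S2) : E3 := (√(lam ℓ))⁻¹ • surfCurl p x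

/-- The curl-free vector spherical harmonic built from `p` of degree `ℓ ≥ 1`. -/
def vecCurl (ℓ : ℕ) (p : MvPolynomial (Fin 3) ℝ) (x : S2) : E3 := (√(lam ℓ))⁻¹ • surfGrad p x

/-! ### Sobolev spaces of tangent vector fields -/

/-- The `L₂` inner product of vector fields. -/
def ip (f g : S2 → E3) : ℝ := ∫ x, inner ℝ (f x) (g x) ∂surf

/-- Square-integrable tangent vector fields. -/
structure MemL2Tangent (f : S2 → E3) : Prop where
  memLp : MemLp f 2 surf
  tangential : ∀ᵐ x : S2 ∂surf, inner ℝ (x : E3) (f x) = 0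

/-- The contribution of degree `ℓ` to the squared Sobolev norm of order `σ`. -/
def sobolevTerm (Y : (ℓ : ℕ) → Fin (2 * ℓ + 1) → MvPolynomial (Fin 3) ℝ) (σ : ℝ)
    (f : S2 → E3) (ℓ : ℕ) : ℝ :=
  ∑ k, (1 + lam ℓ) ^ σ *
    (|ip f (vecDiv ℓ (Y ℓ k))| ^ 2 + |ip f (vecCurl ℓ (Y ℓ k))| ^ 2)

/-- Membership in the Sobolev space of order `σ` of tangent vector fields (degrees `ℓ ≥ 1`). -/
structure MemSobolev (Y : (ℓ : ℕ) → Fin (2 * ℓ + 1) → MvPolynomial (Fin 3) ℝ) (σ : ℝ)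
    (f : S2 → E3) : Prop where
  memL2 : MemL2Tangent f
  summable : Summable fun n : ℕ => sobolevTerm Y σ f (n + 1)

/-- The Sobolev norm of order `σ`. -/
def sobolevNorm (Y : (ℓ : ℕ) → Fin (2 * ℓ + 1) → MvPolynomial (Fin 3) ℝ) (σ : ℝ)
    (f : S2 → E3) : ℝ :=
  √(∑' n : ℕ, sobolevTerm Y σ f (n + 1))

/-! ### Zonal kernels -/

/-- The Legendre polynomial, normalised by `P_ℓ(1) = 1` (Rodrigues' formula). -/
def legendreP (ℓ : ℕ) : Polynomial ℝ :=
  Polynomial.C ((2 ^ ℓ * (ℓ.factorial : ℝ))⁻¹) *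
    Polynomial.derivative^[ℓ] ((Polynomial.X ^ 2 - 1) ^ ℓ)

/-- The Fourier–Legendre coefficient of a zonal kernel `ψ(x · y)`, normalised so that
`ψ(t) = ∑ (2ℓ+1)/(4π) ψ̂(ℓ) P_ℓ(t)`. -/
def zonalCoeff (ψ : ℝ → ℝ) (ℓ : ℕ) : ℝ :=
  2 * Real.pi * ∫ t in (-1 : ℝ)..1, ψ t * (legendreP ℓ).eval t

/-- The approximation condition of order `m` on a scaled family `ψ ρ`, `0 < ρ < ρ₀`, of continuous
zonal kernels: the Fourier–Legendre coefficients are close to `1` up to degree `⌊ρ⁻¹ - 1⌋` and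
bounded beyond it. -/
structure KernelCondition (ψ : ℝ → ℝ → ℝ) (m ρ₀ c₁ c₂ : ℝ) : Prop where
  continuousOn : ∀ ρ, 0 < ρ → ρ < ρ₀ → ContinuousOn (ψ ρ) (Set.Icc (-1) 1)
  low : ∀ ρ, 0 < ρ → ρ < ρ₀ → ∀ ℓ : ℕ, (ℓ : ℤ) ≤ ⌊ρ⁻¹ - 1⌋ →
    |1 - zonalCoeff (ψ ρ) ℓ| ≤ c₁ * (ℓ * ρ) ^ m
  high : ∀ ρ, 0 < ρ → ρ < ρ₀ → ∀ ℓ : ℕ, ⌊ρ⁻¹ - 1⌋ < (ℓ : ℤ) → |zonalCoeff (ψ ρ) ℓ| ≤ c₂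

/-! ### The matrix kernel and its convolution operator -/

/-- The auxiliary function of a zonal kernel, meaningful on the open interval `(-1, 1)`. -/
def kappa (ψ : ℝ → ℝ) (t : ℝ) : ℝ :=
  (4 * Real.pi * (1 - t ^ 2))⁻¹ * ∫ s in (-1 : ℝ)..t, (1 - 4 * Real.pi * ψ s)

/-- The rank-one matrix `u vᵀ`. -/
def outer (u v : E3) : Matrix (Fin 3) (Fin 3) ℝ := Matrix.vecMulVec u.ofLp v.ofLp

/-- The divergence-free matrix kernel, for `x ≠ ±y`; for fixed `x` the excluded points `y = ±x`
form a null set, which the convolution does not see. -/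
def kernelDiv (ψ : ℝ → ℝ) (x y : S2) : Matrix (Fin 3) (Fin 3) ℝ :=
  let t : ℝ := inner ℝ (x : E3) (y : E3)
  deriv (kappa ψ) t • (-outer (cross x y) (cross x y)) + kappa ψ t • (t • 1 - outer y x)

/-- The curl-free matrix kernel, for `x ≠ ±y`. -/
def kernelCurl (ψ : ℝ → ℝ) (x y : S2) : Matrix (Fin 3) (Fin 3) ℝ :=
  let t : ℝ := inner ℝ (x : E3) (y : E3)
  deriv (kappa ψ) t • outer ((y : E3) - t • (x : E3)) ((x : E3) - t • (y : E3)) +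
    kappa ψ t • ((1 - outer x x) * (1 - outer y y))

/-- The matrix kernel: the sum of the divergence-free and the curl-free kernels. -/
def kernelMat (ψ : ℝ → ℝ) (x y : S2) : Matrix (Fin 3) (Fin 3) ℝ :=
  kernelDiv ψ x y + kernelCurl ψ x y

/-- The integrand of the convolution. -/
def convIntegrand (ψ : ℝ → ℝ) (f : S2 → E3) (x y : S2) : E3 :=
  WithLp.toLp 2 ((kernelMat ψ x y).mulVec (f y).ofLp)

/-- The convolution operator of the matrix kernel. -/
def conv (ψ : ℝ → ℝ) (f : S2 → E3) (x : S2) : E3 := ∫ y, convIntegrand ψ f x y ∂surf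

end SphereVec

end

noncomputable section

namespace SphereVec

/-! The convolution is a Fourier multiplier: on the component `fieldPart` of degree `ℓ` it acts as
multiplication by `ψ̂(ℓ)`. By Legendre's equation the antiderivative of `P_ℓ` vanishing at `-1` is
`-(1 - t²) P_ℓ' / λ_ℓ`. The condition at `ℓ = 0` forces `ψ̂(0) = 1`, so `1 - 4πψ` has no degree-zero
part, and for a polynomial `ψ` the factor `1 - t²` cancels: `κ = ∑ (2ℓ+1)/(4π) ψ̂(ℓ)/λ_ℓ P_ℓ'`. The
matrix kernel built from `κ` and `κ'` is then, by the addition theorem differentiated once in each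
variable, the sum of `ψ̂(ℓ) (𝐲 𝐲ᵀ + 𝐳 𝐳ᵀ)` over the vector harmonics (`fieldPart_eq_integral`,
`conv_polynomial`).

The Legendre series of a merely continuous `ψ` need not converge, so `ψ` is approximated uniformly
by polynomials of the same mean. Equality of the means tames the singularities of `κ` at `±1`
(`abs_kappa_sub_le`), which makes the convolution Lipschitz in the sup norm of the kernel
(`norm_conv_sub_le`); `conv_eq_tsum` is the limit.

Consequently `f - Cf = ∑ (1 - ψ̂(ℓ)) f_ℓ` almost everywhere. The squares of the vector harmonics of
degree `ℓ` sum to the constant `(2ℓ+1)/(2π)`, so Cauchy–Schwarz, within a degree and then over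
degrees, bounds the error uniformly by the Sobolev norm times the square root of `∑ (1 - ψ̂(ℓ))²
(2ℓ+1)/(2π) (1+λ_ℓ)^(-σ)`. The weight is at most `ℓ^(1-2σ)`. There are at most `1/ρ` low degrees,
each contributing at most `c₁² ρ^(2σ-1)`, and the high degrees form the tail of `∑ ℓ^(1-2σ)` from
about `1/ρ` on; both are of order `ρ^(2σ-2)` (`sum_error_le`).

The expansion of `f` itself rests on completeness of the vector harmonics
(`ae_eq_zero_of_ip_eq_zero`): orthogonality to all of them kills the moments of flux of `g` and of
`y × g`, and an induction on the degree then kills all moments of both fields. -/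

/-! ### Legendre polynomials -/

open Polynomial in
theorem iterate_derivative_ode (ℓ : ℕ) (u : ℝ[X])
    (h : (X ^ 2 - 1) * derivative u = 2 * (ℓ : ℝ[X]) * X * u) :
    (1 - X ^ 2) * derivative^[ℓ + 2] u - 2 * X * derivative^[ℓ + 1] u
      + (ℓ * (ℓ + 1) : ℝ[X]) * derivative^[ℓ] u = 0 := by
  -- One derivative of the hypothesis, arranged so that the Leibniz rule for products with `X` and
  -- `X ^ 2` performs the remaining `ℓ`.
  have h1 : derivative^[2] u * X ^ 2 = derivative^[2] u
      + ((2 * ℓ - 2 : ℝ) • (derivative u * X) + (2 * ℓ : ℝ) • u) := by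
    have := congrArg derivative h
    simp only [derivative_mul, derivative_sub, derivative_X_pow, derivative_one, derivative_X,
      derivative_natCast, derivative_ofNat] at this
    simp only [Function.iterate_succ, Function.iterate_zero, Function.comp, id, smul_eq_C_mul,
      map_sub, map_mul, map_natCast, map_ofNat]
    simp only [map_ofNat, Nat.cast_ofNat] at this
    linear_combination this
  have h2 := congrArg (derivative^[ℓ]) h1
  rw [iterate_derivative_derivative_mul_X_sq, iterate_map_add, iterate_map_add,
    iterate_derivative_smul, iterate_derivative_smul, iterate_derivative_derivative_mul_X,
    ← Function.iterate_add_apply] at h2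
  simp only [nsmul_eq_mul, smul_eq_C_mul, map_sub, map_mul, map_natCast, map_ofNat] at h2
  have h3 : ((ℓ * (ℓ - 1) : ℕ) : ℝ[X]) = ℓ * (ℓ - 1) := by
    rcases ℓ with _ | n
    · simp
    · push_cast; simp
  rw [h3] at h2
  push_cast at h2
  linear_combination -h2

open Polynomial in
theorem legendreP_ode (ℓ : ℕ) :
    (1 - X ^ 2) * derivative (derivative (legendreP ℓ)) - 2 * X * derivative (legendreP ℓ)
      + C (lam ℓ) * legendreP ℓ = 0 := by
  have h := iterate_derivative_ode ℓ ((X ^ 2 - 1) ^ ℓ) (by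
    rw [derivative_pow]
    rcases ℓ with _ | n
    · simp
    · simp only [derivative_sub, derivative_X_pow, derivative_one, Nat.add_sub_cancel, map_natCast]
      push_cast; ring)
  have e1 : derivative (legendreP ℓ) = C ((2 ^ ℓ * (ℓ.factorial : ℝ))⁻¹) *
      derivative^[ℓ + 1] ((X ^ 2 - 1) ^ ℓ) := by
    rw [legendreP, derivative_C_mul, ← Function.iterate_succ_apply' derivative]
  have e2 : derivative (derivative (legendreP ℓ)) = C ((2 ^ ℓ * (ℓ.factorial : ℝ))⁻¹) *
      derivative^[ℓ + 2] ((X ^ 2 - 1) ^ ℓ) := by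
    rw [e1, derivative_C_mul, ← Function.iterate_succ_apply' derivative]
  rw [e2, e1, legendreP, lam]
  simp only [map_mul, map_add, map_natCast, map_one]
  linear_combination C ((2 ^ ℓ * (ℓ.factorial : ℝ))⁻¹) * h

theorem legendreP_eval_ode (ℓ : ℕ) (t : ℝ) :
    (1 - t ^ 2) * (legendreP ℓ).derivative.derivative.eval t
      - 2 * t * (legendreP ℓ).derivative.eval t + lam ℓ * (legendreP ℓ).eval t = 0 := by
  have := congrArg (Polynomial.eval t) (legendreP_ode ℓ)
  simpa using this

open Polynomial in
theorem legendreP_eval_one (ℓ : ℕ) : (legendreP ℓ).eval 1 = 1 := by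
  have h : derivative^[ℓ] ((X ^ 2 - 1 : ℝ[X]) ^ ℓ) = derivative^[ℓ] ((X - C 1) ^ ℓ * (X + C 1) ^ ℓ) := by
    rw [← mul_pow]; congr 2; simp only [map_one]; ring
  have h2 : (derivative^[ℓ] ((X - C 1 : ℝ[X]) ^ ℓ * (X + C 1) ^ ℓ)).eval 1
      = (ℓ.factorial : ℝ) * 2 ^ ℓ := by
    -- At `1` only the Leibniz term with all `ℓ` derivatives on `(X - 1) ^ ℓ` survives.
    rw [iterate_derivative_mul, eval_finsetSum,
      Finset.sum_eq_single_of_mem 0 (Finset.mem_range.mpr ℓ.succ_pos)]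
    · rw [ℓ.choose_zero_right, one_smul, eval_mul, Nat.sub_zero, iterate_derivative_X_sub_pow_self]
      simp; norm_num
    · intro b hb hb0
      rw [iterate_derivative_X_sub_pow, eval_smul, eval_mul, eval_smul, eval_pow,
        Nat.sub_sub_self (Finset.mem_range_succ_iff.mp hb)]
      simp [hb0]
  rw [legendreP, h, eval_mul, h2, eval_C]
  have : (ℓ.factorial : ℝ) ≠ 0 := by exact_mod_cast ℓ.factorial_ne_zero
  field_simp

theorem legendreP_derivative_eval_one (ℓ : ℕ) : (legendreP ℓ).derivative.eval 1 = lam ℓ / 2 := by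
  have := legendreP_eval_ode ℓ 1
  rw [legendreP_eval_one] at this
  linarith

open Polynomial in
theorem legendreP_coeff (ℓ a : ℕ) : (legendreP ℓ).coeff a = (2 ^ ℓ * (ℓ.factorial : ℝ))⁻¹ *
    ((a + ℓ).descFactorial ℓ * if 2 ∣ a + ℓ then ((X - 1 : ℝ[X]) ^ ℓ).coeff ((a + ℓ) / 2) else 0) := by
  have : ((X ^ 2 - 1 : ℝ[X]) ^ ℓ) = expand ℝ 2 ((X - 1) ^ ℓ) := by simp
  rw [legendreP, coeff_C_mul, coeff_iterate_derivative, this, coeff_expand (by norm_num),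
    nsmul_eq_mul]

theorem legendreP_coeff_eq_zero_of_parity {ℓ a : ℕ} (h : ¬ 2 ∣ a + ℓ) :
    (legendreP ℓ).coeff a = 0 := by
  simp [legendreP_coeff, h]

open Polynomial in
theorem legendreP_coeff_self_ne_zero (ℓ : ℕ) : (legendreP ℓ).coeff ℓ ≠ 0 := by
  have h1 : (X - 1 : ℝ[X]) = X - C 1 := by simp
  have : ((X - 1 : ℝ[X]) ^ ℓ).coeff ℓ = 1 := by
    have hm : ((X - C 1 : ℝ[X]) ^ ℓ).Monic := (monic_X_sub_C 1).pow ℓ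
    have hd : ((X - C 1 : ℝ[X]) ^ ℓ).natDegree = ℓ := by
      rw [natDegree_pow, natDegree_X_sub_C, mul_one]
    rw [h1]; have := hm.coeff_natDegree; rwa [hd] at this
  rw [legendreP_coeff, if_pos ⟨ℓ, by ring⟩, show (ℓ + ℓ) / 2 = ℓ by omega, this]
  have h2 : (ℓ.factorial : ℝ) ≠ 0 := by exact_mod_cast ℓ.factorial_ne_zero
  have h3 : ((ℓ + ℓ).descFactorial ℓ : ℝ) ≠ 0 := by
    rw [Nat.cast_ne_zero, Ne, Nat.descFactorial_eq_zero_iff_lt]; omega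
  positivity

open Polynomial in
theorem legendreP_natDegree (ℓ : ℕ) : (legendreP ℓ).natDegree = ℓ := by
  apply le_antisymm
  · refine (natDegree_C_mul_le _ _).trans ((natDegree_iterate_derivative _ _).trans ?_)
    have : ((X ^ 2 - 1 : ℝ[X]) ^ ℓ).natDegree ≤ 2 * ℓ := by
      refine natDegree_pow_le.trans ?_
      have : (X ^ 2 - 1 : ℝ[X]).natDegree ≤ 2 := by compute_degree
      nlinarith
    omega
  · exact le_natDegree_of_ne_zero (legendreP_coeff_self_ne_zero ℓ)

/-- The recursion of the coefficients of a Legendre polynomial. -/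
theorem legendreP_coeff_recursion (ℓ a : ℕ) :
    ((a + 2) * (a + 1) : ℝ) * (legendreP ℓ).coeff (a + 2)
      + (lam ℓ - a * (a + 1)) * (legendreP ℓ).coeff a = 0 := by
  have h := congrArg (fun p => Polynomial.coeff p a) (legendreP_ode ℓ)
  set p := legendreP ℓ
  have e : (1 - Polynomial.X ^ 2) * p.derivative.derivative - 2 * Polynomial.X * p.derivative
      + Polynomial.C (lam ℓ) * p = p.derivative.derivative - p.derivative.derivative * Polynomial.X ^ 2
      - Polynomial.C 2 * (p.derivative * Polynomial.X) + Polynomial.C (lam ℓ) * p := by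
    simp only [map_ofNat]; ring
  simp only [e, Polynomial.coeff_add, Polynomial.coeff_sub, Polynomial.coeff_C_mul,
    Polynomial.coeff_zero, Polynomial.coeff_mul_X_pow', Polynomial.coeff_derivative] at h
  rcases a with _ | _ | a
  · simp [Polynomial.coeff_derivative] at h ⊢; linarith
  · simp [Polynomial.coeff_derivative, Polynomial.coeff_mul_X] at h ⊢; linarith
  · simp [Polynomial.coeff_derivative, Polynomial.coeff_mul_X] at h ⊢; linarith

theorem exists_legendre_expansion (n : ℕ) (q : Polynomial ℝ) (hq : q.natDegree ≤ n) :
    ∃ a : ℕ → ℝ, q = ∑ ℓ ∈ Finset.range (n + 1), Polynomial.C (a ℓ) * legendreP ℓ := by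
  induction n generalizing q with
  | zero =>
    refine ⟨fun _ => q.coeff 0, ?_⟩
    have : legendreP 0 = 1 := by simp [legendreP]
    rw [Polynomial.eq_C_of_natDegree_le_zero hq]
    simp [this]
  | succ n ih =>
    set c := q.coeff (n + 1) / (legendreP (n + 1)).coeff (n + 1)
    have h1 : (q - Polynomial.C c * legendreP (n + 1)).natDegree ≤ n := by
      rw [Polynomial.natDegree_le_iff_coeff_eq_zero]
      intro N hN
      rcases Nat.lt_or_ge (n + 1) N with h | h
      · rw [Polynomial.coeff_sub, Polynomial.coeff_C_mul, Polynomial.coeff_eq_zero_of_natDegree_lt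
          (by omega), Polynomial.coeff_eq_zero_of_natDegree_lt (by rw [legendreP_natDegree]; omega)]
        simp
      · obtain rfl : N = n + 1 := by omega
        rw [Polynomial.coeff_sub, Polynomial.coeff_C_mul, div_mul_cancel₀ _
          (legendreP_coeff_self_ne_zero _), sub_self]
    obtain ⟨a, ha⟩ := ih _ h1
    refine ⟨fun ℓ => if ℓ = n + 1 then c else a ℓ, ?_⟩
    rw [Finset.sum_range_succ]
    beta_reduce
    rw [if_pos rfl, ← sub_eq_iff_eq_add, ha]
    refine Finset.sum_congr rfl fun ℓ hℓ => ?_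
    rw [if_neg (by rw [Finset.mem_range] at hℓ; omega)]

theorem intervalIntegrable_eval (q : Polynomial ℝ) (a b : ℝ) :
    IntervalIntegrable (fun t => q.eval t) volume a b :=
  q.continuous.intervalIntegrable a b

theorem continuous_eval_mul_eval (p q : Polynomial ℝ) :
    Continuous fun t => p.eval t * q.eval t := p.continuous.mul q.continuous

theorem lam_strictMono : StrictMono lam := by
  refine strictMono_nat_of_lt_succ fun n => ?_
  simp only [lam]; push_cast; nlinarith

theorem lam_pos {ℓ : ℕ} (h : 1 ≤ ℓ) : 0 < lam ℓ := by
  have : (1 : ℝ) ≤ ℓ := by exact_mod_cast h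
  unfold lam; positivity

/-- Lagrange's identity: `(1 - t²)(p'q - q'p)` vanishes at both endpoints and has derivative `(λ_m -
λ_ℓ) p q`. -/
theorem legendreP_orthogonal {ℓ m : ℕ} (h : ℓ ≠ m) :
    ∫ t in (-1 : ℝ)..1, (legendreP ℓ).eval t * (legendreP m).eval t = 0 := by
  set p := legendreP ℓ
  set q := legendreP m
  have hd : ∀ t ∈ Set.uIcc (-1 : ℝ) 1, HasDerivAt (fun t => (1 - t ^ 2) *
      (p.derivative.eval t * q.eval t - q.derivative.eval t * p.eval t))
      ((lam m - lam ℓ) * (p.eval t * q.eval t)) t := by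
    intro t _
    have h1 := (((hasDerivAt_id t).pow 2).const_sub 1).mul
      (((p.derivative.hasDerivAt t).mul (q.hasDerivAt t)).sub
        ((q.derivative.hasDerivAt t).mul (p.hasDerivAt t)))
    refine h1.congr_deriv ?_
    have a := legendreP_eval_ode ℓ t
    have b := legendreP_eval_ode m t
    simp only [id, Pi.mul_apply, Pi.sub_apply, Pi.pow_apply]
    simp only [p, q]
    push_cast
    linear_combination (legendreP m).eval t * a - (legendreP ℓ).eval t * b
  have h2 := intervalIntegral.integral_eq_sub_of_hasDerivAt hd
    (((continuous_eval_mul_eval p q).const_mul _).intervalIntegrable _ _)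
  rw [intervalIntegral.integral_const_mul] at h2
  have h3 : lam m - lam ℓ ≠ 0 := sub_ne_zero.2 fun e => h (lam_strictMono.injective e).symm
  have h4 : (lam m - lam ℓ) * ∫ t in (-1 : ℝ)..1, p.eval t * q.eval t = 0 := by
    rw [h2]; norm_num
  exact (mul_eq_zero.1 h4).resolve_left h3

theorem legendreP_orthogonal_of_natDegree_lt {ℓ : ℕ} {q : Polynomial ℝ} (h : q.natDegree < ℓ) :
    ∫ t in (-1 : ℝ)..1, q.eval t * (legendreP ℓ).eval t = 0 := by
  obtain ⟨a, ha⟩ := exists_legendre_expansion (ℓ - 1) q (by omega)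
  have e : ∀ t, q.eval t * (legendreP ℓ).eval t = ∑ m ∈ Finset.range (ℓ - 1 + 1),
      a m * ((legendreP m).eval t * (legendreP ℓ).eval t) := by
    intro t
    conv_lhs => rw [ha]
    simp [Polynomial.eval_finsetSum, Finset.sum_mul, mul_assoc]
  simp_rw [e]
  rw [intervalIntegral.integral_finsetSum fun m _ =>
    (((continuous_eval_mul_eval (legendreP m) (legendreP ℓ)).const_mul _).intervalIntegrable _ _)]
  refine Finset.sum_eq_zero fun m hm => ?_
  rw [intervalIntegral.integral_const_mul, legendreP_orthogonal, mul_zero]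
  rw [Finset.mem_range] at hm; omega

theorem legendreP_integral_sq (ℓ : ℕ) :
    ∫ t in (-1 : ℝ)..1, (legendreP ℓ).eval t * (legendreP ℓ).eval t = 2 / (2 * ℓ + 1) := by
  rcases Nat.eq_zero_or_pos ℓ with rfl | hℓ
  · norm_num [legendreP]
  set p := legendreP ℓ with hp
  -- The weight `1 + t` kills the boundary term at `-1`, so only the value at `1` is needed. In `X
  -- p' - ℓ p + p'` the leading terms cancel, so that polynomial has degree below `ℓ` and is
  -- orthogonal to `p`.
  have hd : ∀ t ∈ Set.uIcc (-1 : ℝ) 1, HasDerivAt (fun t => (1 + t) * (p.eval t * p.eval t))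
      ((2 * ℓ + 1) * (p.eval t * p.eval t) + 2 *
        ((Polynomial.X * p.derivative - Polynomial.C (ℓ : ℝ) * p + p.derivative).eval t * p.eval t)) t := by
    intro t _
    have h1 := ((hasDerivAt_id t).const_add 1).mul ((p.hasDerivAt t).mul (p.hasDerivAt t))
    refine h1.congr_deriv ?_
    simp
    ring
  have hdeg : (Polynomial.X * p.derivative - Polynomial.C (ℓ : ℝ) * p + p.derivative).natDegree
      < ℓ := by
    rw [Nat.lt_iff_le_pred hℓ, Polynomial.natDegree_le_iff_coeff_eq_zero]
    intro N hN
    obtain ⟨k, rfl⟩ : ∃ k, N = k + 1 := ⟨N - 1, by omega⟩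
    have h2 : p.coeff (k + 1 + 1) = 0 :=
      Polynomial.coeff_eq_zero_of_natDegree_lt (by rw [hp, legendreP_natDegree]; omega)
    simp only [Polynomial.coeff_add, Polynomial.coeff_sub, Polynomial.coeff_C_mul,
      Polynomial.coeff_X_mul, Polynomial.coeff_derivative, h2]
    rcases Nat.lt_or_ge ℓ (k + 1) with h | h
    · rw [Polynomial.coeff_eq_zero_of_natDegree_lt (p := p) (by rw [hp, legendreP_natDegree]; omega)]
      simp
    · obtain rfl : ℓ = k + 1 := by omega
      push_cast; ring
  have h2 := intervalIntegral.integral_eq_sub_of_hasDerivAt hd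
    ((((continuous_eval_mul_eval p p).const_mul _).add
      ((continuous_eval_mul_eval _ p).const_mul _)).intervalIntegrable _ _)
  rw [intervalIntegral.integral_add
    (((continuous_eval_mul_eval p p).const_mul _).intervalIntegrable _ _)
    (((continuous_eval_mul_eval _ p).const_mul _).intervalIntegrable _ _),
    intervalIntegral.integral_const_mul, intervalIntegral.integral_const_mul,
    legendreP_orthogonal_of_natDegree_lt hdeg, hp, legendreP_eval_one] at h2
  rw [eq_div_iff (by positivity), mul_comm]
  linarith

/-- From `|P| ≤ (P² + 1)/2` and `∫ P² ≤ 2`. This serves in place of the pointwise bound `|P_ℓ| ≤ 1`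
when Fourier–Legendre coefficients are estimated. -/
theorem integral_abs_legendreP_le (ℓ : ℕ) :
    ∫ t in (-1 : ℝ)..1, |(legendreP ℓ).eval t| ≤ 2 := by
  have hc := (legendreP ℓ).continuous
  have h1 : ∫ t in (-1 : ℝ)..1, |(legendreP ℓ).eval t| ≤
      ∫ t in (-1 : ℝ)..1, (2⁻¹ * ((legendreP ℓ).eval t * (legendreP ℓ).eval t) + 2⁻¹) := by
    refine intervalIntegral.integral_mono_on (by norm_num) (hc.abs.intervalIntegrable _ _)
      ((((continuous_eval_mul_eval (legendreP ℓ) (legendreP ℓ)).const_mul _).add continuous_const).intervalIntegrable _ _) fun t _ => ?_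
    nlinarith [sq_nonneg (|(legendreP ℓ).eval t| - 1), abs_mul_abs_self ((legendreP ℓ).eval t)]
  refine h1.trans ?_
  rw [intervalIntegral.integral_add (((continuous_eval_mul_eval (legendreP ℓ) (legendreP ℓ)).const_mul _).intervalIntegrable _ _)
    (continuous_const.intervalIntegrable _ _), intervalIntegral.integral_const_mul,
    legendreP_integral_sq, intervalIntegral.integral_const]
  have : (2 : ℝ) / (2 * ℓ + 1) ≤ 2 := div_le_self (by norm_num) (by linarith [(Nat.cast_nonneg ℓ : (0 : ℝ) ≤ ℓ)])
  norm_num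
  linarith

/-- Legendre's equation in divergence form, `((1 - t²) P')' = -λ P`. The factor `1 - t²` is what
cancels the denominator of `kappa`. -/
theorem integral_legendreP_eq {ℓ : ℕ} (hℓ : 1 ≤ ℓ) (t : ℝ) :
    ∫ s in (-1 : ℝ)..t, (legendreP ℓ).eval s
      = -((1 - t ^ 2) * (legendreP ℓ).derivative.eval t) / lam ℓ := by
  set p := legendreP ℓ
  have hl := (lam_pos hℓ).ne'
  have hd : ∀ s ∈ Set.uIcc (-1 : ℝ) t, HasDerivAt
      (fun t => -((1 - t ^ 2) * p.derivative.eval t) / lam ℓ) (p.eval s) s := by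
    intro s _
    have h1 := ((((hasDerivAt_id s).pow 2).const_sub 1).mul (p.derivative.hasDerivAt s)).neg.div_const
      (lam ℓ)
    refine h1.congr_deriv ?_
    have a := legendreP_eval_ode ℓ s
    rw [div_eq_iff hl]
    simp only [id, Pi.pow_apply]
    simp only [p]
    push_cast
    linear_combination -a
  rw [intervalIntegral.integral_eq_sub_of_hasDerivAt hd (intervalIntegrable_eval _ _ _)]
  norm_num

theorem zonalCoeff_sum (N : ℕ) (a : ℕ → ℝ) (ℓ : ℕ) :
    zonalCoeff (fun t => (∑ m ∈ Finset.range N, Polynomial.C (a m) * legendreP m).eval t) ℓ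
      = if ℓ < N then 4 * Real.pi / (2 * ℓ + 1) * a ℓ else 0 := by
  have e : ∀ t, (∑ m ∈ Finset.range N, Polynomial.C (a m) * legendreP m).eval t * (legendreP ℓ).eval t
      = ∑ m ∈ Finset.range N, a m * ((legendreP m).eval t * (legendreP ℓ).eval t) := by
    intro t; simp [Polynomial.eval_finsetSum, Finset.sum_mul, mul_assoc]
  simp_rw [zonalCoeff, e]
  rw [intervalIntegral.integral_finsetSum fun m _ =>
    (((continuous_eval_mul_eval (legendreP m) (legendreP ℓ)).const_mul _).intervalIntegrable _ _)]
  simp_rw [intervalIntegral.integral_const_mul]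
  split_ifs with h
  · rw [Finset.sum_eq_single_of_mem ℓ (Finset.mem_range.2 h) fun m _ hm => by
      rw [legendreP_orthogonal hm, mul_zero], legendreP_integral_sq]
    ring
  · rw [Finset.sum_eq_zero, mul_zero]
    intro m hm
    rw [legendreP_orthogonal, mul_zero]
    rintro rfl
    exact h (Finset.mem_range.1 hm)

open scoped Pointwise

/-! ### Coordinates -/

theorem inner_eq_sum_three (x y : E3) : inner ℝ x y = x 0 * y 0 + x 1 * y 1 + x 2 * y 2 := by
  simp [PiLp.inner_apply, Fin.sum_univ_three]; ring

@[simp] theorem cross_apply_zero (x y : E3) : cross x y 0 = x 1 * y 2 - x 2 * y 1 := by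
  simp [cross, cross_apply]

@[simp] theorem cross_apply_one (x y : E3) : cross x y 1 = x 2 * y 0 - x 0 * y 2 := by
  simp [cross, cross_apply]

@[simp] theorem cross_apply_two (x y : E3) : cross x y 2 = x 0 * y 1 - x 1 * y 0 := by
  simp [cross, cross_apply]

theorem ext_three {x y : E3} (h0 : x 0 = y 0) (h1 : x 1 = y 1) (h2 : x 2 = y 2) : x = y := by
  ext i; fin_cases i <;> assumption

theorem inner_self_sphere (x : S2) : inner ℝ (x : E3) (x : E3) = 1 := by
  rw [real_inner_self_eq_norm_sq, norm_eq_of_mem_sphere]; norm_num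

theorem cross_add_right (x y z : E3) : cross x (y + z) = cross x y + cross x z :=
  ext_three (by simp; ring) (by simp; ring) (by simp; ring)

theorem cross_smul_right (c : ℝ) (x y : E3) : cross x (c • y) = c • cross x y :=
  ext_three (by simp; ring) (by simp; ring) (by simp; ring)

theorem cross_self (x : E3) : cross x x = 0 :=
  ext_three (by simp; ring) (by simp; ring) (by simp; ring)

theorem inner_cross_self_left (x y : E3) : inner ℝ x (cross x y) = 0 := by
  rw [inner_eq_sum_three]; simp; ring

theorem inner_cross_self_right (x y : E3) : inner ℝ y (cross x y) = 0 := by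
  rw [inner_eq_sum_three]; simp; ring

/-- Cyclic invariance of the triple product. -/
theorem inner_cross_cyclic (x y z : E3) : inner ℝ x (cross y z) = inner ℝ z (cross x y) := by
  simp only [inner_eq_sum_three, cross_apply_zero, cross_apply_one, cross_apply_two]; ring

theorem inner_cross_cross (x y z w : E3) : inner ℝ (cross x y) (cross z w)
    = inner ℝ x z * inner ℝ y w - inner ℝ x w * inner ℝ y z := by
  simp only [inner_eq_sum_three, cross_apply_zero, cross_apply_one, cross_apply_two]; ring

theorem norm_cross_le (x y : E3) : ‖cross x y‖ ≤ ‖x‖ * ‖y‖ := by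
  refine abs_le_of_sq_le_sq' ?_ (by positivity) |>.2
  rw [← real_inner_self_eq_norm_sq, inner_cross_cross, mul_pow, real_inner_self_eq_norm_sq,
    real_inner_self_eq_norm_sq, real_inner_comm x y]
  nlinarith [mul_self_nonneg (inner ℝ x y)]

theorem continuous_cross : Continuous fun p : E3 × E3 => cross p.1 p.2 := by
  unfold cross
  simp only [cross_apply]
  refine (PiLp.continuous_toLp 2 _).comp (continuous_pi fun i => ?_)
  fin_cases i <;> simp <;> fun_prop

theorem _root_.Continuous.sphere_cross {α : Type*} [TopologicalSpace α] {f g : α → E3}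
    (hf : Continuous f) (hg : Continuous g) : Continuous fun a => cross (f a) (g a) :=
  continuous_cross.comp (hf.prodMk hg)

/-! ### Polynomials as functions -/

theorem continuous_evalAt (p : MvPolynomial (Fin 3) ℝ) : Continuous (evalAt p) := by
  unfold evalAt
  exact (MvPolynomial.continuous_eval p).comp (PiLp.continuous_ofLp 2 _)

theorem continuous_grad (p : MvPolynomial (Fin 3) ℝ) : Continuous (grad p) := by
  unfold grad
  exact (PiLp.continuous_toLp 2 _).comp (continuous_pi fun i => continuous_evalAt _)

theorem grad_apply (p : MvPolynomial (Fin 3) ℝ) (x : E3) (i : Fin 3) :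
    grad p x i = evalAt (MvPolynomial.pderiv i p) x := rfl

theorem evalAt_add (p q : MvPolynomial (Fin 3) ℝ) (x : E3) :
    evalAt (p + q) x = evalAt p x + evalAt q x := by simp [evalAt]

theorem evalAt_mul (p q : MvPolynomial (Fin 3) ℝ) (x : E3) :
    evalAt (p * q) x = evalAt p x * evalAt q x := by simp [evalAt]

theorem evalAt_smul (c : ℝ) (p : MvPolynomial (Fin 3) ℝ) (x : E3) :
    evalAt (c • p) x = c * evalAt p x := by simp [evalAt]

theorem evalAt_sum {ι : Type*} (s : Finset ι) (p : ι → MvPolynomial (Fin 3) ℝ) (x : E3) :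
    evalAt (∑ i ∈ s, p i) x = ∑ i ∈ s, evalAt (p i) x := by simp [evalAt]

theorem hasDerivAt_evalAt_comp (p : MvPolynomial (Fin 3) ℝ) {c : ℝ → E3} {c' : E3} {t : ℝ}
    (hc : HasDerivAt c c' t) :
    HasDerivAt (fun s => evalAt p (c s)) (inner ℝ (grad p (c t)) c') t := by
  have hci : ∀ i, HasDerivAt (fun s => c s i) (c' i) t := fun i =>
    ((EuclideanSpace.proj (𝕜 := ℝ) i).hasFDerivAt.comp_hasDerivAt t hc)
  induction p using MvPolynomial.induction_on with
  | C a => simpa [evalAt, inner_eq_sum_three, grad_apply] using hasDerivAt_const t a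
  | add p q hp hq =>
    refine ((hp.add hq).congr_of_eventuallyEq ?_).congr_deriv ?_
    · exact Filter.Eventually.of_forall fun s => evalAt_add p q _
    · simp only [inner_eq_sum_three, grad_apply, map_add, evalAt_add]; ring
  | mul_X p i hp =>
    refine ((hp.mul (hci i)).congr_of_eventuallyEq ?_).congr_deriv ?_
    · exact Filter.Eventually.of_forall fun s => by simp [evalAt]
    · simp only [inner_eq_sum_three, grad_apply, Derivation.leibniz, smul_eq_mul, evalAt_add,
        evalAt_mul]
      fin_cases i <;> simp [MvPolynomial.pderiv_X, evalAt] <;> ring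

/-! ### The surface measure -/

instance : IsFiniteMeasure surf := by unfold surf; infer_instance

instance : Measure.IsOpenPosMeasure surf := by unfold surf; infer_instance

theorem surf_real_univ : surf.real Set.univ = 4 * Real.pi := by
  rw [surf, Measure.toSphere_real_apply_univ, measureReal_def,
    EuclideanSpace.volume_ball_fin_three]
  rw [finrank_euclideanSpace, Fintype.card_fin, ENNReal.toReal_mul, ENNReal.toReal_pow]
  simp [ENNReal.toReal_ofReal (by positivity : 0 ≤ Real.pi * 4 / 3)]
  ring

theorem integrable_of_continuous_sphere {E : Type*} [NormedAddCommGroup E] {f : S2 → E}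
    (hf : Continuous f) [SecondCountableTopologyEither S2 E] : Integrable f surf := by
  obtain ⟨C, hC⟩ := (isCompact_range hf).isBounded.exists_norm_le
  exact (integrable_const C).mono' hf.aestronglyMeasurable
    (Filter.Eventually.of_forall fun x => hC _ ⟨x, rfl⟩)

/-- The cone over a point lies in a line, a null set of three-space. Hence the excluded points `y =
±x` of the kernel do not matter. -/
theorem surf_singleton (x : S2) : surf {x} = 0 := by
  rw [surf, Measure.toSphere_apply' _ (measurableSet_singleton x)]
  have h : (volume : Measure E3) ((ℝ ∙ (x : E3) : Submodule ℝ E3) : Set E3) = 0 := by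
    refine Measure.addHaar_submodule _ _ fun h => ?_
    have h1 := finrank_span_singleton (K := ℝ) (v := (x : E3)) (ne_zero_of_mem_unit_sphere x)
    rw [h, finrank_top, finrank_euclideanSpace] at h1
    simp at h1
  have h2 : Set.Ioo (0 : ℝ) 1 • (Subtype.val '' ({x} : Set S2)) ⊆
      ((ℝ ∙ (x : E3) : Submodule ℝ E3) : Set E3) := by
    rintro _ ⟨r, _, _, ⟨y, rfl, rfl⟩, rfl⟩
    exact Submodule.smul_mem _ _ (Submodule.mem_span_singleton_self _)
  rw [measure_mono_null h2 h, mul_zero]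

/-- The restriction of a linear isometry to the sphere. -/
def sphereMap (R : E3 ≃ₗᵢ[ℝ] E3) (x : S2) : S2 := ⟨R x, by simp⟩

theorem measurableEmbedding_sphereMap (R : E3 ≃ₗᵢ[ℝ] E3) : MeasurableEmbedding (sphereMap R) :=
  Continuous.measurableEmbedding
    (Continuous.subtype_mk (R.continuous.comp continuous_subtype_val) _)
    fun _ _ h => Subtype.ext (R.injective (congrArg Subtype.val h))

theorem measurePreserving_sphereMap (R : E3 ≃ₗᵢ[ℝ] E3) :
    MeasurePreserving (sphereMap R) surf surf := by
  have hm : Measurable (sphereMap R) :=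
    (Continuous.subtype_mk (R.continuous.comp continuous_subtype_val) _).measurable
  refine ⟨hm, Measure.ext fun s hs => ?_⟩
  rw [Measure.map_apply hm hs, surf, Measure.toSphere_apply' _ hs,
    Measure.toSphere_apply' _ (hm hs)]
  congr 1
  have h : Set.Ioo (0 : ℝ) 1 • (Subtype.val '' (sphereMap R ⁻¹' s)) =
      R ⁻¹' (Set.Ioo (0 : ℝ) 1 • (Subtype.val '' s)) := by
    ext z
    constructor
    · rintro ⟨r, hr, _, ⟨y, hy, rfl⟩, rfl⟩
      exact ⟨r, hr, R y, ⟨sphereMap R y, hy, rfl⟩, by simp⟩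
    · rintro ⟨r, hr, _, ⟨y, hy, rfl⟩, h⟩
      refine ⟨r, hr, R.symm y, ⟨sphereMap R.symm y, ?_, rfl⟩, ?_⟩
      · have : sphereMap R (sphereMap R.symm y) = y := Subtype.ext (by simp [sphereMap])
        rwa [Set.mem_preimage, this]
      · apply R.injective
        simpa using h
  rw [h, R.measurePreserving.measure_preimage_emb R.toHomeomorph.measurableEmbedding]

/-- The rotation by the angle `θ` about the unit vector `e`. -/
def rotation (e : E3) (he : inner ℝ e e = 1) (θ : ℝ) : E3 ≃ₗᵢ[ℝ] E3 :=
  LinearIsometry.toLinearIsometryEquiv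
    { toFun := fun x => Real.cos θ • x + Real.sin θ • cross e x
        + ((1 - Real.cos θ) * inner ℝ e x) • e
      map_add' := fun x y => by
        rw [cross_add_right, inner_add_right]; module
      map_smul' := fun c x => by
        rw [cross_smul_right, inner_smul_right]; simp only [RingHom.id_apply]; module
      norm_map' := fun x => by
        rw [← sq_eq_sq₀ (norm_nonneg _) (norm_nonneg _), ← real_inner_self_eq_norm_sq,
          ← real_inner_self_eq_norm_sq]
        change inner ℝ (Real.cos θ • x + Real.sin θ • cross e x + ((1 - Real.cos θ) * inner ℝ e x) • e)
          (Real.cos θ • x + Real.sin θ • cross e x + ((1 - Real.cos θ) * inner ℝ e x) • e) = _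
        simp only [inner_add_left, inner_add_right, inner_smul_left, inner_smul_right,
          inner_cross_self_left, inner_cross_self_right, inner_cross_cross, he,
          real_inner_comm _ (cross e x), real_inner_comm e x]
        simp
        linear_combination (‖x‖ ^ 2 - inner ℝ e x ^ 2) * Real.sin_sq_add_cos_sq θ } rfl

theorem rotation_apply (e : E3) (he : inner ℝ e e = 1) (θ : ℝ) (x : E3) :
    rotation e he θ x = Real.cos θ • x + Real.sin θ • cross e x
        + ((1 - Real.cos θ) * inner ℝ e x) • e := rfl

theorem hasDerivAt_rotation (e : E3) (he : inner ℝ e e = 1) (θ : ℝ) (x : E3) :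
    HasDerivAt (fun θ => rotation e he θ x) (cross e (rotation e he θ x)) θ := by
  have h := (((Real.hasDerivAt_cos θ).smul_const x).add
    ((Real.hasDerivAt_sin θ).smul_const (cross e x))).add
    ((((Real.hasDerivAt_cos θ).const_sub 1).mul_const (inner ℝ e x)).smul_const e)
  refine (h.congr_of_eventuallyEq (Filter.Eventually.of_forall fun s => rotation_apply e he s x)).congr_deriv ?_
  rw [rotation_apply, cross_add_right, cross_add_right, cross_smul_right, cross_smul_right,
    cross_smul_right, cross_self]
  have : cross e (cross e x) = inner ℝ e x • e - x := by
    rw [inner_eq_sum_three] at *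
    refine ext_three ?_ ?_ ?_ <;> simp
    · linear_combination -x 0 * he
    · linear_combination -x 1 * he
    · linear_combination -x 2 * he
  rw [this]
  module

/-- Rotation invariance in infinitesimal form. -/
theorem integral_inner_grad_cross (p : MvPolynomial (Fin 3) ℝ) (e : E3) (he : inner ℝ e e = 1) :
    ∫ x : S2, inner ℝ (grad p x) (cross e x) ∂surf = 0 := by
  have hcont : Continuous fun x : S2 => inner ℝ (grad p x) (cross e x) :=
    ((continuous_grad p).comp continuous_subtype_val).inner
      (continuous_const.sphere_cross continuous_subtype_val)
  obtain ⟨C, hC⟩ := (isCompact_range hcont).isBounded.exists_norm_le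
  -- The integral over the rotated sphere does not depend on `θ`; differentiating under the integral
  -- at `θ = 0` gives the claim.
  have hconst : ∀ θ, ∫ x : S2, evalAt p (rotation e he θ x) ∂surf = ∫ x : S2, evalAt p x ∂surf := by
    intro θ
    exact (measurePreserving_sphereMap (rotation e he θ)).integral_comp
      (measurableEmbedding_sphereMap _)      (fun x : S2 => evalAt p x)
  have hd := (hasDerivAt_integral_of_dominated_loc_of_deriv_le (μ := surf) (x₀ := (0 : ℝ))
    (s := Set.univ) (bound := fun _ => C)
    (F := fun θ (x : S2) => evalAt p (rotation e he θ x))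
    (F' := fun θ (x : S2) => inner ℝ (grad p (rotation e he θ x)) (cross e (rotation e he θ x)))
    Filter.univ_mem
    (Filter.Eventually.of_forall fun θ => ((continuous_evalAt p).comp
      ((rotation e he θ).continuous.comp continuous_subtype_val)).aestronglyMeasurable)
    (integrable_of_continuous_sphere ((continuous_evalAt p).comp
      ((rotation e he 0).continuous.comp continuous_subtype_val)))
    ((((continuous_grad p).comp ((rotation e he 0).continuous.comp continuous_subtype_val)).inner
      (continuous_const.sphere_cross
        ((rotation e he 0).continuous.comp continuous_subtype_val))).aestronglyMeasurable)
    (Filter.Eventually.of_forall fun x θ _ => hC _ ⟨sphereMap (rotation e he θ) x, rfl⟩)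
    (integrable_const C)
    (Filter.Eventually.of_forall fun x θ _ =>
      hasDerivAt_evalAt_comp p (hasDerivAt_rotation e he θ x))).2
  have h0 : ∀ x : E3, rotation e he 0 x = x := fun x => by simp [rotation_apply]
  simp only [h0, hconst] at hd
  exact hd.unique (hasDerivAt_const _ _)

/-- The infinitesimal rotations `(x × ∇)_a`, as operators on polynomials. -/
def angular (a : Fin 3) (p : MvPolynomial (Fin 3) ℝ) : MvPolynomial (Fin 3) ℝ :=
  MvPolynomial.X (a + 1) * MvPolynomial.pderiv (a + 2) p
    - MvPolynomial.X (a + 2) * MvPolynomial.pderiv (a + 1) p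

theorem evalAt_angular (a : Fin 3) (p : MvPolynomial (Fin 3) ℝ) (x : E3) :
    evalAt (angular a p) x = cross x (grad p x) a := by
  fin_cases a <;> simp [angular, evalAt, grad]

theorem integral_angular (a : Fin 3) (p : MvPolynomial (Fin 3) ℝ) :
    ∫ x : S2, evalAt (angular a p) x ∂surf = 0 := by
  rw [← integral_inner_grad_cross p (EuclideanSpace.single a 1) (by simp)]
  refine integral_congr_ae (Filter.Eventually.of_forall fun x => ?_)
  simp only [evalAt_angular, inner_eq_sum_three]
  fin_cases a <;> simp <;> ring

/-- Integration by parts: `angular a` is a derivation whose values have mean zero. -/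
theorem integral_angular_mul (a : Fin 3) (p q : MvPolynomial (Fin 3) ℝ) :
    ∫ x : S2, evalAt (angular a p) x * evalAt q x ∂surf
      = -∫ x : S2, evalAt p x * evalAt (angular a q) x ∂surf := by
  have hc : ∀ r : MvPolynomial (Fin 3) ℝ, Continuous fun x : S2 => evalAt r x := fun r =>
    (continuous_evalAt r).comp continuous_subtype_val
  have hi : ∀ r s : MvPolynomial (Fin 3) ℝ,
      Integrable (fun x : S2 => evalAt r x * evalAt s x) surf := fun r s =>
    integrable_of_continuous_sphere ((hc r).mul (hc s))
  rw [eq_neg_iff_add_eq_zero, ← integral_add (hi _ _) (hi _ _), ← integral_angular a (p * q)]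
  refine integral_congr_ae (Filter.Eventually.of_forall fun x => ?_)
  simp only [← evalAt_mul, ← evalAt_add]
  congr 1
  simp only [angular, Derivation.leibniz, smul_eq_mul]
  ring

/-! ### Spherical harmonics as eigenfunctions, and Green's identities -/

open MvPolynomial in
theorem pderiv_comm (i j : Fin 3) (p : MvPolynomial (Fin 3) ℝ) :
    pderiv i (pderiv j p) = pderiv j (pderiv i p) := by
  have h : ⁅pderiv (R := ℝ) i, pderiv (R := ℝ) j⁆ = 0 := by
    refine MvPolynomial.derivation_ext fun k => ?_
    rw [Derivation.commutator_apply, pderiv_X, pderiv_X, Pi.single_apply, Pi.single_apply]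
    split_ifs <;> simp
  have h2 := congrArg (fun D => D p) h
  simpa [Derivation.commutator_apply, sub_eq_zero] using h2

theorem mem_harmonicSpace {ℓ : ℕ} {p : MvPolynomial (Fin 3) ℝ} : p ∈ harmonicSpace ℓ ↔
    p.IsHomogeneous ℓ ∧
      ∑ i, MvPolynomial.pderiv i (MvPolynomial.pderiv i p) = 0 := by
  simp [harmonicSpace, LinearMap.sum_apply]

theorem pderiv_X_ite (i j : Fin 3) : MvPolynomial.pderiv (R := ℝ) i (MvPolynomial.X j) =
    if i = j then 1 else 0 := by
  rw [MvPolynomial.pderiv_X, Pi.single_apply]; simp [eq_comm]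

open MvPolynomial in
theorem angular_zero (p : MvPolynomial (Fin 3) ℝ) :
    angular 0 p = X 1 * pderiv 2 p - X 2 * pderiv 1 p := rfl

open MvPolynomial in
theorem angular_one (p : MvPolynomial (Fin 3) ℝ) :
    angular 1 p = X 2 * pderiv 0 p - X 0 * pderiv 2 p := rfl

open MvPolynomial in
theorem angular_two (p : MvPolynomial (Fin 3) ℝ) :
    angular 2 p = X 0 * pderiv 1 p - X 1 * pderiv 0 p := rfl

-- With the Euler operator `E = ∑ X_i ∂_i` the right side is `r² Δ - E² - E`. On a harmonic
-- polynomial homogeneous of degree `ℓ` only `-(ℓ² + ℓ)` remains on the unit sphere.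
open MvPolynomial in
theorem sum_angular_angular_eq (p : MvPolynomial (Fin 3) ℝ) :
    ∑ a, angular a (angular a p) = (∑ i, X i ^ 2) * (∑ i, pderiv i (pderiv i p))
      - ∑ i, X i * pderiv i (∑ j, X j * pderiv j p) - ∑ i, X i * pderiv i p := by
  simp only [angular_zero, angular_one, angular_two, Fin.sum_univ_three, Derivation.leibniz,
    map_sub, map_add, smul_eq_mul, pderiv_X_ite]
  simp
  rw [pderiv_comm 1 0, pderiv_comm 2 0, pderiv_comm 2 1]
  ring

theorem evalAt_sum_X_sq (x : S2) : evalAt (∑ i, MvPolynomial.X i ^ 2) x = 1 := by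
  have := inner_self_sphere x
  rw [inner_eq_sum_three] at this
  simp [evalAt, Fin.sum_univ_three]
  linarith

/-- Spherical harmonics are eigenfunctions of the Laplace–Beltrami operator. -/
theorem sum_angular_angular_harmonic {ℓ : ℕ} {p : MvPolynomial (Fin 3) ℝ}
    (hp : p ∈ harmonicSpace ℓ) (x : S2) :
    ∑ a, evalAt (angular a (angular a p)) x = -(lam ℓ * evalAt p x) := by
  obtain ⟨h1, h2⟩ := mem_harmonicSpace.1 hp
  have e := h1.sum_X_mul_pderiv
  have e2 : ∑ i, MvPolynomial.X i * MvPolynomial.pderiv i (ℓ • p) = ℓ • (ℓ • p) := by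
    simp only [map_nsmul, mul_smul_comm, ← Finset.smul_sum, e]
  rw [← evalAt_sum, sum_angular_angular_eq, h2, e, e2]
  simp [evalAt, lam]; ring

theorem continuous_evalAt_sphere (p : MvPolynomial (Fin 3) ℝ) :
    Continuous fun x : S2 => evalAt p x := (continuous_evalAt p).comp continuous_subtype_val

theorem continuous_grad_sphere (p : MvPolynomial (Fin 3) ℝ) :
    Continuous fun x : S2 => grad p x := (continuous_grad p).comp continuous_subtype_val

theorem integrable_evalAt_mul (p q : MvPolynomial (Fin 3) ℝ) :
    Integrable (fun x : S2 => evalAt p x * evalAt q x) surf :=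
  integrable_of_continuous_sphere ((continuous_evalAt_sphere p).mul (continuous_evalAt_sphere q))

/-- Green's identity for the surface curl. -/
theorem integral_surfCurl_surfCurl {ℓ : ℕ} {p : MvPolynomial (Fin 3) ℝ}
    (hp : p ∈ harmonicSpace ℓ) (q : MvPolynomial (Fin 3) ℝ) :
    ∫ x : S2, inner ℝ (surfCurl p x) (surfCurl q x) ∂surf
      = lam ℓ * ∫ x : S2, evalAt p x * evalAt q x ∂surf := by
  have e : ∀ x : S2, inner ℝ (surfCurl p x) (surfCurl q x)
      = ∑ a, evalAt (angular a p) x * evalAt (angular a q) x := by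
    intro x
    simp only [inner_eq_sum_three, surfCurl, Fin.sum_univ_three, evalAt_angular]
  simp_rw [e]
  rw [integral_finsetSum _ fun a _ => integrable_evalAt_mul _ _]
  have e2 : ∀ a, ∫ x : S2, evalAt (angular a p) x * evalAt (angular a q) x ∂surf
      = -∫ x : S2, evalAt (angular a (angular a p)) x * evalAt q x ∂surf := by
    intro a; rw [integral_angular_mul a (angular a p) q, neg_neg]
  simp_rw [e2]
  rw [Finset.sum_neg_distrib, ← integral_finsetSum _ fun a _ => integrable_evalAt_mul _ _]
  simp_rw [← Finset.sum_mul, sum_angular_angular_harmonic hp, neg_mul, mul_assoc]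
  rw [integral_neg, neg_neg, integral_const_mul]

/-- Green's identity read in both orders gives the same integral with the factors `λ_ℓ` and `λ_m`,
which differ. -/
theorem integral_harmonic_orthogonal {ℓ m : ℕ} (h : ℓ ≠ m) {p q : MvPolynomial (Fin 3) ℝ}
    (hp : p ∈ harmonicSpace ℓ) (hq : q ∈ harmonicSpace m) :
    ∫ x : S2, evalAt p x * evalAt q x ∂surf = 0 := by
  have h1 := integral_surfCurl_surfCurl hp q
  have h2 := integral_surfCurl_surfCurl hq p
  simp_rw [real_inner_comm (surfCurl p _), mul_comm (evalAt q _)] at h2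
  rw [h1] at h2
  have h3 : lam ℓ - lam m ≠ 0 := sub_ne_zero.2 fun e => h (lam_strictMono.injective e)
  have h4 : (lam ℓ - lam m) * ∫ x : S2, evalAt p x * evalAt q x ∂surf = 0 := by
    rw [sub_mul]; linarith
  exact (mul_eq_zero.1 h4).resolve_left h3

theorem inner_surfGrad_of_tangent (p : MvPolynomial (Fin 3) ℝ) (x : S2) {w : E3}
    (hw : inner ℝ (x : E3) w = 0) : inner ℝ w (surfGrad p x) = inner ℝ (grad p x) w := by
  rw [surfGrad, inner_sub_right, inner_smul_right, real_inner_comm (x : E3) w, hw, mul_zero,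
    sub_zero, real_inner_comm]

theorem inner_surfCurl (p : MvPolynomial (Fin 3) ℝ) (x : S2) (w : E3) :
    inner ℝ w (surfCurl p x) = inner ℝ (grad p x) (cross w x) := by
  rw [surfCurl, inner_cross_cyclic]

theorem inner_surfGrad_self (p : MvPolynomial (Fin 3) ℝ) (x : S2) :
    inner ℝ (x : E3) (surfGrad p x) = 0 := by
  rw [surfGrad, inner_sub_right, inner_smul_right, inner_self_sphere, mul_one, sub_self]

theorem inner_surfCurl_self (p : MvPolynomial (Fin 3) ℝ) (x : S2) :
    inner ℝ (x : E3) (surfCurl p x) = 0 := inner_cross_self_left _ _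

theorem integral_surfGrad_surfGrad {ℓ : ℕ} {p : MvPolynomial (Fin 3) ℝ}
    (hp : p ∈ harmonicSpace ℓ) (q : MvPolynomial (Fin 3) ℝ) :
    ∫ x : S2, inner ℝ (surfGrad p x) (surfGrad q x) ∂surf
      = lam ℓ * ∫ x : S2, evalAt p x * evalAt q x ∂surf := by
  rw [← integral_surfCurl_surfCurl hp q]
  refine integral_congr_ae (Filter.Eventually.of_forall fun x => ?_)
  beta_reduce
  rw [surfCurl, surfCurl, inner_cross_cross, inner_self_sphere,
    inner_surfGrad_of_tangent q x (inner_surfGrad_self p x), surfGrad, inner_sub_right,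
    inner_smul_right, real_inner_comm (x : E3) (grad q x), real_inner_comm (grad p x) (grad q x),
    real_inner_comm (x : E3) (grad p x)]
  ring

-- This is `(x × ∇) · ∇q = x · (∇ × ∇q) = 0`. After integration by parts it makes surface curls
-- orthogonal to surface gradients.
open MvPolynomial in
theorem sum_angular_pderiv (q : MvPolynomial (Fin 3) ℝ) :
    ∑ a, angular a (pderiv a q) = 0 := by
  simp only [angular_zero, angular_one, angular_two, Fin.sum_univ_three]
  rw [pderiv_comm 1 0, pderiv_comm 2 0, pderiv_comm 2 1]
  ring

theorem integral_surfCurl_surfGrad (p q : MvPolynomial (Fin 3) ℝ) :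
    ∫ x : S2, inner ℝ (surfCurl p x) (surfGrad q x) ∂surf = 0 := by
  have e : ∀ x : S2, inner ℝ (surfCurl p x) (surfGrad q x)
      = ∑ a, evalAt (angular a p) x * evalAt (MvPolynomial.pderiv a q) x := by
    intro x
    rw [inner_surfGrad_of_tangent q x (inner_surfCurl_self p x), real_inner_comm]
    simp only [inner_eq_sum_three, surfCurl, Fin.sum_univ_three, evalAt_angular, grad_apply]
  simp_rw [e]
  rw [integral_finsetSum _ fun a _ => integrable_evalAt_mul _ _]
  simp_rw [integral_angular_mul]
  rw [Finset.sum_neg_distrib, ← integral_finsetSum _ fun a _ => integrable_evalAt_mul _ _]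
  simp_rw [← Finset.mul_sum, ← evalAt_sum, sum_angular_pderiv]
  simp [evalAt]

/-! ### Zonal harmonics -/

/-- The linear form `y ↦ x · y`. -/
def linForm (x : E3) : MvPolynomial (Fin 3) ℝ := ∑ i, MvPolynomial.C (x i) * MvPolynomial.X i

theorem evalAt_linForm (x y : E3) : evalAt (linForm x) y = inner ℝ x y := by
  simp [evalAt, linForm, inner_eq_sum_three, Fin.sum_univ_three]

/-- The homogeneous harmonic polynomial with values `P_ℓ(x · y)` on the sphere. -/
def zonalPoly (ℓ : ℕ) (x : E3) : MvPolynomial (Fin 3) ℝ :=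
  ∑ a ∈ Finset.range (ℓ + 1), MvPolynomial.C ((legendreP ℓ).coeff a) *
    (linForm x ^ a * (∑ i, MvPolynomial.X i ^ 2) ^ ((ℓ - a) / 2))

theorem evalAt_zonalPoly (ℓ : ℕ) (x : E3) (y : S2) :
    evalAt (zonalPoly ℓ x) y = (legendreP ℓ).eval (inner ℝ x (y : E3)) := by
  rw [zonalPoly, evalAt_sum, Polynomial.eval_eq_sum_range, legendreP_natDegree]
  refine Finset.sum_congr rfl fun a _ => ?_
  have h1 := evalAt_sum_X_sq y
  have h2 := evalAt_linForm x y
  simp only [evalAt] at h1 h2 ⊢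
  rw [map_mul, map_mul, map_pow, map_pow, h1, h2, MvPolynomial.eval_C, one_pow, mul_one]

-- Write `L` for the linear form and `N` for the squared radius. Then `|∇L|² = |x|² = 1` gives the
-- coefficient `a(a-1)`, `∇L · ∇N = 2L` gives the cross term `4ab`, and `Δ N^b = 2b(2b+1) N^(b-1)`.
-- The truncated exponents are harmless: wherever they truncate, the coefficient is zero.
open MvPolynomial in
theorem laplacian_linForm_pow_mul (x : S2) (a b : ℕ) :
    ∑ i, pderiv i (pderiv i (linForm x ^ a * (∑ i, X i ^ 2) ^ b))
      = C ((a * (a - 1) : ℕ) : ℝ) * (linForm x ^ (a - 2) * (∑ i, X i ^ 2) ^ b)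
        + C (2 * b * (2 * b + 1) + 4 * a * b : ℝ)
          * (linForm x ^ a * (∑ i, X i ^ 2) ^ (b - 1)) := by
  have hx : (C ((x : E3) 0) ^ 2 + C ((x : E3) 1) ^ 2 + C ((x : E3) 2) ^ 2
      : MvPolynomial (Fin 3) ℝ) = 1 := by
    have := inner_self_sphere x
    rw [inner_eq_sum_three] at this
    rw [← map_pow, ← map_pow, ← map_pow, ← map_add, ← map_add, ← map_one C]
    congr 1; linarith
  have hl : ∀ i, pderiv i (linForm x) = C ((x : E3) i) := by
    intro i
    fin_cases i <;> simp [linForm, Fin.sum_univ_three, pderiv_X]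
  have hn : ∀ i, pderiv i (∑ i, X i ^ 2 : MvPolynomial (Fin 3) ℝ) = 2 * X i := by
    intro i
    fin_cases i <;> simp [Fin.sum_univ_three, pderiv_X]
  have hL : linForm x = C ((x : E3) 0) * X 0 + C ((x : E3) 1) * X 1 + C ((x : E3) 2) * X 2 := by
    simp [linForm, Fin.sum_univ_three]
  have hN : (∑ i, X i ^ 2 : MvPolynomial (Fin 3) ℝ) = X 0 ^ 2 + X 1 ^ 2 + X 2 ^ 2 := by
    simp [Fin.sum_univ_three]
  generalize linForm x = L at hL hl ⊢
  generalize (∑ i, X i ^ 2 : MvPolynomial (Fin 3) ℝ) = N at hN hn ⊢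
  have hc : ∀ i (n : ℕ), pderiv i (n : MvPolynomial (Fin 3) ℝ) = 0 := fun i n => by
    rw [← map_natCast (C (σ := Fin 3) (R := ℝ)), pderiv_C]
  have hc2 : ∀ i, pderiv i (2 : MvPolynomial (Fin 3) ℝ) = 0 := fun i => hc i 2
  have h2 : ∀ i, pderiv i (pderiv i (L ^ a * N ^ b))
      = (a * (a - 1 : ℕ) : MvPolynomial (Fin 3) ℝ) * (L ^ (a - 2) * N ^ b) * C ((x : E3) i) ^ 2
        + 4 * (a * b : MvPolynomial (Fin 3) ℝ) * (L ^ (a - 1) * N ^ (b - 1))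
          * (C ((x : E3) i) * X i)
        + 4 * (b * (b - 1 : ℕ) : MvPolynomial (Fin 3) ℝ) * (L ^ a * N ^ (b - 2)) * X i ^ 2
        + 2 * (b : MvPolynomial (Fin 3) ℝ) * (L ^ a * N ^ (b - 1)) := by
    intro i
    simp only [pderiv_mul, pderiv_pow, hl, hn, map_add, pderiv_X_self, pderiv_C, hc, hc2,
      Nat.sub_sub]
    ring
  rw [Fin.sum_univ_three, h2, h2, h2]
  have ha : (a : MvPolynomial (Fin 3) ℝ) * L ^ (a - 1) * L = a * L ^ a := by
    rcases a with _ | a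
    · simp
    · simp [pow_succ, mul_assoc]
  have hb : (b * (b - 1 : ℕ) : MvPolynomial (Fin 3) ℝ) * N ^ (b - 2) * N
      = b * (b - 1 : ℕ) * N ^ (b - 1) := by
    rcases b with _ | _ | b
    · simp
    · simp
    · simp [pow_succ, mul_assoc]
  have hB : (b * (b - 1 : ℕ) : MvPolynomial (Fin 3) ℝ) = b * (b - 1) := by
    rcases b with _ | b
    · simp
    · simp
  simp only [map_mul, map_add, map_natCast, map_ofNat, map_one, Nat.cast_mul]
  linear_combination (a * (a - 1 : ℕ) : MvPolynomial (Fin 3) ℝ) * L ^ (a - 2) * N ^ b * hx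
    - (4 * a * b : MvPolynomial (Fin 3) ℝ) * L ^ (a - 1) * N ^ (b - 1) * hL
    + 4 * (b : MvPolynomial (Fin 3) ℝ) * N ^ (b - 1) * ha
    - 4 * (b * (b - 1 : ℕ) : MvPolynomial (Fin 3) ℝ) * L ^ a * N ^ (b - 2) * hN
    + 4 * L ^ a * hb + 4 * L ^ a * N ^ (b - 1) * hB

/-- Aligns the powers of the linear form in the two halves of the Laplacian of `zonalPoly`, so that
the coefficient recursion applies term by term. -/
theorem sum_range_shift_two {M : Type*} [AddCommMonoid M] {n : ℕ} (f : ℕ → M) (h0 : f 0 = 0)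
    (h1 : f 1 = 0) (h2 : f (n + 1) = 0) (h3 : f (n + 2) = 0) :
    ∑ a ∈ Finset.range (n + 1), f a = ∑ a ∈ Finset.range (n + 1), f (a + 2) := by
  have h := Finset.sum_range_succ' f (n + 2)
  rw [Finset.sum_range_succ' _ (n + 1), Finset.sum_range_succ, Finset.sum_range_succ, h0, h1, h2,
    h3] at h
  simpa using h

/-- Harmonicity is exactly the coefficient recursion coming from Legendre's equation. Coefficients
with `ℓ - a` odd vanish, so the halved exponent `(ℓ - a) / 2` is exact wherever it counts. -/
theorem zonalPoly_mem_harmonicSpace (ℓ : ℕ) (x : S2) : zonalPoly ℓ x ∈ harmonicSpace ℓ := by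
  rw [mem_harmonicSpace]
  constructor
  · refine MvPolynomial.IsHomogeneous.sum _ _ _ fun a ha => ?_
    by_cases h : 2 ∣ a + ℓ
    · have h1 : (linForm x).IsHomogeneous 1 :=
        MvPolynomial.IsHomogeneous.sum _ _ _ fun i _ => by
          simpa using (MvPolynomial.isHomogeneous_C (Fin 3) ((x : E3) i)).mul
            (MvPolynomial.isHomogeneous_X ℝ i)
      have h2 : (∑ i, MvPolynomial.X i ^ 2 : MvPolynomial (Fin 3) ℝ).IsHomogeneous 2 :=
        MvPolynomial.IsHomogeneous.sum _ _ _ fun i _ => by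
          simpa using (MvPolynomial.isHomogeneous_X ℝ i).pow 2
      have h3 := (MvPolynomial.isHomogeneous_C (Fin 3) ((legendreP ℓ).coeff a)).mul
        ((h1.pow a).mul (h2.pow ((ℓ - a) / 2)))
      have h4 : 0 + (1 * a + 2 * ((ℓ - a) / 2)) = ℓ := by
        rw [Finset.mem_range] at ha; omega
      rwa [h4] at h3
    · rw [legendreP_coeff_eq_zero_of_parity h]
      simpa using MvPolynomial.isHomogeneous_zero _ _ _
  · set L := linForm x
    set N := (∑ i, MvPolynomial.X i ^ 2 : MvPolynomial (Fin 3) ℝ)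
    set c := (legendreP ℓ).coeff with hc
    have e : ∑ i, MvPolynomial.pderiv i (MvPolynomial.pderiv i (zonalPoly ℓ x))
        = ∑ a ∈ Finset.range (ℓ + 1), MvPolynomial.C (c a) *
            (MvPolynomial.C ((a * (a - 1) : ℕ) : ℝ) * (L ^ (a - 2) * N ^ ((ℓ - a) / 2)))
          + ∑ a ∈ Finset.range (ℓ + 1), MvPolynomial.C (c a) *
            (MvPolynomial.C (2 * ((ℓ - a) / 2 : ℕ) * (2 * ((ℓ - a) / 2 : ℕ) + 1)
              + 4 * a * ((ℓ - a) / 2 : ℕ) : ℝ) * (L ^ a * N ^ ((ℓ - a) / 2 - 1))) := by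
      simp only [zonalPoly, map_sum, MvPolynomial.pderiv_C_mul]
      rw [Finset.sum_comm, ← Finset.sum_add_distrib]
      refine Finset.sum_congr rfl fun a _ => ?_
      rw [← Finset.mul_sum, laplacian_linForm_pow_mul, mul_add]
    have hz : ∀ a, ℓ < a → c a = 0 := fun a ha =>
      Polynomial.coeff_eq_zero_of_natDegree_lt (by rw [legendreP_natDegree]; exact ha)
    have e2 : ∑ a ∈ Finset.range (ℓ + 1), MvPolynomial.C (c a) *
            (MvPolynomial.C ((a * (a - 1) : ℕ) : ℝ) * (L ^ (a - 2) * N ^ ((ℓ - a) / 2)))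
        = ∑ a ∈ Finset.range (ℓ + 1), MvPolynomial.C (c (a + 2)) *
            (MvPolynomial.C (((a + 2) * (a + 1) : ℕ) : ℝ) * (L ^ a * N ^ ((ℓ - (a + 2)) / 2))) := by
      refine (sum_range_shift_two _ ?_ ?_ ?_ ?_).trans (Finset.sum_congr rfl fun a _ => ?_)
      · rw [Nat.zero_mul, Nat.cast_zero, map_zero, zero_mul, mul_zero]
      · rw [Nat.sub_self, Nat.mul_zero, Nat.cast_zero, map_zero, zero_mul, mul_zero]
      · rw [hz (ℓ + 1) (by omega), map_zero, zero_mul]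
      · rw [hz (ℓ + 2) (by omega), map_zero, zero_mul]
      · rw [show a + 2 - 1 = a + 1 by omega, Nat.add_sub_cancel]
    rw [e, e2, ← Finset.sum_add_distrib]
    refine Finset.sum_eq_zero fun a ha => ?_
    rw [Finset.mem_range] at ha
    have hrec := legendreP_coeff_recursion ℓ a
    rw [← hc] at hrec
    by_cases h : 2 ∣ a + ℓ
    · obtain ⟨b, hb⟩ : ∃ b, ℓ = a + 2 * b := ⟨(ℓ - a) / 2, by omega⟩
      rw [show (ℓ - (a + 2)) / 2 = b - 1 by omega, show (ℓ - a) / 2 = b by omega,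
        ← mul_assoc, ← mul_assoc (MvPolynomial.C (c a)), ← add_mul, ← map_mul, ← map_mul, ← map_add]
      have : c (a + 2) * (((a + 2) * (a + 1) : ℕ) : ℝ)
          + c a * (2 * b * (2 * b + 1) + 4 * a * b) = 0 := by
        rw [lam, hb] at hrec
        push_cast at hrec ⊢
        linear_combination hrec
      rw [this, map_zero, zero_mul]
    · rw [hc, legendreP_coeff_eq_zero_of_parity h, legendreP_coeff_eq_zero_of_parity (by omega)]
      simp

/-! ### Reproducing kernels and the addition theorem -/

open Filter Topology

theorem IsHarmonicBasis.mem {ℓ : ℕ} {Y : Fin (2 * ℓ + 1) → MvPolynomial (Fin 3) ℝ}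
    (h : IsHarmonicBasis ℓ Y) (k : Fin (2 * ℓ + 1)) : Y k ∈ harmonicSpace ℓ := by
  rw [← h.span_eq]; exact Submodule.subset_span ⟨k, rfl⟩

/-- Expansion in an orthonormal basis of spherical harmonics. -/
theorem IsHarmonicBasis.eq_sum {ℓ : ℕ} {Y : Fin (2 * ℓ + 1) → MvPolynomial (Fin 3) ℝ}
    (h : IsHarmonicBasis ℓ Y) {p : MvPolynomial (Fin 3) ℝ} (hp : p ∈ harmonicSpace ℓ) :
    p = ∑ k, (∫ x : S2, evalAt p x * evalAt (Y k) x ∂surf) • Y k := by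
  rw [← h.span_eq, Submodule.mem_span_range_iff_exists_fun] at hp
  obtain ⟨c, hc⟩ := hp
  have : ∀ k, ∫ x : S2, evalAt p x * evalAt (Y k) x ∂surf = c k := by
    intro k
    rw [← hc]
    simp_rw [evalAt_sum, Finset.sum_mul, evalAt_smul, mul_assoc]
    rw [integral_finsetSum _ fun a _ => (integrable_evalAt_mul _ _).const_mul _]
    simp_rw [integral_const_mul, h.orthonormal]
    simp
  simp_rw [this]
  exact hc.symm

theorem integral_legendreP_mul_eq_zero {ℓ m : ℕ} (h : ℓ ≠ m) {p : MvPolynomial (Fin 3) ℝ}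
    (hp : p ∈ harmonicSpace ℓ) (x : S2) :
    ∫ y : S2, (legendreP m).eval (inner ℝ (x : E3) (y : E3)) * evalAt p y ∂surf = 0 := by
  have := integral_harmonic_orthogonal h.symm (zonalPoly_mem_harmonicSpace m x) hp
  simpa only [evalAt_zonalPoly] using this

theorem continuous_inner_sphere (x : E3) : Continuous fun y : S2 => inner ℝ x (y : E3) :=
  continuous_const.inner continuous_subtype_val

theorem continuous_eval_inner (q : Polynomial ℝ) (x : E3) :
    Continuous fun y : S2 => q.eval (inner ℝ x (y : E3)) :=
  q.continuous.comp (continuous_inner_sphere x)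

theorem integral_sum_legendreP_mul {ℓ N : ℕ} (hN : ℓ < N) (a : ℕ → ℝ)
    {p : MvPolynomial (Fin 3) ℝ} (hp : p ∈ harmonicSpace ℓ) (x : S2) :
    ∫ y : S2, (∑ m ∈ Finset.range N, Polynomial.C (a m) * legendreP m).eval
        (inner ℝ (x : E3) (y : E3)) * evalAt p y ∂surf
      = a ℓ * ∫ y : S2, (legendreP ℓ).eval (inner ℝ (x : E3) (y : E3)) * evalAt p y ∂surf := by
  have e : ∀ y : S2, (∑ m ∈ Finset.range N, Polynomial.C (a m) * legendreP m).eval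
        (inner ℝ (x : E3) (y : E3)) * evalAt p y
      = ∑ m ∈ Finset.range N,
        a m * ((legendreP m).eval (inner ℝ (x : E3) (y : E3)) * evalAt p y) := by
    intro t; simp [Polynomial.eval_finsetSum, Finset.sum_mul, mul_assoc]
  simp_rw [e]
  have hi : ∀ m, Integrable (fun y : S2 => a m *
      ((legendreP m).eval (inner ℝ (x : E3) (y : E3)) * evalAt p y)) surf := fun m =>
    (integrable_of_continuous_sphere
      ((continuous_eval_inner _ _).mul (continuous_evalAt_sphere p))).const_mul _
  rw [integral_finsetSum _ fun m _ => hi m]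
  simp_rw [integral_const_mul]
  rw [Finset.sum_eq_single_of_mem ℓ (Finset.mem_range.2 hN) fun m _ hm => by
    rw [integral_legendreP_mul_eq_zero hm.symm hp, mul_zero]]

/-- The function `(1 + x · y)/2` lies in `[0, 1]` and attains `1` only at `y = x`, so its normalised
powers are an approximate identity made of zonal polynomials. -/
theorem tendsto_peak_integral (p : MvPolynomial (Fin 3) ℝ) (x : S2) :
    Tendsto (fun n : ℕ => (∫ y : S2, ((1 + inner ℝ (x : E3) (y : E3)) / 2) ^ n ∂surf)⁻¹ *
      ∫ y : S2, ((1 + inner ℝ (x : E3) (y : E3)) / 2) ^ n * evalAt p y ∂surf) atTop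
      (𝓝 (evalAt p x)) := by
  have h := tendsto_setIntegral_pow_smul_of_unique_maximum_of_isCompact_of_continuousOn
    (μ := surf) (s := Set.univ) (x₀ := x) (c := fun y : S2 => (1 + inner ℝ (x : E3) (y : E3)) / 2)
    (g := fun y : S2 => evalAt p y) isCompact_univ
    ((continuous_const.add (continuous_inner_sphere x)).div_const 2).continuousOn
    (fun y _ hy => by
      have h1 : inner ℝ (x : E3) (y : E3) < 1 := by
        refine inner_lt_one_iff_real_of_norm_eq_one (norm_eq_of_mem_sphere x)
          (norm_eq_of_mem_sphere y) |>.2 fun e => hy (Subtype.ext e.symm)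
      rw [inner_self_sphere]; linarith)
    (fun y _ => by
      have h1 := abs_real_inner_le_norm (x : E3) (y : E3)
      rw [norm_eq_of_mem_sphere, norm_eq_of_mem_sphere, mul_one, abs_le] at h1
      linarith [h1.1])
    (by rw [inner_self_sphere]; norm_num) (by simp) (continuous_evalAt_sphere p).continuousOn
  simpa using h

theorem one_mem_harmonicSpace_zero : (1 : MvPolynomial (Fin 3) ℝ) ∈ harmonicSpace 0 := by
  rw [mem_harmonicSpace]
  exact ⟨MvPolynomial.isHomogeneous_one _ _, by simp⟩

/-- The zonal kernel of degree `ℓ` reproduces the spherical harmonics of degree `ℓ`, up to a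
factor. -/
theorem exists_reproducing_factor {ℓ : ℕ} {Y : Fin (2 * ℓ + 1) → MvPolynomial (Fin 3) ℝ}
    (h : IsHarmonicBasis ℓ Y) : ∃ γ : ℝ, ∀ p ∈ harmonicSpace ℓ, ∀ x : S2,
      γ * ∫ y : S2, (legendreP ℓ).eval (inner ℝ (x : E3) (y : E3)) * evalAt p y ∂surf
        = evalAt p x := by
  -- In the Legendre expansion of the peak kernel only the term of degree `ℓ` acts on harmonics of
  -- degree `ℓ`. The factors `r n` therefore depend neither on `p` nor on `x`.
  have hr : ∃ r : ℕ → ℝ, ∀ p ∈ harmonicSpace ℓ, ∀ x : S2,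
      Tendsto (fun n => r n *
        ∫ y : S2, (legendreP ℓ).eval (inner ℝ (x : E3) (y : E3)) * evalAt p y ∂surf) atTop
        (𝓝 (evalAt p x)) := by
    have hG : ∀ n : ℕ, ∃ (N : ℕ) (a : ℕ → ℝ), ℓ < N ∧ (0 < N) ∧
        (Polynomial.C (1 / 2 : ℝ) * (1 + Polynomial.X)) ^ n
          = ∑ m ∈ Finset.range N, Polynomial.C (a m) * legendreP m := by
      intro n
      set q := (Polynomial.C (1 / 2 : ℝ) * (1 + Polynomial.X)) ^ n
      obtain ⟨a, ha⟩ := exists_legendre_expansion (q.natDegree + ℓ) q (by omega)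
      exact ⟨_, a, by omega, by omega, ha⟩
    choose N a hN hN0 ha using hG
    have hev : ∀ (n : ℕ) (t : ℝ), ((1 + t) / 2) ^ n
        = (∑ m ∈ Finset.range (N n), Polynomial.C (a n m) * legendreP m).eval t := by
      intro n t
      rw [← ha]; simp; ring
    -- The mass of the peak is its degree-zero part, found from the same identity with `p = 1`;
    -- dividing the coefficient of degree `ℓ` by it gives `r n`.
    refine ⟨fun n => (a n 0 * ∫ _ : S2, (1 : ℝ) ∂surf)⁻¹ * a n ℓ, fun p hp x => ?_⟩
    refine (tendsto_peak_integral p x).congr fun n => ?_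
    have h1 := integral_sum_legendreP_mul (hN n) (a n) hp x
    have h2 := integral_sum_legendreP_mul (hN0 n) (a n) one_mem_harmonicSpace_zero x
    have h3 : ∀ y : E3, evalAt 1 y = 1 := fun y => by simp [evalAt]
    have h4 : ∀ t, (legendreP 0).eval t = 1 := fun t => by simp [legendreP]
    simp only [h3, h4, mul_one] at h2
    simp_rw [hev]
    rw [h1, h2, mul_assoc]
  obtain ⟨r, hr⟩ := hr
  obtain ⟨x, hx⟩ : ∃ x : S2, evalAt (Y 0) x ≠ 0 := by
    by_contra! hc
    have := h.orthonormal 0 0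
    simp [hc] at this
  set I := ∫ y : S2, (legendreP ℓ).eval (inner ℝ (x : E3) (y : E3)) * evalAt (Y 0) y ∂surf with hI
  have hlim := hr (Y 0) (h.mem 0) x
  have hI0 : I ≠ 0 := by
    intro h0
    rw [← hI, h0] at hlim
    simp only [mul_zero] at hlim
    exact hx (tendsto_nhds_unique hlim tendsto_const_nhds)
  -- At a point where `Y 0` does not vanish the Legendre integral `I` is nonzero, so `r` itself
  -- converges; its limit is the factor.
  refine ⟨evalAt (Y 0) x / I, fun p hp z => ?_⟩
  have h1 : Tendsto r atTop (𝓝 (evalAt (Y 0) x / I)) := by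
    refine (hlim.div_const I).congr fun n => ?_
    rw [mul_div_cancel_right₀ _ hI0]
  exact tendsto_nhds_unique (h1.mul_const _) (hr p hp z)

/-- The addition theorem. -/
theorem addition_theorem {ℓ : ℕ} {Y : Fin (2 * ℓ + 1) → MvPolynomial (Fin 3) ℝ}
    (h : IsHarmonicBasis ℓ Y) (x y : S2) :
    ∑ k, evalAt (Y k) x * evalAt (Y k) y
      = (2 * ℓ + 1) / (4 * Real.pi) * (legendreP ℓ).eval (inner ℝ (x : E3) (y : E3)) := by
  obtain ⟨γ, hγ⟩ := exists_reproducing_factor h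
  have h1 : ∀ x y : S2, ∑ k, evalAt (Y k) x * evalAt (Y k) y
      = γ * (legendreP ℓ).eval (inner ℝ (x : E3) (y : E3)) := by
    intro x y
    have e := congrArg (fun p => evalAt p (y : E3)) (h.eq_sum (zonalPoly_mem_harmonicSpace ℓ x))
    simp only [evalAt_zonalPoly, evalAt_sum, evalAt_smul] at e
    rw [e, Finset.mul_sum]
    refine Finset.sum_congr rfl fun k _ => ?_
    rw [← mul_assoc, hγ _ (h.mem k)]
  -- Integrating the diagonal `y = x` counts the basis: `2ℓ + 1 = 4π γ`.
  have h2 : γ = (2 * ℓ + 1) / (4 * Real.pi) := by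
    have h3 : ∫ x : S2, ∑ k, evalAt (Y k) x * evalAt (Y k) x ∂surf = 2 * ℓ + 1 := by
      rw [integral_finsetSum _ fun k _ => integrable_evalAt_mul _ _]
      simp [h.orthonormal]
    simp_rw [h1, inner_self_sphere, legendreP_eval_one] at h3
    rw [integral_const, surf_real_univ] at h3
    have := Real.pi_pos
    rw [eq_div_iff (by positivity), ← h3]
    simp; ring
  rw [h1, h2]

/-! ### Derivatives of the addition theorem -/

/-- Every tangent vector of the sphere is the velocity of a curve on the sphere. -/
theorem exists_tangent_curve (x : S2) {v : E3} (hv : inner ℝ (x : E3) v = 0) :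
    ∃ c : ℝ → S2, c 0 = x ∧ HasDerivAt (fun s => (c s : E3)) v 0 := by
  have hne : ∀ s : ℝ, (x : E3) + s • v ≠ 0 := by
    intro s hs
    have h1 := congrArg (inner ℝ (x : E3)) hs
    rw [inner_add_right, inner_smul_right, hv, inner_self_sphere, inner_zero_right] at h1
    norm_num at h1
  have hn : ∀ s : ℝ, ‖(x : E3) + s • v‖ = √(1 + s ^ 2 * ‖v‖ ^ 2) := by
    intro s
    rw [← Real.sqrt_sq (norm_nonneg _), norm_add_sq_real, inner_smul_right, hv, norm_smul,
      norm_eq_of_mem_sphere, mul_pow, Real.norm_eq_abs, sq_abs]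
    simp
  refine ⟨fun s => ⟨‖(x : E3) + s • v‖⁻¹ • ((x : E3) + s • v), ?_⟩, ?_, ?_⟩
  · rw [mem_sphere_zero_iff_norm, norm_smul, norm_inv, norm_norm,
      inv_mul_cancel₀ (norm_ne_zero_iff.2 (hne s))]
  · apply Subtype.ext; simp
  · have h1 : HasDerivAt (fun s : ℝ => 1 + s ^ 2 * ‖v‖ ^ 2) 0 0 := by
      have := (((hasDerivAt_id (0 : ℝ)).pow 2).mul_const (‖v‖ ^ 2)).const_add 1
      simpa using this
    have h2 := (h1.sqrt (by norm_num)).inv (by norm_num)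
    have h3 : HasDerivAt (fun s : ℝ => (x : E3) + s • v) v 0 := by
      simpa using ((hasDerivAt_id (0 : ℝ)).smul_const v).const_add (x : E3)
    have h4 := h2.smul h3
    refine (h4.congr_of_eventuallyEq (Eventually.of_forall fun s => ?_)).congr_deriv (by simp)
    simp [hn]

/-- The addition theorem holds on the sphere only, so it is differentiated along a curve in the
sphere; this is why `w` must be tangent at `y`. -/
theorem addition_theorem_deriv {ℓ : ℕ} {Y : Fin (2 * ℓ + 1) → MvPolynomial (Fin 3) ℝ}
    (h : IsHarmonicBasis ℓ Y) (x y : S2) {w : E3} (hw : inner ℝ (y : E3) w = 0) :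
    ∑ k, evalAt (Y k) x * inner ℝ (grad (Y k) y) w
      = (2 * ℓ + 1) / (4 * Real.pi) *
        ((legendreP ℓ).derivative.eval (inner ℝ (x : E3) (y : E3)) * inner ℝ (x : E3) w) := by
  obtain ⟨c, hc0, hc⟩ := exists_tangent_curve y hw
  have h1 : HasDerivAt (fun s => ∑ k, evalAt (Y k) x * evalAt (Y k) (c s))
      (∑ k, evalAt (Y k) x * inner ℝ (grad (Y k) (c 0)) w) 0 :=
    HasDerivAt.fun_sum fun k _ => (hasDerivAt_evalAt_comp (Y k) hc).const_mul _
  have h2 : HasDerivAt (fun s => inner ℝ (x : E3) (c s : E3)) (inner ℝ (x : E3) w) 0 := by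
    simpa using (hasDerivAt_const (0 : ℝ) (x : E3)).inner ℝ hc
  have h3 := (((legendreP ℓ).hasDerivAt _).comp (0 : ℝ) h2).const_mul
    ((2 * ℓ + 1) / (4 * Real.pi))
  simp_rw [addition_theorem h] at h1
  rw [hc0] at h1 h3
  exact h1.unique h3

/-- The twice differentiated addition theorem. -/
theorem addition_theorem_deriv_deriv {ℓ : ℕ}
    {Y : Fin (2 * ℓ + 1) → MvPolynomial (Fin 3) ℝ} (h : IsHarmonicBasis ℓ Y) (x y : S2) {v w : E3}
    (hv : inner ℝ (x : E3) v = 0) (hw : inner ℝ (y : E3) w = 0) :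
    ∑ k, inner ℝ (grad (Y k) x) v * inner ℝ (grad (Y k) y) w
      = (2 * ℓ + 1) / (4 * Real.pi) *
        ((legendreP ℓ).derivative.derivative.eval (inner ℝ (x : E3) (y : E3)) *
          (inner ℝ v (y : E3) * inner ℝ (x : E3) w)
        + (legendreP ℓ).derivative.eval (inner ℝ (x : E3) (y : E3)) * inner ℝ v w) := by
  obtain ⟨c, hc0, hc⟩ := exists_tangent_curve x hv
  have h1 : HasDerivAt (fun s => ∑ k, evalAt (Y k) (c s) * inner ℝ (grad (Y k) y) w)
      (∑ k, inner ℝ (grad (Y k) (c 0)) v * inner ℝ (grad (Y k) y) w) 0 :=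
    HasDerivAt.fun_sum fun k _ => (hasDerivAt_evalAt_comp (Y k) hc).mul_const _
  have h2 : ∀ z : E3, HasDerivAt (fun s => inner ℝ (c s : E3) z) (inner ℝ v z) 0 := by
    intro z
    simpa using hc.inner ℝ (hasDerivAt_const (0 : ℝ) z)
  have h3 := ((((legendreP ℓ).derivative.hasDerivAt _).comp (0 : ℝ) (h2 y)).mul (h2 w)).const_mul
    ((2 * ℓ + 1) / (4 * Real.pi))
  simp_rw [addition_theorem_deriv h _ _ hw] at h1
  rw [hc0] at h1 h3
  rw [h1.unique h3]
  simp only [Function.comp, hc0]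
  ring

/-! ### Completeness of the vector spherical harmonics -/

theorem _root_.MeasureTheory.Integrable.mul_continuous_sphere {φ : S2 → ℝ}
    (hφ : Integrable φ surf) {g : S2 → ℝ} (hg : Continuous g) :
    Integrable (fun y => φ y * g y) surf := by
  obtain ⟨C, hC⟩ := (isCompact_range hg).isBounded.exists_norm_le
  exact hφ.mul_bdd hg.aestronglyMeasurable (Eventually.of_forall fun y => hC _ ⟨y, rfl⟩)

/-- Termwise integration of the exponential series. Exponentials of linear forms are closed under
multiplication, so their span is an algebra, as Stone–Weierstrass requires. -/
theorem integral_mul_exp_eq_zero {φ : S2 → ℝ} (hφ : Integrable φ surf) (x : E3)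
    (h : ∀ n : ℕ, ∫ y : S2, φ y * inner ℝ x (y : E3) ^ n ∂surf = 0) :
    ∫ y : S2, φ y * Real.exp (inner ℝ x (y : E3)) ∂surf = 0 := by
  have hb : ∀ y : S2, |inner ℝ x (y : E3)| ≤ ‖x‖ := fun y => by
    simpa using abs_real_inner_le_norm x (y : E3)
  have hsum : HasSum (fun n : ℕ => ‖x‖ ^ n / n.factorial) (Real.exp ‖x‖) := by
    rw [Real.exp_eq_exp_ℝ]; exact NormedSpace.expSeries_div_hasSum_exp ‖x‖
  have h1 : HasSum (fun n : ℕ => ∫ y : S2, φ y * inner ℝ x (y : E3) ^ n / n.factorial ∂surf)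
      (∫ y : S2, φ y * Real.exp (inner ℝ x (y : E3)) ∂surf) := by
    refine hasSum_integral_of_dominated_convergence
      (fun n y => |φ y| * (‖x‖ ^ n / n.factorial)) (fun n => ?_) (fun n => ?_) ?_ ?_ ?_
    · exact ((hφ.mul_continuous_sphere
        ((continuous_inner_sphere x).pow n)).div_const _).aestronglyMeasurable
    · refine Eventually.of_forall fun y => ?_
      rw [norm_div, norm_mul, norm_pow, mul_div_assoc, Real.norm_eq_abs, Real.norm_eq_abs,
        Real.norm_natCast]
      gcongr
      exact hb y
    · exact Eventually.of_forall fun y => hsum.summable.mul_left _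
    · simp_rw [tsum_mul_left]
      exact hφ.abs.mul_const _
    · refine Eventually.of_forall fun y => ?_
      have := (NormedSpace.expSeries_div_hasSum_exp (𝔸 := ℝ) (inner ℝ x (y : E3))).mul_left (φ y)
      rw [← Real.exp_eq_exp_ℝ] at this
      simpa only [mul_div_assoc] using this
  have h2 : ∀ n : ℕ, ∫ y : S2, φ y * inner ℝ x (y : E3) ^ n / n.factorial ∂surf = 0 := by
    intro n; rw [integral_div, h, zero_div]
  simp_rw [h2] at h1
  exact h1.unique hasSum_zero

/-- The exponential functions, as a monoid of continuous functions on the sphere. -/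
def expHom : Multiplicative E3 →* C(S2, ℝ) where
  toFun x := ⟨fun y => Real.exp (inner ℝ (Multiplicative.toAdd x) (y : E3)),
    Real.continuous_exp.comp (continuous_inner_sphere _)⟩
  map_one' := by ext y; simp
  map_mul' x z := by ext y; simp [inner_add_left, Real.exp_add]

theorem integral_mul_eq_zero_of_separatesPoints {φ : S2 → ℝ} (hφ : Integrable φ surf)
    {A : Subalgebra ℝ C(S2, ℝ)} (hsep : A.SeparatesPoints)
    (hA : ∀ a ∈ A, ∫ y, φ y * a y ∂surf = 0) (g : C(S2, ℝ)) : ∫ y, φ y * g y ∂surf = 0 := by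
  by_contra hne
  set I := ∫ y, |φ y| ∂surf
  have hI : 0 ≤ I := integral_nonneg fun y => abs_nonneg _
  -- With `I + 1` in place of `I` the tolerance is well defined even for `I = 0`, and the resulting
  -- bound is strictly below `|∫ φ g|`.
  obtain ⟨⟨a, haA⟩, ha⟩ := ContinuousMap.exists_mem_subalgebra_near_continuousMap_of_separatesPoints
    A hsep g (|∫ y, φ y * g y ∂surf| / (I + 1)) (by positivity)
  have h1 : ∫ y, φ y * g y ∂surf = ∫ y, φ y * (g y - a y) ∂surf := by
    simp only [mul_sub]
    rw [integral_sub (hφ.mul_continuous_sphere g.continuous)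
      (hφ.mul_continuous_sphere a.continuous), hA a haA, sub_zero]
  have h2 : |∫ y, φ y * (g y - a y) ∂surf| ≤ I * (|∫ y, φ y * g y ∂surf| / (I + 1)) := by
    rw [← integral_mul_const, ← Real.norm_eq_abs]
    refine norm_integral_le_of_norm_le (hφ.abs.mul_const _) (Eventually.of_forall fun y => ?_)
    rw [norm_mul, Real.norm_eq_abs]
    gcongr
    rw [norm_sub_rev]
    exact ((a - g : C(S2, ℝ)).norm_coe_le_norm y).trans ha.le
  rw [← h1] at h2
  have h3 : 0 < |∫ y, φ y * g y ∂surf| := abs_pos.2 hne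
  have h4 : I * (|∫ y, φ y * g y ∂surf| / (I + 1)) < |∫ y, φ y * g y ∂surf| := by
    rw [mul_div_assoc', div_lt_iff₀ (by positivity)]
    nlinarith
  linarith

/-- The powers `(x · y) ^ n` form a total family of functions on the sphere. -/
theorem ae_eq_zero_of_integral_inner_pow {φ : S2 → ℝ} (hφ : Integrable φ surf)
    (h : ∀ (n : ℕ) (x : E3), ∫ y : S2, φ y * inner ℝ x (y : E3) ^ n ∂surf = 0) :
    φ =ᵐ[surf] 0 := by
  set A : Subalgebra ℝ C(S2, ℝ) := Algebra.adjoin ℝ (MonoidHom.mrange expHom : Set C(S2, ℝ)) with hA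
  have hAz : ∀ a ∈ A, ∫ y, φ y * a y ∂surf = 0 := by
    intro a ha
    rw [← Subalgebra.mem_toSubmodule, hA, Algebra.adjoin_eq_span, Submonoid.closure_eq] at ha
    induction ha using Submodule.span_induction with
    | mem a ha =>
      obtain ⟨x, rfl⟩ := ha
      exact integral_mul_exp_eq_zero hφ _ fun n => h n _
    | zero => simp
    | add a b _ _ ha hb =>
      simp only [ContinuousMap.add_apply, mul_add]
      rw [integral_add (hφ.mul_continuous_sphere a.continuous)
        (hφ.mul_continuous_sphere b.continuous), ha, hb, add_zero]
    | smul c a _ ha =>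
      simp only [ContinuousMap.smul_apply, smul_eq_mul, mul_left_comm _ c]
      rw [integral_const_mul, ha, mul_zero]
  have hsep : A.SeparatesPoints := by
    intro y z hyz
    refine ⟨expHom (Multiplicative.ofAdd ((y : E3) - z)), ⟨_, Algebra.subset_adjoin ⟨_, rfl⟩, rfl⟩, ?_⟩
    intro he
    have h1 := Real.exp_injective he
    simp only [toAdd_ofAdd] at h1
    rw [← sub_eq_zero, ← inner_sub_right, inner_self_eq_zero, sub_eq_zero] at h1
    exact hyz (Subtype.ext h1)
  have : Fact (Module.finrank ℝ E3 = 2 + 1) := ⟨by simp⟩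
  refine ae_eq_zero_of_integral_contMDiff_smul_eq_zero (modelWithCornersSelf ℝ (EuclideanSpace ℝ (Fin 2)))
    hφ.locallyIntegrable fun g hg _ => ?_
  simp only [smul_eq_mul, mul_comm (g _)]
  exact integral_mul_eq_zero_of_separatesPoints hφ hsep hAz ⟨g, hg.continuous⟩

/-- All moments of the flux of a vector field through spherical caps vanish. -/
def FluxFree (g : S2 → E3) : Prop :=
  ∀ (n : ℕ) (x : E3), ∫ y : S2, inner ℝ x (g y) * inner ℝ x (y : E3) ^ n ∂surf = 0

/-- The derivatives `P_ℓ'` with `ℓ ≥ 1` span all polynomials: expand `t^(n+1)/(n+1)` and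
differentiate. Homogeneity of degree `n + 1` passes from unit vectors `x` to all `x`. -/
theorem fluxFree_of_legendre {g : S2 → E3} (hg : Integrable g surf)
    (h : ∀ ℓ, 1 ≤ ℓ → ∀ x : S2, ∫ y : S2, inner ℝ (x : E3) (g y) *
      (legendreP ℓ).derivative.eval (inner ℝ (x : E3) (y : E3)) ∂surf = 0) : FluxFree g := by
  have h1 : ∀ (n : ℕ) (x : S2),
      ∫ y : S2, inner ℝ (x : E3) (g y) * inner ℝ (x : E3) (y : E3) ^ n ∂surf = 0 := by
    intro n x
    obtain ⟨a, ha⟩ := exists_legendre_expansion (n + 1)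
      (Polynomial.C ((n + 1 : ℝ)⁻¹) * Polynomial.X ^ (n + 1))
      ((Polynomial.natDegree_C_mul_le _ _).trans (by simp))
    have e : ∀ t : ℝ, t ^ n
        = ∑ m ∈ Finset.range (n + 1 + 1), a m * (legendreP m).derivative.eval t := by
      intro t
      have := congrArg (fun p => p.derivative.eval t) ha
      have hn : (n + 1 : ℝ) ≠ 0 := by positivity
      simp [Polynomial.eval_finsetSum] at this
      rw [← this]; field_simp
    have hi : ∀ m, Integrable (fun y : S2 => a m * (inner ℝ (x : E3) (g y) *
        (legendreP m).derivative.eval (inner ℝ (x : E3) (y : E3)))) surf := fun m =>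
      ((hg.const_inner (x : E3)).mul_continuous_sphere (continuous_eval_inner _ _)).const_mul _
    simp_rw [e, Finset.mul_sum, mul_left_comm _ (a _)]
    rw [integral_finsetSum _ fun m _ => hi m]
    refine Finset.sum_eq_zero fun m _ => ?_
    rw [integral_const_mul]
    rcases Nat.eq_zero_or_pos m with rfl | hm
    · simp [legendreP]
    · rw [h m hm, mul_zero]
  intro n x
  rcases eq_or_ne x 0 with rfl | hx
  · simp
  · have h2 := h1 n ⟨‖x‖⁻¹ • x, by simp [norm_smul, hx]⟩
    have e : ∀ y : S2, inner ℝ x (g y) * inner ℝ x (y : E3) ^ n = ‖x‖ ^ (n + 1) *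
        (inner ℝ (‖x‖⁻¹ • x) (g y) * inner ℝ (‖x‖⁻¹ • x) (y : E3) ^ n) := by
      intro y
      have := norm_ne_zero_iff.2 hx
      rw [real_inner_smul_left, real_inner_smul_left, mul_pow, inv_pow, pow_succ]
      field_simp
    simp_rw [e]
    rw [integral_const_mul, h2, mul_zero]

/-- The polarised form of the vanishing of all flux moments. -/
theorem FluxFree.integral_polarised {g : S2 → E3} (h : FluxFree g) (hg : Integrable g surf)
    (n : ℕ) (x v : E3) :
    ∫ y : S2, (inner ℝ v (g y) * inner ℝ x (y : E3) ^ n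
      + inner ℝ x (g y) * (n * inner ℝ x (y : E3) ^ (n - 1) * inner ℝ v (y : E3))) ∂surf = 0 := by
  have hin : ∀ (z : E3) (s : ℝ), HasDerivAt (fun s : ℝ => inner ℝ (x + s • v) z) (inner ℝ v z) s := by
    intro z s
    have := (((hasDerivAt_id s).smul_const v).const_add x).inner ℝ (hasDerivAt_const s z)
    simpa using this
  have hm : ∀ (u w : E3) (m : ℕ),
      Integrable (fun y : S2 => inner ℝ u (g y) * inner ℝ w (y : E3) ^ m) surf := fun u w m =>
    (hg.const_inner u).mul_continuous_sphere ((continuous_inner_sphere w).pow m)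
  set R := ‖x‖ + ‖v‖
  have hR : ∀ s ∈ Metric.ball (0 : ℝ) 1, ‖x + s • v‖ ≤ R := by
    intro s hs
    refine (norm_add_le _ _).trans (add_le_add le_rfl ?_)
    rw [norm_smul]
    rw [mem_ball_zero_iff] at hs
    exact mul_le_of_le_one_left (norm_nonneg _) hs.le
  have hb : ∀ (z : E3) (y : S2), |inner ℝ z (y : E3)| ≤ ‖z‖ := fun z y => by
    simpa using abs_real_inner_le_norm z (y : E3)
  have hd := (hasDerivAt_integral_of_dominated_loc_of_deriv_le (μ := surf) (x₀ := (0 : ℝ))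
    (s := Metric.ball 0 1) (bound := fun y => ‖g y‖ * (‖v‖ * R ^ n + R * (n * R ^ (n - 1) * ‖v‖)))
    (F := fun s (y : S2) => inner ℝ (x + s • v) (g y) * inner ℝ (x + s • v) (y : E3) ^ n)
    (F' := fun s (y : S2) => inner ℝ v (g y) * inner ℝ (x + s • v) (y : E3) ^ n
      + inner ℝ (x + s • v) (g y) *
        (n * inner ℝ (x + s • v) (y : E3) ^ (n - 1) * inner ℝ v (y : E3)))
    (Metric.ball_mem_nhds _ one_pos)
    (Eventually.of_forall fun s => (hm _ _ _).aestronglyMeasurable) (hm _ _ _)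
    (((hm _ _ _).add ((hg.const_inner _).mul_continuous_sphere
      ((continuous_const.mul ((continuous_inner_sphere _).pow _)).mul
        (continuous_inner_sphere v)))).aestronglyMeasurable)
    (Eventually.of_forall fun y s hs => ?_)
    (hg.norm.mul_const _)
    (Eventually.of_forall fun y s _ => (hin _ _).mul ((hin _ _).pow n))).2
  · simp only [h n] at hd
    have := hd.unique (hasDerivAt_const _ _)
    simpa using this
  · have h1 := hR s hs
    have h2 : |inner ℝ (x + s • v) (y : E3)| ≤ R := (hb _ _).trans h1
    have h3 : |inner ℝ (x + s • v) (g y)| ≤ R * ‖g y‖ :=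
      (abs_real_inner_le_norm _ _).trans (by gcongr)
    have h0 : 0 ≤ R := by positivity
    refine (norm_add_le _ _).trans ?_
    simp only [norm_mul, norm_pow, Real.norm_eq_abs, Nat.abs_cast]
    calc _ ≤ (‖v‖ * ‖g y‖) * R ^ n + (R * ‖g y‖) * (n * R ^ (n - 1) * ‖v‖) := by
          gcongr
          · exact abs_real_inner_le_norm _ _
          · exact hb _ _
      _ = _ := by ring

theorem FluxFree.moment_zero {g : S2 → E3} (h : FluxFree g) (hg : Integrable g surf) (x v : E3) :
    ∫ y : S2, inner ℝ v (g y) * inner ℝ x (y : E3) ^ 0 ∂surf = 0 := by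
  simpa using h.integral_polarised hg 0 x v

/-- For `k = y × g` one has `(v × x) · k = (v · y)(x · g) - (v · g)(x · y)`. Inserted into the
polarised identity, this trades the mixed term for `n + 1` further copies of the wanted moment and a
moment of `k` of degree one lower. -/
theorem FluxFree.moment_succ {g k : S2 → E3} (h : FluxFree g) (hg : Integrable g surf)
    (hk : Integrable k surf) (hgk : ∀ᵐ y : S2 ∂surf, k y = cross y (g y)) {n : ℕ}
    (ih : ∀ x v : E3, ∫ y : S2, inner ℝ v (k y) * inner ℝ x (y : E3) ^ n ∂surf = 0) (x v : E3) :
    ∫ y : S2, inner ℝ v (g y) * inner ℝ x (y : E3) ^ (n + 1) ∂surf = 0 := by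
  have h1 := h.integral_polarised hg (n + 1) x v
  have hi : ∀ (g : S2 → E3) (_ : Integrable g surf) (u : E3) (m : ℕ),
      Integrable (fun y : S2 => inner ℝ u (g y) * inner ℝ x (y : E3) ^ m) surf := fun g hg u m =>
    (hg.const_inner u).mul_continuous_sphere ((continuous_inner_sphere x).pow m)
  have e : ∀ᵐ y : S2 ∂surf, inner ℝ v (g y) * inner ℝ x (y : E3) ^ (n + 1)
      + inner ℝ x (g y) * ((n + 1 : ℕ) * inner ℝ x (y : E3) ^ (n + 1 - 1) * inner ℝ v (y : E3))
      = (n + 2) * (inner ℝ v (g y) * inner ℝ x (y : E3) ^ (n + 1))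
        + (n + 1) * (inner ℝ (cross v x) (k y) * inner ℝ x (y : E3) ^ n) := by
    filter_upwards [hgk] with y hy
    rw [hy, inner_cross_cross, Nat.add_sub_cancel]
    push_cast; ring
  rw [integral_congr_ae e, integral_add ((hi g hg _ _).const_mul _) ((hi k hk _ _).const_mul _),
    integral_const_mul, integral_const_mul, ih, mul_zero, add_zero] at h1
  exact (mul_eq_zero.1 h1).resolve_left (by positivity)

/-- A tangent field without flux and without circulation vanishes. -/
theorem ae_eq_zero_of_fluxFree {g k : S2 → E3} (hg : Integrable g surf) (hk : Integrable k surf)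
    (hgk : ∀ᵐ y : S2 ∂surf, k y = cross y (g y)) (hkg : ∀ᵐ y : S2 ∂surf, -g y = cross y (k y))
    (hfg : FluxFree g) (hfk : FluxFree k) : g =ᵐ[surf] 0 := by
  have key : ∀ n : ℕ, (∀ x v : E3, ∫ y : S2, inner ℝ v (g y) * inner ℝ x (y : E3) ^ n ∂surf = 0) ∧
      ∀ x v : E3, ∫ y : S2, inner ℝ v (k y) * inner ℝ x (y : E3) ^ n ∂surf = 0 := by
    intro n
    induction n with
    | zero => exact ⟨hfg.moment_zero hg, hfk.moment_zero hk⟩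
    | succ n ih =>
      -- Since `y × k = -g`, the pair `(k, -g)` stands in the same relation as `(g, k)`, so the two
      -- fields feed each other's induction.
      refine ⟨hfg.moment_succ hg hk hgk ih.2, hfk.moment_succ hk hg.neg hkg fun x v => ?_⟩
      simp only [Pi.neg_apply, inner_neg_right, neg_mul, integral_neg, ih.1, neg_zero]
  have hc : ∀ i : Fin 3, (fun y => g y i) =ᵐ[surf] 0 := by
    intro i
    have e : ∀ y, g y i = inner ℝ (EuclideanSpace.single i (1 : ℝ)) (g y) := by
      intro y; simp [EuclideanSpace.inner_single_left]
    simp_rw [e]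
    exact ae_eq_zero_of_integral_inner_pow (hg.const_inner _) fun n x => (key n).1 x _
  filter_upwards [hc 0, hc 1, hc 2] with y h0 h1 h2
  exact ext_three h0 h1 h2

theorem _root_.MeasureTheory.Integrable.continuous_inner_sphere {w : S2 → E3}
    (hw : Integrable w surf) {c : S2 → E3} (hc : Continuous c) :
    Integrable (fun y => inner ℝ (c y) (w y)) surf := by
  obtain ⟨C, hC⟩ := (isCompact_range hc).isBounded.exists_norm_le
  refine (hw.norm.const_mul C).mono' (hc.aestronglyMeasurable.inner hw.aestronglyMeasurable)
    (Eventually.of_forall fun y => (abs_real_inner_le_norm _ _).trans ?_)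
  gcongr
  exact hC _ ⟨y, rfl⟩

theorem _root_.MeasureTheory.Integrable.cross_sphere {w : S2 → E3}
    (hw : Integrable w surf) : Integrable (fun y : S2 => cross y (w y)) surf := by
  refine hw.norm.mono' (continuous_cross.comp_aestronglyMeasurable
    (continuous_subtype_val.aestronglyMeasurable.prodMk hw.aestronglyMeasurable))
    (Eventually.of_forall fun y => (norm_cross_le _ _).trans ?_)
  simp

theorem integral_inner_mul_legendre_derivative {ℓ : ℕ}
    {Y : Fin (2 * ℓ + 1) → MvPolynomial (Fin 3) ℝ} (hY : IsHarmonicBasis ℓ Y) {w : S2 → E3}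
    (hw : Integrable w surf) (ht : ∀ᵐ y : S2 ∂surf, inner ℝ (y : E3) (w y) = 0)
    (h : ∀ k, ∫ y : S2, inner ℝ (grad (Y k) y) (w y) ∂surf = 0) (x : S2) :
    ∫ y : S2, inner ℝ (x : E3) (w y) *
      (legendreP ℓ).derivative.eval (inner ℝ (x : E3) (y : E3)) ∂surf = 0 := by
  have hi : ∀ k, Integrable (fun y : S2 => inner ℝ (grad (Y k) y) (w y)) surf := fun k =>
    hw.continuous_inner_sphere (continuous_grad_sphere (Y k))
  have h1 : ∫ y : S2, (2 * ℓ + 1) / (4 * Real.pi) * (inner ℝ (x : E3) (w y) *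
      (legendreP ℓ).derivative.eval (inner ℝ (x : E3) (y : E3))) ∂surf = 0 := by
    have e : ∀ᵐ y : S2 ∂surf, (2 * ℓ + 1) / (4 * Real.pi) * (inner ℝ (x : E3) (w y) *
      (legendreP ℓ).derivative.eval (inner ℝ (x : E3) (y : E3)))
        = ∑ k, evalAt (Y k) x * inner ℝ (grad (Y k) y) (w y) := by
      filter_upwards [ht] with y hy
      rw [addition_theorem_deriv hY x y hy]; ring
    rw [integral_congr_ae e, integral_finsetSum _ fun k _ => (hi k).const_mul _]
    simp_rw [integral_const_mul, h, mul_zero, Finset.sum_const_zero]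
  rw [integral_const_mul] at h1
  have := Real.pi_pos
  exact (mul_eq_zero.1 h1).resolve_left (by positivity)

/-- Completeness of the vector spherical harmonics. -/
theorem ae_eq_zero_of_ip_eq_zero {Y : (ℓ : ℕ) → Fin (2 * ℓ + 1) → MvPolynomial (Fin 3) ℝ}
    (hY : ∀ ℓ, IsHarmonicBasis ℓ (Y ℓ)) {g : S2 → E3} (hg : MemL2Tangent g)
    (h1 : ∀ ℓ, 1 ≤ ℓ → ∀ k, ip g (vecDiv ℓ (Y ℓ k)) = 0)
    (h2 : ∀ ℓ, 1 ≤ ℓ → ∀ k, ip g (vecCurl ℓ (Y ℓ k)) = 0) : g =ᵐ[surf] 0 := by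
  have hgi : Integrable g surf := hg.memLp.integrable (by norm_num)
  have hki : Integrable (fun y : S2 => cross y (g y)) surf := hgi.cross_sphere
  have hl : ∀ ℓ, 1 ≤ ℓ → (√(lam ℓ))⁻¹ ≠ 0 := fun ℓ hℓ =>
    inv_ne_zero (Real.sqrt_ne_zero'.2 (lam_pos hℓ))
  refine ae_eq_zero_of_fluxFree hgi hki (Eventually.of_forall fun _ => rfl) ?_ ?_ ?_
  · filter_upwards [hg.tangential] with y hy
    have h0 := inner_self_sphere y
    rw [inner_eq_sum_three] at h0 hy
    refine ext_three ?_ ?_ ?_ <;> simp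
    · linear_combination -(y : E3) 0 * hy + g y 0 * h0
    · linear_combination -(y : E3) 1 * hy + g y 1 * h0
    · linear_combination -(y : E3) 2 * hy + g y 2 * h0
  · refine fluxFree_of_legendre hgi fun ℓ hℓ x =>
      integral_inner_mul_legendre_derivative (hY ℓ) hgi hg.tangential (fun k => ?_) x
    have e := h2 ℓ hℓ k
    simp only [ip, vecCurl, inner_smul_right] at e
    rw [integral_const_mul] at e
    rw [← (mul_eq_zero.1 e).resolve_left (hl ℓ hℓ)]
    refine integral_congr_ae ?_
    filter_upwards [hg.tangential] with y hy
    rw [inner_surfGrad_of_tangent _ _ hy]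
  · refine fluxFree_of_legendre hki fun ℓ hℓ x =>
      integral_inner_mul_legendre_derivative (hY ℓ) hki
        (Eventually.of_forall fun y => inner_cross_self_left _ _) (fun k => ?_) x
    have e := h1 ℓ hℓ k
    simp only [ip, vecDiv, inner_smul_right] at e
    rw [integral_const_mul] at e
    rw [← neg_eq_zero, ← integral_neg, ← (mul_eq_zero.1 e).resolve_left (hl ℓ hℓ)]
    refine integral_congr_ae (Eventually.of_forall fun y => ?_)
    beta_reduce
    rw [inner_surfCurl, ← inner_neg_right]
    congr 1
    refine ext_three ?_ ?_ ?_ <;> simp [mul_comm]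

/-! ### The matrix kernel applied to a vector -/

/-- The part of the kernel multiplying `κ'`, applied to a vector. -/
def kernelVecDeriv (x y w : E3) : E3 :=
  -(inner ℝ (cross x y) w) • cross x y
    + inner ℝ (x - inner ℝ x y • y) w • (y - inner ℝ x y • x)

/-- The part of the kernel multiplying `κ`, applied to a vector. -/
def kernelVecValue (x y w : E3) : E3 :=
  inner ℝ x y • w - inner ℝ x w • y +
    ((w - inner ℝ y w • y) - inner ℝ x (w - inner ℝ y w • y) • x)

/-- The matrix kernel with prescribed values of `κ'` and `κ`, applied to a vector. -/
def kernelVec (a b : ℝ) (x y w : E3) : E3 := a • kernelVecDeriv x y w + b • kernelVecValue x y w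

theorem convIntegrand_eq_kernelVec (ψ : ℝ → ℝ) (f : S2 → E3) (x y : S2) :
    convIntegrand ψ f x y = kernelVec (deriv (kappa ψ) (inner ℝ (x : E3) (y : E3)))
      (kappa ψ (inner ℝ (x : E3) (y : E3))) x y (f y) := by
  unfold convIntegrand kernelMat kernelDiv kernelCurl kernelVec kernelVecDeriv kernelVecValue
  dsimp only
  generalize deriv (kappa ψ) (inner ℝ (x : E3) (y : E3)) = a
  generalize kappa ψ (inner ℝ (x : E3) (y : E3)) = b
  generalize inner ℝ (x : E3) (y : E3) = t
  generalize f y = w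
  obtain ⟨x, hx⟩ := x
  obtain ⟨y, hy⟩ := y
  refine ext_three ?_ ?_ ?_ <;>
  · simp [Matrix.mulVec, dotProduct, Fin.sum_univ_three, outer, Matrix.vecMulVec_apply,
      Matrix.mul_apply, Matrix.one_apply, inner_eq_sum_three]
    ring

/-- Both brackets have the shape of the twice differentiated addition theorem. The first, with the
tangential part of `v` and with `w`, yields gradients; the second, with the rotated vectors `v × x`
and `w × y`, yields surface curls. -/
theorem inner_kernelVec (a b : ℝ) (x y : S2) (v : E3) {w : E3} (hw : inner ℝ (y : E3) w = 0) :
    inner ℝ v (kernelVec a b x y w)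
      = (a * (inner ℝ (v - inner ℝ (x : E3) v • (x : E3)) (y : E3) * inner ℝ (x : E3) w)
          + b * inner ℝ (v - inner ℝ (x : E3) v • (x : E3)) w)
        + (a * (inner ℝ (cross v x) (y : E3) * inner ℝ (x : E3) (cross w y))
          + b * inner ℝ (cross v x) (cross w y)) := by
  have h1 : inner ℝ (cross v x) (y : E3) = inner ℝ v (cross x y) := by
    rw [real_inner_comm, ← inner_cross_cyclic]
  have h2 : inner ℝ (x : E3) (cross w y) = -inner ℝ (cross x y) w := by
    simp only [inner_eq_sum_three, cross_apply_zero, cross_apply_one, cross_apply_two]; ring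
  rw [h1, h2, inner_cross_cross]
  simp only [kernelVec, kernelVecDeriv, kernelVecValue, inner_add_right, inner_sub_right,
    inner_smul_right, inner_sub_left, real_inner_smul_left, hw,
    real_inner_comm v (x : E3), zero_smul, sub_zero]
  ring

theorem norm_sub_inner_smul_sq (x y : S2) :
    ‖(y : E3) - inner ℝ (x : E3) (y : E3) • (x : E3)‖ ^ 2 = 1 - inner ℝ (x : E3) (y : E3) ^ 2 := by
  rw [← real_inner_self_eq_norm_sq]
  simp only [inner_sub_left, inner_sub_right, inner_smul_left, inner_smul_right, inner_self_sphere,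
    real_inner_comm (x : E3) (y : E3)]
  simp; ring

/-- The vectors `x × y`, `y - t x` and `x - t y` all have squared length `1 - t²`. This factor
compensates the growth of `κ'` at `±1`. -/
theorem norm_kernelVecDeriv_le (x y : S2) (w : E3) :
    ‖kernelVecDeriv x y w‖ ≤ 2 * (1 - inner ℝ (x : E3) (y : E3) ^ 2) * ‖w‖ := by
  have h1 : ‖cross x y‖ ^ 2 = 1 - inner ℝ (x : E3) (y : E3) ^ 2 := by
    rw [← real_inner_self_eq_norm_sq, inner_cross_cross, inner_self_sphere, inner_self_sphere,
      real_inner_comm (x : E3) (y : E3)]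
    ring
  have h2 := norm_sub_inner_smul_sq x y
  have h3 := norm_sub_inner_smul_sq y x
  rw [real_inner_comm] at h3
  refine (norm_add_le _ _).trans ?_
  rw [norm_smul, norm_smul, norm_neg, Real.norm_eq_abs, Real.norm_eq_abs]
  have h4 := abs_real_inner_le_norm (cross x y) w
  have h5 := abs_real_inner_le_norm ((x : E3) - inner ℝ (x : E3) (y : E3) • (y : E3)) w
  have h6 : ‖(x : E3) - inner ℝ (x : E3) (y : E3) • (y : E3)‖
      = ‖(y : E3) - inner ℝ (x : E3) (y : E3) • (x : E3)‖ := by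
    rw [← sq_eq_sq₀ (norm_nonneg _) (norm_nonneg _), h2, h3]
  rw [h6] at h5
  calc _ ≤ (‖cross x y‖ * ‖w‖) * ‖cross x y‖
        + (‖(y : E3) - inner ℝ (x : E3) (y : E3) • (x : E3)‖ * ‖w‖)
          * ‖(y : E3) - inner ℝ (x : E3) (y : E3) • (x : E3)‖ := by gcongr
    _ = _ := by linear_combination ‖w‖ * h1 + ‖w‖ * h2

theorem norm_sub_inner_smul_le (x : S2) (w : E3) :
    ‖w - inner ℝ (x : E3) w • (x : E3)‖ ≤ 2 * ‖w‖ := by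
  refine (norm_sub_le _ _).trans ?_
  rw [norm_smul, norm_eq_of_mem_sphere, mul_one, Real.norm_eq_abs]
  have := abs_real_inner_le_norm (x : E3) w
  rw [norm_eq_of_mem_sphere, one_mul] at this
  linarith

theorem norm_kernelVecValue_le (x y : S2) (w : E3) : ‖kernelVecValue x y w‖ ≤ 6 * ‖w‖ := by
  have h1 := abs_real_inner_le_norm (x : E3) (y : E3)
  have h2 := abs_real_inner_le_norm (x : E3) w
  rw [norm_eq_of_mem_sphere, one_mul] at h1 h2
  rw [norm_eq_of_mem_sphere] at h1
  have h3 := norm_sub_inner_smul_le x (w - inner ℝ (y : E3) w • (y : E3))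
  have h4 := norm_sub_inner_smul_le y w
  refine (norm_add_le _ _).trans ?_
  have h5 : ‖inner ℝ (x : E3) (y : E3) • w - inner ℝ (x : E3) w • (y : E3)‖ ≤ 2 * ‖w‖ := by
    refine (norm_sub_le _ _).trans ?_
    rw [norm_smul, norm_smul, norm_eq_of_mem_sphere, mul_one, Real.norm_eq_abs, Real.norm_eq_abs]
    nlinarith [norm_nonneg w]
  linarith

theorem norm_kernelVec_le (a b : ℝ) (x y : S2) (w : E3) :
    ‖kernelVec a b x y w‖
      ≤ (2 * (|a| * (1 - inner ℝ (x : E3) (y : E3) ^ 2)) + 6 * |b|) * ‖w‖ := by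
  refine (norm_add_le _ _).trans ?_
  rw [norm_smul, norm_smul, Real.norm_eq_abs, Real.norm_eq_abs]
  calc _ ≤ |a| * (2 * (1 - inner ℝ (x : E3) (y : E3) ^ 2) * ‖w‖) + |b| * (6 * ‖w‖) := by
        gcongr
        · exact norm_kernelVecDeriv_le x y w
        · exact norm_kernelVecValue_le x y w
    _ = _ := by ring

theorem aestronglyMeasurable_kernelVec {a b : ℝ → ℝ} (ha : Measurable a) (hb : Measurable b)
    {f : S2 → E3} (hf : AEStronglyMeasurable f surf) (x : S2) :
    AEStronglyMeasurable (fun y : S2 => kernelVec (a (inner ℝ (x : E3) (y : E3)))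
      (b (inner ℝ (x : E3) (y : E3))) x y (f y)) surf := by
  have ht := (continuous_inner_sphere x).measurable
  have hy : AEStronglyMeasurable (fun y : S2 => (y : E3)) surf :=
    continuous_subtype_val.aestronglyMeasurable
  have hx : AEStronglyMeasurable (fun _ : S2 => (x : E3)) surf := aestronglyMeasurable_const
  have hi : AEStronglyMeasurable (fun y : S2 => inner ℝ (x : E3) (y : E3)) surf := hx.inner (𝕜 := ℝ) hy
  have hc : AEStronglyMeasurable (fun y : S2 => cross x y) surf :=
    (continuous_const.sphere_cross continuous_subtype_val).aestronglyMeasurable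
  have hw := hf.sub ((hy.inner (𝕜 := ℝ) hf).smul hy)
  refine (AEStronglyMeasurable.smul (ha.comp ht).aestronglyMeasurable ?_).add
    (AEStronglyMeasurable.smul (hb.comp ht).aestronglyMeasurable ?_)
  · exact (((hc.inner (𝕜 := ℝ) hf).neg).smul hc).add
      (((hx.sub (hi.smul hy)).inner (𝕜 := ℝ) hf).smul (hy.sub (hi.smul hx)))
  · exact ((hi.smul hf).sub ((hx.inner (𝕜 := ℝ) hf).smul hy)).add (hw.sub ((hx.inner (𝕜 := ℝ) hw).smul hx))

/-! ### The auxiliary function -/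

/-- On `(-1, 1)` the function `kappa` sees only the values on `[-1, 1]`, so a kernel may be replaced
by a continuous extension to the line. -/
theorem kappa_congr {ψ φ : ℝ → ℝ} (h : ∀ s ∈ Set.Icc (-1 : ℝ) 1, ψ s = φ s) {t : ℝ}
    (ht : t ∈ Set.Ioo (-1 : ℝ) 1) : kappa ψ t = kappa φ t := by
  unfold kappa
  congr 1
  refine intervalIntegral.integral_congr fun s hs => ?_
  rw [Set.uIcc_of_le ht.1.le] at hs
  simp only [h s ⟨hs.1, hs.2.trans ht.2.le⟩]

theorem deriv_kappa_congr {ψ φ : ℝ → ℝ} (h : ∀ s ∈ Set.Icc (-1 : ℝ) 1, ψ s = φ s) {t : ℝ}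
    (ht : t ∈ Set.Ioo (-1 : ℝ) 1) : deriv (kappa ψ) t = deriv (kappa φ) t :=
  EventuallyEq.deriv_eq (eventually_of_mem (Ioo_mem_nhds ht.1 ht.2) fun _ hs => kappa_congr h hs)

theorem zonalCoeff_congr {ψ φ : ℝ → ℝ} (h : ∀ s ∈ Set.Icc (-1 : ℝ) 1, ψ s = φ s) (ℓ : ℕ) :
    zonalCoeff ψ ℓ = zonalCoeff φ ℓ := by
  unfold zonalCoeff
  congr 1
  refine intervalIntegral.integral_congr fun s hs => ?_
  rw [Set.uIcc_of_le (by norm_num)] at hs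
  simp only [h s hs]

theorem one_sub_sq_pos {t : ℝ} (ht : t ∈ Set.Ioo (-1 : ℝ) 1) : 0 < 1 - t ^ 2 := by
  nlinarith [ht.1, ht.2]

theorem measurable_kappa {ψ : ℝ → ℝ} (hψ : Continuous ψ) : Measurable (kappa ψ) := by
  unfold kappa
  refine Measurable.mul (by fun_prop) ?_
  exact (intervalIntegral.continuous_primitive
    (fun a b => (by fun_prop : Continuous fun s => 1 - 4 * Real.pi * ψ s).intervalIntegrable a b)
    (-1)).measurable

theorem hasDerivAt_kappa {ψ : ℝ → ℝ} (hψ : Continuous ψ) {t : ℝ} (ht : t ∈ Set.Ioo (-1 : ℝ) 1) :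
    HasDerivAt (kappa ψ)
      ((1 - 4 * Real.pi * ψ t) / (4 * Real.pi * (1 - t ^ 2)) + 2 * t / (1 - t ^ 2) * kappa ψ t) t := by
  have hc : Continuous fun s => 1 - 4 * Real.pi * ψ s := by fun_prop
  have hp := Real.pi_pos
  have h0 := (one_sub_sq_pos ht).ne'
  have h1 := intervalIntegral.integral_hasDerivAt_right (hc.intervalIntegrable (-1) t)
    hc.stronglyMeasurable.stronglyMeasurableAtFilter hc.continuousAt
  have h2 := ((((hasDerivAt_id t).pow 2).const_sub 1).const_mul (4 * Real.pi)).inv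
    (by simp only [id, Pi.pow_apply]; positivity)
  refine (h2.mul h1).congr_deriv ?_
  simp only [id, Pi.pow_apply, kappa, Pi.inv_apply]
  field_simp
  push_cast
  ring

theorem abs_integral_sub_le {ψ φ : ℝ → ℝ} {ε a b : ℝ} (hab : a ≤ b) (ha : -1 ≤ a) (hb : b ≤ 1)
    (h : ∀ s ∈ Set.Icc (-1 : ℝ) 1, |ψ s - φ s| ≤ ε) : |∫ s in a..b, (ψ s - φ s)| ≤ ε * (b - a) := by
  have := intervalIntegral.norm_integral_le_of_norm_le_const (a := a) (b := b)
    (f := fun s => ψ s - φ s) (C := ε) fun s hs => by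
      rw [Set.uIoc_of_le hab] at hs
      exact h s ⟨ha.trans hs.1.le, hs.2.trans hb⟩
  rwa [abs_of_nonneg (sub_nonneg.2 hab)] at this

theorem zonalCoeff_zero (ψ : ℝ → ℝ) :
    zonalCoeff ψ 0 = 2 * Real.pi * ∫ t in (-1 : ℝ)..1, ψ t := by
  simp [zonalCoeff, legendreP]

/-- The difference is minus `∫ (ψ - φ)` over `[-1, t]`, divided by `1 - t²`. By equality of the
means that integral is also minus the one over `[t, 1]`, so its modulus is at most `ε` times the
distance from `t` to the nearer endpoint, which is at most `1 - t²`. -/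
theorem abs_kappa_sub_le {ψ φ : ℝ → ℝ} (hψ : Continuous ψ) (hφ : Continuous φ)
    (h0 : zonalCoeff ψ 0 = zonalCoeff φ 0) {ε : ℝ}
    (h : ∀ s ∈ Set.Icc (-1 : ℝ) 1, |ψ s - φ s| ≤ ε) {t : ℝ} (ht : t ∈ Set.Ioo (-1 : ℝ) 1) :
    |kappa ψ t - kappa φ t| ≤ ε := by
  have hp := Real.pi_pos
  have hs := one_sub_sq_pos ht
  have hI : ∀ a b : ℝ, IntervalIntegrable (fun s => ψ s - φ s) volume a b := fun a b =>
    (hψ.sub hφ).intervalIntegrable a b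
  have e : kappa ψ t - kappa φ t = -((∫ s in (-1 : ℝ)..t, (ψ s - φ s)) / (1 - t ^ 2)) := by
    unfold kappa
    rw [← mul_sub, ← intervalIntegral.integral_sub
      ((by fun_prop : Continuous fun s => 1 - 4 * Real.pi * ψ s).intervalIntegrable _ _)
      ((by fun_prop : Continuous fun s => 1 - 4 * Real.pi * φ s).intervalIntegrable _ _)]
    have : ∀ s, 1 - 4 * Real.pi * ψ s - (1 - 4 * Real.pi * φ s)
        = (-(4 * Real.pi)) * (ψ s - φ s) := fun s => by ring
    simp_rw [this]
    rw [intervalIntegral.integral_const_mul]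
    field_simp
  have hz : ∫ s in (-1 : ℝ)..1, (ψ s - φ s) = 0 := by
    rw [intervalIntegral.integral_sub (hψ.intervalIntegrable _ _) (hφ.intervalIntegrable _ _)]
    rw [zonalCoeff_zero, zonalCoeff_zero] at h0
    rw [mul_left_cancel₀ (by positivity) h0, sub_self]
  have h1 := abs_integral_sub_le (ψ := ψ) (φ := φ) ht.1.le le_rfl ht.2.le h
  have h2 := abs_integral_sub_le (ψ := ψ) (φ := φ) ht.2.le ht.1.le le_rfl h
  have h3 := intervalIntegral.integral_add_adjacent_intervals (hI (-1) t) (hI t 1)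
  rw [hz] at h3
  have hε : 0 ≤ ε := (abs_nonneg _).trans (h 0 (by norm_num))
  rw [e, abs_neg, abs_div, abs_of_pos hs, div_le_iff₀ hs]
  rcases le_total 0 t with h4 | h4
  · rw [show ∫ s in (-1 : ℝ)..t, (ψ s - φ s) = -∫ s in t..1, (ψ s - φ s) by linarith, abs_neg]
    refine h2.trans (mul_le_mul_of_nonneg_left ?_ hε)
    nlinarith [ht.2]
  · refine h1.trans (mul_le_mul_of_nonneg_left ?_ hε)
    nlinarith [ht.1]

/-- From `(1 - t²) κ' = 1/(4π) - ψ + 2tκ`: the kernel itself accounts for `ε` and `2tκ` for `2ε`. -/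
theorem abs_deriv_kappa_sub_le {ψ φ : ℝ → ℝ} (hψ : Continuous ψ) (hφ : Continuous φ)
    (h0 : zonalCoeff ψ 0 = zonalCoeff φ 0) {ε : ℝ}
    (h : ∀ s ∈ Set.Icc (-1 : ℝ) 1, |ψ s - φ s| ≤ ε) {t : ℝ} (ht : t ∈ Set.Ioo (-1 : ℝ) 1) :
    |deriv (kappa ψ) t - deriv (kappa φ) t| * (1 - t ^ 2) ≤ 3 * ε := by
  have hp := Real.pi_pos
  have hs := one_sub_sq_pos ht
  have h1 := abs_kappa_sub_le hψ hφ h0 h ht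
  have h2 := h t ⟨ht.1.le, ht.2.le⟩
  rw [(hasDerivAt_kappa hψ ht).deriv, (hasDerivAt_kappa hφ ht).deriv, ← abs_of_pos hs, ← abs_mul,
    abs_of_pos hs]
  have e : ((1 - 4 * Real.pi * ψ t) / (4 * Real.pi * (1 - t ^ 2)) + 2 * t / (1 - t ^ 2) * kappa ψ t
      - ((1 - 4 * Real.pi * φ t) / (4 * Real.pi * (1 - t ^ 2)) + 2 * t / (1 - t ^ 2) * kappa φ t))
        * (1 - t ^ 2) = -(ψ t - φ t) + 2 * t * (kappa ψ t - kappa φ t) := by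
    have := hs.ne'
    field_simp
    ring
  rw [e]
  refine (abs_add_le _ _).trans ?_
  rw [abs_neg, abs_mul, abs_mul, abs_two]
  have h3 : |t| ≤ 1 := abs_le.2 ⟨ht.1.le, ht.2.le⟩
  nlinarith [abs_nonneg t, abs_nonneg (kappa ψ t - kappa φ t)]

theorem ae_inner_mem_Ioo (x : S2) :
    ∀ᵐ y : S2 ∂surf, inner ℝ (x : E3) (y : E3) ∈ Set.Ioo (-1 : ℝ) 1 := by
  have h1 := measure_eq_zero_iff_ae_notMem.1 (surf_singleton x)
  have h2 := measure_eq_zero_iff_ae_notMem.1 (surf_singleton (-x))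
  filter_upwards [h1, h2] with y hy1 hy2
  have hx := norm_eq_of_mem_sphere x
  have hy := norm_eq_of_mem_sphere y
  constructor
  · have : inner ℝ (x : E3) (-(y : E3)) < 1 := by
      refine (inner_lt_one_iff_real_of_norm_eq_one hx (by rwa [norm_neg])).2 fun e => hy2 ?_
      rw [Set.mem_singleton_iff]
      exact Subtype.ext (by rw [coe_neg_sphere, e, neg_neg])
    rw [inner_neg_right] at this
    linarith
  · exact (inner_lt_one_iff_real_of_norm_eq_one hx hy).2 fun e => hy1 (Subtype.ext e.symm)

theorem integrable_kernelVec {a b : ℝ → ℝ} (ha : Measurable a) (hb : Measurable b) {M : ℝ}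
    (hM : ∀ t ∈ Set.Ioo (-1 : ℝ) 1, |a t| * (1 - t ^ 2) ≤ M ∧ |b t| ≤ M)
    {f : S2 → E3} (hf : Integrable f surf) (x : S2) :
    Integrable (fun y : S2 => kernelVec (a (inner ℝ (x : E3) (y : E3)))
      (b (inner ℝ (x : E3) (y : E3))) x y (f y)) surf := by
  refine (hf.norm.const_mul (2 * M + 6 * M)).mono'
    (aestronglyMeasurable_kernelVec ha hb hf.aestronglyMeasurable x) ?_
  filter_upwards [ae_inner_mem_Ioo x] with y hy
  refine (norm_kernelVec_le _ _ _ _ _).trans ?_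
  have := hM _ hy
  gcongr
  · exact this.1
  · exact this.2

theorem integrable_kernelVec_of_continuous {a b : ℝ → ℝ} (ha : Continuous a) (hb : Continuous b)
    {f : S2 → E3} (hf : Integrable f surf) (x : S2) :
    Integrable (fun y : S2 => kernelVec (a (inner ℝ (x : E3) (y : E3)))
      (b (inner ℝ (x : E3) (y : E3))) x y (f y)) surf := by
  obtain ⟨A, hA⟩ := (isCompact_Icc (a := (-1 : ℝ)) (b := 1)).exists_bound_of_continuousOn
    ha.continuousOn
  obtain ⟨B, hB⟩ := (isCompact_Icc (a := (-1 : ℝ)) (b := 1)).exists_bound_of_continuousOn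
    hb.continuousOn
  refine integrable_kernelVec ha.measurable hb.measurable (M := max A B) (fun t ht => ⟨?_, ?_⟩) hf x
  · refine le_max_of_le_left ?_
    have h1 := hA t ⟨ht.1.le, ht.2.le⟩
    rw [Real.norm_eq_abs] at h1
    nlinarith [abs_nonneg (a t), sq_nonneg t]
  · exact le_max_of_le_right (hB t ⟨ht.1.le, ht.2.le⟩)

/-! ### The component of a vector field of fixed degree -/

/-- The component of degree `ℓ` of a vector field. -/
def fieldPart (Y : (ℓ : ℕ) → Fin (2 * ℓ + 1) → MvPolynomial (Fin 3) ℝ) (f : S2 → E3) (ℓ : ℕ)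
    (x : S2) : E3 :=
  ∑ k, (ip f (vecDiv ℓ (Y ℓ k)) • vecDiv ℓ (Y ℓ k) x
    + ip f (vecCurl ℓ (Y ℓ k)) • vecCurl ℓ (Y ℓ k) x)

theorem cross_eq_neg (x y : E3) : cross x y = -cross y x :=
  ext_three (by simp [mul_comm]) (by simp [mul_comm]) (by simp [mul_comm])

theorem ip_vecDiv (f : S2 → E3) (ℓ : ℕ) (p : MvPolynomial (Fin 3) ℝ) : ip f (vecDiv ℓ p)
    = (√(lam ℓ))⁻¹ * ∫ y : S2, inner ℝ (grad p y) (cross (f y) y) ∂surf := by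
  simp only [ip, vecDiv, inner_smul_right, inner_surfCurl]
  rw [integral_const_mul]

theorem ip_vecCurl {f : S2 → E3} (hf : MemL2Tangent f) (ℓ : ℕ) (p : MvPolynomial (Fin 3) ℝ) :
    ip f (vecCurl ℓ p) = (√(lam ℓ))⁻¹ * ∫ y : S2, inner ℝ (grad p y) (f y) ∂surf := by
  simp only [ip, vecCurl, inner_smul_right]
  rw [integral_const_mul]
  congr 1
  refine integral_congr_ae ?_
  filter_upwards [hf.tangential] with y hy
  rw [inner_surfGrad_of_tangent _ _ hy]

theorem inner_surfGrad (p : MvPolynomial (Fin 3) ℝ) (x : S2) (v : E3) :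
    inner ℝ v (surfGrad p x) = inner ℝ (grad p x) (v - inner ℝ (x : E3) v • (x : E3)) := by
  rw [surfGrad, inner_sub_right, inner_sub_right, inner_smul_right, inner_smul_right,
    real_inner_comm v, real_inner_comm (x : E3) (grad p x), real_inner_comm (x : E3) v]
  ring

theorem inner_sub_proj (x : S2) (v : E3) :
    inner ℝ (x : E3) (v - inner ℝ (x : E3) v • (x : E3)) = 0 := by
  rw [inner_sub_right, inner_smul_right, inner_self_sphere, mul_one, sub_self]

/-- The component of degree `ℓ` is given by the kernel of the Legendre polynomial of degree `ℓ`. -/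
theorem fieldPart_eq_integral {Y : (ℓ : ℕ) → Fin (2 * ℓ + 1) → MvPolynomial (Fin 3) ℝ} {ℓ : ℕ}
    (hY : IsHarmonicBasis ℓ (Y ℓ)) (hℓ : 1 ≤ ℓ) {f : S2 → E3} (hf : MemL2Tangent f) (x : S2) :
    fieldPart Y f ℓ x = ∫ y : S2, kernelVec
      ((2 * ℓ + 1) / (4 * Real.pi) / lam ℓ *
        (legendreP ℓ).derivative.derivative.eval (inner ℝ (x : E3) (y : E3)))
      ((2 * ℓ + 1) / (4 * Real.pi) / lam ℓ *
        (legendreP ℓ).derivative.eval (inner ℝ (x : E3) (y : E3))) x y (f y) ∂surf := by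
  have hfi : Integrable f surf := hf.memLp.integrable (by norm_num)
  have hl := lam_pos hℓ
  have hci : Integrable (fun y : S2 => cross (f y) y) surf := by
    refine hfi.cross_sphere.neg.congr (Eventually.of_forall fun y => ?_)
    exact (cross_eq_neg (f y) y).symm
  refine ext_inner_left ℝ fun v => ?_
  rw [← integral_inner (integrable_kernelVec_of_continuous
    (a := fun t => (2 * ℓ + 1) / (4 * Real.pi) / lam ℓ *
      (legendreP ℓ).derivative.derivative.eval t)
    (b := fun t => (2 * ℓ + 1) / (4 * Real.pi) / lam ℓ * (legendreP ℓ).derivative.eval t)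
    ((Polynomial.continuous _).const_mul _) ((Polynomial.continuous _).const_mul _) hfi x)]
  set v' := v - inner ℝ (x : E3) v • (x : E3) with hv'
  -- Tested against `v`, the kernel splits by `inner_kernelVec` into a curl and a gradient part, and
  -- the twice differentiated addition theorem separates the variables `x` and `y` in each.
  have e : ∀ᵐ y : S2 ∂surf, inner ℝ v (kernelVec
      ((2 * ℓ + 1) / (4 * Real.pi) / lam ℓ *
        (legendreP ℓ).derivative.derivative.eval (inner ℝ (x : E3) (y : E3)))
      ((2 * ℓ + 1) / (4 * Real.pi) / lam ℓ *
        (legendreP ℓ).derivative.eval (inner ℝ (x : E3) (y : E3))) x y (f y))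
      = ∑ k, (lam ℓ)⁻¹ * (inner ℝ (grad (Y ℓ k) x) (cross v x)
            * inner ℝ (grad (Y ℓ k) y) (cross (f y) y)
          + inner ℝ (grad (Y ℓ k) x) v' * inner ℝ (grad (Y ℓ k) y) (f y)) := by
    filter_upwards [hf.tangential] with y hy
    rw [inner_kernelVec _ _ _ _ _ hy, ← Finset.mul_sum, Finset.sum_add_distrib,
      addition_theorem_deriv_deriv hY x y (inner_cross_self_right v x)
        (inner_cross_self_right (f y) y),
      addition_theorem_deriv_deriv hY x y (inner_sub_proj x v) hy, ← hv']
    ring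
  have hi : ∀ k, Integrable (fun y : S2 => (lam ℓ)⁻¹ *
      (inner ℝ (grad (Y ℓ k) x) (cross v x) * inner ℝ (grad (Y ℓ k) y) (cross (f y) y)
        + inner ℝ (grad (Y ℓ k) x) v' * inner ℝ (grad (Y ℓ k) y) (f y))) surf := fun k =>
    (((hci.continuous_inner_sphere (continuous_grad_sphere _)).const_mul _).add
      ((hfi.continuous_inner_sphere (continuous_grad_sphere _)).const_mul _)).const_mul _
  rw [integral_congr_ae e, integral_finsetSum _ fun k _ => hi k, fieldPart, inner_sum]
  refine Finset.sum_congr rfl fun k _ => ?_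
  rw [integral_const_mul, integral_add
    ((hci.continuous_inner_sphere (continuous_grad_sphere _)).const_mul _)
    ((hfi.continuous_inner_sphere (continuous_grad_sphere _)).const_mul _), integral_const_mul,
    integral_const_mul, inner_add_right, inner_smul_right, inner_smul_right, ip_vecDiv,
    ip_vecCurl hf, vecDiv, vecCurl, inner_smul_right, inner_smul_right, inner_surfCurl,
    inner_surfGrad, ← hv']
  have hs : (lam ℓ)⁻¹ = (√(lam ℓ))⁻¹ * (√(lam ℓ))⁻¹ := by
    rw [← mul_inv, Real.mul_self_sqrt hl.le]
  rw [hs]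
  ring

/-! ### Convolution with polynomial kernels -/

/-- The condition on `a 0` removes the constant term of `1 - 4πψ`; each remaining `P_ℓ` integrates
to a multiple of `1 - t²`, which cancels the denominator. -/
theorem kappa_legendre_sum (N : ℕ) (a : ℕ → ℝ) (ha : a 0 = 1 / (4 * Real.pi)) {t : ℝ}
    (ht : t ∈ Set.Ioo (-1 : ℝ) 1) :
    kappa (fun t => (∑ m ∈ Finset.range (N + 1), Polynomial.C (a m) * legendreP m).eval t) t
      = ∑ n ∈ Finset.range N,
        a (n + 1) / lam (n + 1) * (legendreP (n + 1)).derivative.eval t := by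
  have hp := Real.pi_pos
  have hs := one_sub_sq_pos ht
  have e : ∀ s : ℝ, 1 - 4 * Real.pi *
      (∑ m ∈ Finset.range (N + 1), Polynomial.C (a m) * legendreP m).eval s
      = -(4 * Real.pi) * ∑ n ∈ Finset.range N, a (n + 1) * (legendreP (n + 1)).eval s := by
    intro s
    have h0 : (legendreP 0).eval s = 1 := by simp [legendreP]
    rw [Finset.sum_range_succ', Polynomial.eval_add, Polynomial.eval_finsetSum]
    simp only [Polynomial.eval_mul, Polynomial.eval_C, h0, ha]
    field_simp
    ring
  unfold kappa
  simp_rw [e]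
  rw [intervalIntegral.integral_const_mul, intervalIntegral.integral_finsetSum fun n _ =>
    (intervalIntegrable_eval _ _ _).const_mul _, Finset.mul_sum, Finset.mul_sum]
  refine Finset.sum_congr rfl fun n _ => ?_
  rw [intervalIntegral.integral_const_mul, integral_legendreP_eq (by omega)]
  have := (lam_pos (Nat.le_add_left 1 n)).ne'
  field_simp

theorem deriv_kappa_legendre_sum (N : ℕ) (a : ℕ → ℝ) (ha : a 0 = 1 / (4 * Real.pi)) {t : ℝ}
    (ht : t ∈ Set.Ioo (-1 : ℝ) 1) :
    deriv (kappa fun t =>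
        (∑ m ∈ Finset.range (N + 1), Polynomial.C (a m) * legendreP m).eval t) t
      = ∑ n ∈ Finset.range N,
        a (n + 1) / lam (n + 1) * (legendreP (n + 1)).derivative.derivative.eval t := by
  have h : HasDerivAt (fun t => ∑ n ∈ Finset.range N,
        a (n + 1) / lam (n + 1) * (legendreP (n + 1)).derivative.eval t)
      (∑ n ∈ Finset.range N,
        a (n + 1) / lam (n + 1) * (legendreP (n + 1)).derivative.derivative.eval t) t :=
    HasDerivAt.fun_sum fun n _ => (Polynomial.hasDerivAt _ _).const_mul _
  rw [← h.deriv]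
  exact EventuallyEq.deriv_eq (eventually_of_mem (Ioo_mem_nhds ht.1 ht.2) fun _ hs =>
    kappa_legendre_sum N a ha hs)

theorem kernelVec_sum {ι : Type*} (s : Finset ι) (z a b : ι → ℝ) (x y w : E3) :
    kernelVec (∑ i ∈ s, z i * a i) (∑ i ∈ s, z i * b i) x y w
      = ∑ i ∈ s, z i • kernelVec (a i) (b i) x y w := by
  simp only [kernelVec, Finset.sum_smul, smul_add, Finset.sum_add_distrib, mul_smul]

/-- The sum is finite. Stating it as `HasSum` lets it be subtracted term by term from the series of
a continuous kernel. -/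
theorem conv_polynomial {Y : (ℓ : ℕ) → Fin (2 * ℓ + 1) → MvPolynomial (Fin 3) ℝ}
    (hY : ∀ ℓ, IsHarmonicBasis ℓ (Y ℓ)) (q : Polynomial ℝ)
    (hq : zonalCoeff (fun t => q.eval t) 0 = 1) {f : S2 → E3} (hf : MemL2Tangent f) (x : S2) :
    HasSum (fun n => zonalCoeff (fun t => q.eval t) (n + 1) • fieldPart Y f (n + 1) x)
      (conv (fun t => q.eval t) f x) := by
  have hp := Real.pi_pos
  have hfi : Integrable f surf := hf.memLp.integrable (by norm_num)
  obtain ⟨a, ha⟩ := exists_legendre_expansion q.natDegree q le_rfl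
  set N := q.natDegree
  have hz : ∀ ℓ, zonalCoeff (fun t => q.eval t) ℓ
      = if ℓ < N + 1 then 4 * Real.pi / (2 * ℓ + 1) * a ℓ else 0 := by
    intro ℓ
    rw [← zonalCoeff_sum, ← ha]
  have ha0 : a 0 = 1 / (4 * Real.pi) := by
    rw [hz, if_pos (Nat.succ_pos _)] at hq
    rw [eq_div_iff (by positivity), ← hq]
    simp; ring
  have hval : conv (fun t => q.eval t) f x = ∑ n ∈ Finset.range N,
      zonalCoeff (fun t => q.eval t) (n + 1) • fieldPart Y f (n + 1) x := by
    have hc : ∀ n ∈ Finset.range N, ∀ r : ℝ, a (n + 1) / lam (n + 1) * r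
        = zonalCoeff (fun t => q.eval t) (n + 1) *
          ((2 * (n + 1 : ℕ) + 1) / (4 * Real.pi) / lam (n + 1) * r) := by
      intro n hn r
      rw [hz, if_pos (by rw [Finset.mem_range] at hn; omega)]
      have := (lam_pos (Nat.le_add_left 1 n)).ne'
      field_simp
    have e : ∀ᵐ y : S2 ∂surf, convIntegrand (fun t => q.eval t) f x y
        = ∑ n ∈ Finset.range N, zonalCoeff (fun t => q.eval t) (n + 1) • kernelVec
          ((2 * (n + 1 : ℕ) + 1) / (4 * Real.pi) / lam (n + 1) *
            (legendreP (n + 1)).derivative.derivative.eval (inner ℝ (x : E3) (y : E3)))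
          ((2 * (n + 1 : ℕ) + 1) / (4 * Real.pi) / lam (n + 1) *
            (legendreP (n + 1)).derivative.eval (inner ℝ (x : E3) (y : E3))) x y (f y) := by
      filter_upwards [ae_inner_mem_Ioo x] with y hy
      have h1 := kappa_legendre_sum N a ha0 hy
      have h2 := deriv_kappa_legendre_sum N a ha0 hy
      rw [← ha] at h1 h2
      rw [convIntegrand_eq_kernelVec, h1, h2, ← kernelVec_sum]
      congr 1
      · exact Finset.sum_congr rfl fun n hn => hc n hn _
      · exact Finset.sum_congr rfl fun n hn => hc n hn _
    have hi : ∀ n : ℕ, Integrable (fun y : S2 => zonalCoeff (fun t => q.eval t) (n + 1) • kernelVec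
          ((2 * (n + 1 : ℕ) + 1) / (4 * Real.pi) / lam (n + 1) *
            (legendreP (n + 1)).derivative.derivative.eval (inner ℝ (x : E3) (y : E3)))
          ((2 * (n + 1 : ℕ) + 1) / (4 * Real.pi) / lam (n + 1) *
            (legendreP (n + 1)).derivative.eval (inner ℝ (x : E3) (y : E3))) x y (f y)) surf :=
      fun n => Integrable.smul (zonalCoeff (fun t => q.eval t) (n + 1))
        (integrable_kernelVec_of_continuous
        (a := fun t => (2 * (n + 1 : ℕ) + 1) / (4 * Real.pi) / lam (n + 1) *
          (legendreP (n + 1)).derivative.derivative.eval t)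
        (b := fun t => (2 * (n + 1 : ℕ) + 1) / (4 * Real.pi) / lam (n + 1) *
          (legendreP (n + 1)).derivative.eval t)
        ((Polynomial.continuous _).const_mul _) ((Polynomial.continuous _).const_mul _)
        hfi x)
    rw [conv, integral_congr_ae e, integral_finsetSum _ fun n _ => hi n]
    refine Finset.sum_congr rfl fun n _ => ?_
    rw [integral_smul, fieldPart_eq_integral (hY _) (by omega) hf]
  rw [hval]
  refine hasSum_sum_of_ne_finset_zero fun n hn => ?_
  rw [hz, if_neg (by rw [Finset.mem_range] at hn; omega), zero_smul]

/-! ### Convolution with continuous kernels -/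

/-- Comparison with the constant kernel `1/(4π)`, whose degree-zero coefficient is `1` and whose
`kappa` is zero. -/
theorem integrable_convIntegrand {ψ : ℝ → ℝ} (hψ : Continuous ψ) (h0 : zonalCoeff ψ 0 = 1)
    {f : S2 → E3} (hf : Integrable f surf) (x : S2) : Integrable (convIntegrand ψ f x) surf := by
  have hp := Real.pi_pos
  have hc0 : zonalCoeff ψ 0 = zonalCoeff (fun _ => 1 / (4 * Real.pi)) 0 := by
    rw [h0, zonalCoeff_zero]; simp; field_simp; norm_num
  have hk : kappa (fun _ => 1 / (4 * Real.pi)) = 0 := by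
    funext t
    have : 1 - 4 * Real.pi * (1 / (4 * Real.pi)) = 0 := by field_simp; ring
    simp only [kappa, this]
    simp
  obtain ⟨A, hA⟩ := (isCompact_Icc (a := (-1 : ℝ)) (b := 1)).exists_bound_of_continuousOn
    (hψ.sub (continuous_const (y := 1 / (4 * Real.pi)))).continuousOn
  have h1 := fun t ht => abs_kappa_sub_le hψ continuous_const hc0 hA (t := t) ht
  have h2 := fun t ht => abs_deriv_kappa_sub_le hψ continuous_const hc0 hA (t := t) ht
  simp only [hk, Pi.zero_apply, sub_zero, deriv_zero] at h1 h2
  simp_rw [funext (convIntegrand_eq_kernelVec ψ f x)]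
  refine integrable_kernelVec (measurable_deriv _) (measurable_kappa hψ) (M := 3 * A)
    (fun t ht => ⟨h2 t ht, (h1 t ht).trans ?_⟩) hf x
  linarith [(abs_nonneg _).trans (h1 t ht)]

/-- The constant is `12 = 2 · 3 + 6`: the bound `3ε` for the `κ'` part and `ε` for the `κ` part
enter `norm_kernelVec_le` with the factors `2` and `6`. -/
theorem norm_conv_sub_le {ψ φ : ℝ → ℝ} (hψ : Continuous ψ) (hφ : Continuous φ)
    (h0 : zonalCoeff ψ 0 = 1) (h1 : zonalCoeff φ 0 = 1) {ε : ℝ}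
    (h : ∀ s ∈ Set.Icc (-1 : ℝ) 1, |ψ s - φ s| ≤ ε) {f : S2 → E3} (hf : Integrable f surf)
    (x : S2) : ‖conv ψ f x - conv φ f x‖ ≤ 12 * ε * ∫ y, ‖f y‖ ∂surf := by
  rw [conv, conv, ← integral_sub (integrable_convIntegrand hψ h0 hf x)
    (integrable_convIntegrand hφ h1 hf x), ← integral_const_mul]
  refine norm_integral_le_of_norm_le (hf.norm.const_mul _) ?_
  filter_upwards [ae_inner_mem_Ioo x] with y hy
  have e : convIntegrand ψ f x y - convIntegrand φ f x y
      = kernelVec (deriv (kappa ψ) (inner ℝ (x : E3) (y : E3))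
          - deriv (kappa φ) (inner ℝ (x : E3) (y : E3)))
        (kappa ψ (inner ℝ (x : E3) (y : E3)) - kappa φ (inner ℝ (x : E3) (y : E3))) x y (f y) := by
    rw [convIntegrand_eq_kernelVec, convIntegrand_eq_kernelVec]
    simp only [kernelVec]
    module
  rw [e]
  refine (norm_kernelVec_le _ _ _ _ _).trans ?_
  have h2 := abs_kappa_sub_le hψ hφ (h0.trans h1.symm) h hy
  have h3 := abs_deriv_kappa_sub_le hψ hφ (h0.trans h1.symm) h hy
  gcongr
  linarith

theorem abs_zonalCoeff_sub_le {ψ φ : ℝ → ℝ} (hψ : Continuous ψ) (hφ : Continuous φ) {ε : ℝ}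
    (h : ∀ s ∈ Set.Icc (-1 : ℝ) 1, |ψ s - φ s| ≤ ε) (ℓ : ℕ) :
    |zonalCoeff ψ ℓ - zonalCoeff φ ℓ| ≤ 4 * Real.pi * ε := by
  have hp := Real.pi_pos
  have hε : 0 ≤ ε := (abs_nonneg _).trans (h 0 (by norm_num))
  have hc := (legendreP ℓ).continuous
  have e : zonalCoeff ψ ℓ - zonalCoeff φ ℓ
      = 2 * Real.pi * ∫ t in (-1 : ℝ)..1, (ψ t - φ t) * (legendreP ℓ).eval t := by
    simp only [zonalCoeff, sub_mul]
    rw [← mul_sub, intervalIntegral.integral_sub]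
    · exact (hψ.mul hc).intervalIntegrable _ _
    · exact (hφ.mul hc).intervalIntegrable _ _
  have h1 : |∫ t in (-1 : ℝ)..1, (ψ t - φ t) * (legendreP ℓ).eval t|
      ≤ ∫ t in (-1 : ℝ)..1, ε * |(legendreP ℓ).eval t| := by
    refine (intervalIntegral.abs_integral_le_integral_abs (by norm_num)).trans ?_
    refine intervalIntegral.integral_mono_on (by norm_num)
      (((hψ.sub hφ).mul hc).abs.intervalIntegrable _ _)
      ((hc.abs.const_mul ε).intervalIntegrable _ _) fun t ht => ?_
    rw [abs_mul]
    gcongr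
    exact h t ht
  rw [intervalIntegral.integral_const_mul] at h1
  have h2 := integral_abs_legendreP_le ℓ
  rw [e, abs_mul, abs_of_pos (by positivity)]
  calc _ ≤ 2 * Real.pi * (ε * 2) := by gcongr; exact h1.trans (by gcongr)
    _ = _ := by ring

theorem abs_zonalCoeff_le {ψ : ℝ → ℝ} (hψ : Continuous ψ) :
    ∃ M : ℝ, ∀ ℓ, |zonalCoeff ψ ℓ| ≤ M := by
  obtain ⟨A, hA⟩ := (isCompact_Icc (a := (-1 : ℝ)) (b := 1)).exists_bound_of_continuousOn
    hψ.continuousOn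
  refine ⟨4 * Real.pi * A, fun ℓ => ?_⟩
  have := abs_zonalCoeff_sub_le (φ := fun _ => 0) hψ continuous_const (by simpa using hA) ℓ
  simpa [zonalCoeff] using this

/-- Weierstrass approximation of zonal kernels with prescribed mean. -/
theorem exists_polynomial_near_zonal {ψ : ℝ → ℝ} (hψ : Continuous ψ) (h0 : zonalCoeff ψ 0 = 1)
    {ε : ℝ} (hε : 0 < ε) : ∃ q : Polynomial ℝ, zonalCoeff (fun t => q.eval t) 0 = 1 ∧
      ∀ s ∈ Set.Icc (-1 : ℝ) 1, |ψ s - q.eval s| ≤ ε := by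
  have hp := Real.pi_pos
  obtain ⟨p, hp1⟩ := exists_polynomial_near_of_continuousOn (-1) 1 ψ hψ.continuousOn (ε / 2)
    (half_pos hε)
  have hp2 : ∀ s ∈ Set.Icc (-1 : ℝ) 1, |ψ s - p.eval s| ≤ ε / 2 := fun s hs => by
    rw [abs_sub_comm]; exact (hp1 s hs).le
  -- Adding a constant `c` raises the coefficient of degree zero by `4πc`, so this choice restores
  -- the value `1`; it costs at most another `ε / 2`.
  set c := (1 - zonalCoeff (fun t => p.eval t) 0) / (4 * Real.pi) with hc
  have h1 := abs_zonalCoeff_sub_le hψ p.continuous hp2 0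
  rw [h0] at h1
  have hc1 : |c| ≤ ε / 2 := by
    rw [hc, abs_div, abs_of_pos (by positivity : 0 < 4 * Real.pi), div_le_iff₀ (by positivity)]
    linarith
  refine ⟨p + Polynomial.C c, ?_, fun s hs => ?_⟩
  · rw [zonalCoeff_zero]
    simp only [Polynomial.eval_add, Polynomial.eval_C]
    rw [intervalIntegral.integral_add (intervalIntegrable_eval _ _ _) (by simp), mul_add,
      ← zonalCoeff_zero, intervalIntegral.integral_const, hc]
    simp only [smul_eq_mul]
    field_simp
    ring
  · rw [Polynomial.eval_add, Polynomial.eval_C, ← sub_sub]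
    refine (abs_sub _ _).trans ?_
    linarith [hp2 s hs]

/-- The convolution operator acts on the component of degree `ℓ` as multiplication by the
Fourier–Legendre coefficient. -/
theorem conv_eq_tsum {Y : (ℓ : ℕ) → Fin (2 * ℓ + 1) → MvPolynomial (Fin 3) ℝ}
    (hY : ∀ ℓ, IsHarmonicBasis ℓ (Y ℓ)) {ψ : ℝ → ℝ} (hψ : Continuous ψ)
    (h0 : zonalCoeff ψ 0 = 1) {f : S2 → E3} (hf : MemL2Tangent f) {x : S2}
    (hs : Summable fun n => ‖fieldPart Y f (n + 1) x‖) :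
    conv ψ f x = ∑' n, zonalCoeff ψ (n + 1) • fieldPart Y f (n + 1) x := by
  have hp := Real.pi_pos
  have hfi : Integrable f surf := hf.memLp.integrable (by norm_num)
  obtain ⟨M, hM⟩ := abs_zonalCoeff_le hψ
  have hsum : Summable fun n => zonalCoeff ψ (n + 1) • fieldPart Y f (n + 1) x := by
    refine Summable.of_norm_bounded (hs.mul_left M) fun n => ?_
    rw [norm_smul]
    gcongr
    exact hM _
  set I := ∫ y, ‖f y‖ ∂surf
  set T := ∑' n, ‖fieldPart Y f (n + 1) x‖
  have hI : 0 ≤ I := integral_nonneg fun y => norm_nonneg _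
  have hT : 0 ≤ T := tsum_nonneg fun n => norm_nonneg _
  -- Both sides are compared with those of a polynomial kernel `ε`-close to `ψ`, where they agree.
  -- Absolute summability of the components makes the series Lipschitz in the sup norm of the
  -- kernel.
  have key : ∀ ε : ℝ, 0 < ε → ‖conv ψ f x - ∑' n, zonalCoeff ψ (n + 1) • fieldPart Y f (n + 1) x‖
      ≤ ε * (12 * I + 4 * Real.pi * T) := by
    intro ε hε
    obtain ⟨q, hq0, hq⟩ := exists_polynomial_near_zonal hψ h0 hε
    have h1 := norm_conv_sub_le hψ q.continuous h0 hq0 hq hfi x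
    have h2 := (conv_polynomial hY q hq0 hf x).sub hsum.hasSum
    have h3 : ‖conv (fun t => q.eval t) f x
        - ∑' n, zonalCoeff ψ (n + 1) • fieldPart Y f (n + 1) x‖ ≤ 4 * Real.pi * ε * T := by
      rw [← h2.tsum_eq]
      refine tsum_of_norm_bounded (hs.hasSum.mul_left _) fun n => ?_
      rw [← sub_smul, norm_smul, Real.norm_eq_abs, abs_sub_comm]
      gcongr
      exact abs_zonalCoeff_sub_le hψ q.continuous hq _
    calc _ = ‖(conv ψ f x - conv (fun t => q.eval t) f x) + (conv (fun t => q.eval t) f x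
          - ∑' n, zonalCoeff ψ (n + 1) • fieldPart Y f (n + 1) x)‖ := by congr 1; abel
      _ ≤ _ := norm_add_le _ _
      _ ≤ 12 * ε * I + 4 * Real.pi * ε * T := add_le_add h1 h3
      _ = _ := by ring
  rw [← sub_eq_zero, ← norm_le_zero_iff]
  refine le_of_forall_pos_le_add fun δ hδ => ?_
  have hD : 0 < 12 * I + 4 * Real.pi * T + 1 := by positivity
  refine (key (δ / (12 * I + 4 * Real.pi * T + 1)) (by positivity)).trans ?_
  rw [zero_add, div_mul_eq_mul_div, div_le_iff₀ hD]
  nlinarith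

/-! ### Pointwise bounds -/

theorem norm_sq_eq_sum_three (x : E3) : ‖x‖ ^ 2 = x 0 ^ 2 + x 1 ^ 2 + x 2 ^ 2 := by
  rw [← real_inner_self_eq_norm_sq, inner_eq_sum_three]; ring

/-- Take `y = x` and `v = w` the tangential part of a coordinate vector. The `P_ℓ''` term vanishes
since `v ⟂ x`, `P_ℓ'(1) = λ_ℓ/2`, and the squared lengths `1 - x_i²` add up to `2`. -/
theorem sum_norm_surfGrad_sq {ℓ : ℕ} {Y : Fin (2 * ℓ + 1) → MvPolynomial (Fin 3) ℝ}
    (hY : IsHarmonicBasis ℓ Y) (x : S2) :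
    ∑ k, ‖surfGrad (Y k) x‖ ^ 2 = (2 * ℓ + 1) / (4 * Real.pi) * lam ℓ := by
  have e : ∀ i : Fin 3, ∑ k, (surfGrad (Y k) x i) ^ 2
      = (2 * ℓ + 1) / (4 * Real.pi) * (lam ℓ / 2) * (1 - (x : E3) i ^ 2) := by
    intro i
    set v : E3 := EuclideanSpace.single i 1 - inner ℝ (x : E3) (EuclideanSpace.single i 1) • (x : E3)
    have hv : inner ℝ (x : E3) v = 0 := inner_sub_proj x _
    have h1 : ∀ k, surfGrad (Y k) x i = inner ℝ (grad (Y k) x) v := by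
      intro k
      rw [← inner_surfGrad, EuclideanSpace.inner_single_left]
      simp
    have h2 : inner ℝ v v = 1 - (x : E3) i ^ 2 := by
      have h3 : inner ℝ (x : E3) (EuclideanSpace.single i (1 : ℝ)) = (x : E3) i := by
        rw [EuclideanSpace.inner_single_right]; simp
      have h4 : inner ℝ v v = inner ℝ (EuclideanSpace.single i (1 : ℝ)) v := by
        rw [inner_sub_left, inner_smul_left, hv, mul_zero, sub_zero]
      rw [h4, inner_sub_right, inner_smul_right, real_inner_comm (x : E3), h3]
      simp; ring
    simp_rw [h1, pow_two (inner ℝ (grad _ _) v)]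
    rw [addition_theorem_deriv_deriv hY x x hv hv, hv, inner_self_sphere,
      legendreP_derivative_eval_one, h2]
    ring
  simp_rw [norm_sq_eq_sum_three, Finset.sum_add_distrib, e]
  have := inner_self_sphere x
  rw [inner_eq_sum_three] at this
  linear_combination -((2 * ℓ + 1) / (4 * Real.pi) * (lam ℓ / 2)) * this

theorem norm_surfCurl_sq (p : MvPolynomial (Fin 3) ℝ) (x : S2) :
    ‖surfCurl p x‖ ^ 2 = ‖surfGrad p x‖ ^ 2 := by
  rw [← real_inner_self_eq_norm_sq, ← real_inner_self_eq_norm_sq, surfCurl, inner_cross_cross,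
    inner_self_sphere, inner_surfGrad_of_tangent p x (inner_surfGrad_self p x), surfGrad,
    inner_sub_right, inner_smul_right, real_inner_comm (x : E3) (grad p x)]
  ring

theorem sum_norm_vec_sq {ℓ : ℕ} {Y : Fin (2 * ℓ + 1) → MvPolynomial (Fin 3) ℝ}
    (hY : IsHarmonicBasis ℓ Y) (hℓ : 1 ≤ ℓ) (x : S2) :
    ∑ k, (‖vecDiv ℓ (Y k) x‖ ^ 2 + ‖vecCurl ℓ (Y k) x‖ ^ 2) = (2 * ℓ + 1) / (2 * Real.pi) := by
  have hl := lam_pos hℓ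
  have hp := Real.pi_pos
  have e : ∀ k, ‖vecDiv ℓ (Y k) x‖ ^ 2 + ‖vecCurl ℓ (Y k) x‖ ^ 2
      = 2 * (lam ℓ)⁻¹ * ‖surfGrad (Y k) x‖ ^ 2 := by
    intro k
    rw [vecDiv, vecCurl, norm_smul, norm_smul, mul_pow, mul_pow, norm_surfCurl_sq, norm_inv,
      Real.norm_eq_abs, abs_of_nonneg (Real.sqrt_nonneg _), inv_pow, Real.sq_sqrt hl.le]
    ring
  simp_rw [e]
  rw [← Finset.mul_sum, sum_norm_surfGrad_sq hY]
  field_simp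
  norm_num

/-- The weight of the degree `ℓ` in the pointwise Sobolev bound. -/
def degreeWeight (σ : ℝ) (ℓ : ℕ) : ℝ := (2 * ℓ + 1) / (2 * Real.pi) * (1 + lam ℓ) ^ (-σ)

theorem lam_nonneg (ℓ : ℕ) : 0 ≤ lam ℓ := by unfold lam; positivity

theorem degreeWeight_nonneg (σ : ℝ) (ℓ : ℕ) : 0 ≤ degreeWeight σ ℓ := by
  have := lam_nonneg ℓ
  have := Real.pi_pos
  unfold degreeWeight; positivity

theorem sobolevTerm_nonneg (Y : (ℓ : ℕ) → Fin (2 * ℓ + 1) → MvPolynomial (Fin 3) ℝ) (σ : ℝ)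
    (f : S2 → E3) (ℓ : ℕ) : 0 ≤ sobolevTerm Y σ f ℓ := by
  have := lam_nonneg ℓ
  unfold sobolevTerm
  positivity

/-- Cauchy–Schwarz over the vector harmonics of degree `ℓ`, whose squared lengths sum to a constant
on the sphere. The powers `±σ` of `1 + λ_ℓ` cancel, so `σ` is free here. -/
theorem norm_fieldPart_le {Y : (ℓ : ℕ) → Fin (2 * ℓ + 1) → MvPolynomial (Fin 3) ℝ} {ℓ : ℕ}
    (hY : IsHarmonicBasis ℓ (Y ℓ)) (hℓ : 1 ≤ ℓ) (σ : ℝ) (f : S2 → E3) (x : S2) :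
    ‖fieldPart Y f ℓ x‖ ≤ √(degreeWeight σ ℓ) * √(sobolevTerm Y σ f ℓ) := by
  have hl : 0 < 1 + lam ℓ := by have := lam_nonneg ℓ; linarith
  set a := fun k => ip f (vecDiv ℓ (Y ℓ k))
  set b := fun k => ip f (vecCurl ℓ (Y ℓ k))
  set A := fun k => vecDiv ℓ (Y ℓ k) x
  set B := fun k => vecCurl ℓ (Y ℓ k) x
  have h1 : degreeWeight σ ℓ * sobolevTerm Y σ f ℓ
      = (∑ k, (‖A k‖ ^ 2 + ‖B k‖ ^ 2)) * ∑ k, (|a k| ^ 2 + |b k| ^ 2) := by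
    rw [sum_norm_vec_sq hY hℓ, degreeWeight, sobolevTerm, ← Finset.mul_sum, mul_assoc, ← mul_assoc _ ((1 + lam ℓ) ^ σ),
      ← Real.rpow_add hl]
    simp [a, b]
  rw [← Real.sqrt_mul (degreeWeight_nonneg σ ℓ), h1]
  have h2 : ∀ k, ‖a k • A k + b k • B k‖
      ≤ √(‖A k‖ ^ 2 + ‖B k‖ ^ 2) * √(|a k| ^ 2 + |b k| ^ 2) := by
    intro k
    refine (norm_add_le _ _).trans ?_
    rw [norm_smul, norm_smul, Real.norm_eq_abs, Real.norm_eq_abs, ← Real.sqrt_mul (by positivity)]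
    refine Real.le_sqrt_of_sq_le ?_
    nlinarith [sq_nonneg (|a k| * ‖B k‖ - |b k| * ‖A k‖)]
  rw [Real.sqrt_mul (by positivity)]
  refine (norm_sum_le _ _).trans ((Finset.sum_le_sum fun k _ => h2 k).trans ?_)
  exact Real.sum_sqrt_mul_sqrt_le _ (fun k => by positivity) (fun k => by positivity)

/-! ### Weighted sums over the degrees -/

theorem summable_sqrt_mul_sqrt {u v : ℕ → ℝ} (hu0 : ∀ n, 0 ≤ u n) (hv0 : ∀ n, 0 ≤ v n)
    (hu : Summable u) (hv : Summable v) : Summable (fun n => √(u n) * √(v n)) ∧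
      ∑' n, √(u n) * √(v n) ≤ √(∑' n, u n) * √(∑' n, v n) := by
  have h : ∀ N, ∑ n ∈ Finset.range N, √(u n) * √(v n) ≤ √(∑' n, u n) * √(∑' n, v n) := by
    intro N
    refine (Real.sum_sqrt_mul_sqrt_le _ hu0 hv0).trans ?_
    gcongr
    · exact hu.sum_le_tsum _ fun n _ => hu0 n
    · exact hv.sum_le_tsum _ fun n _ => hv0 n
  have h0 : ∀ n, 0 ≤ √(u n) * √(v n) := fun n => by positivity
  exact ⟨summable_of_sum_range_le h0 h, Real.tsum_le_of_sum_range_le h0 h⟩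

/-- With `m = n + 1`, `π > 3` gives `(2m+1)/(2π) ≤ m`, and `1 + λ_m ≥ m²`. For `σ > 1` the exponent
`1 - 2σ` is below `-1`, which gives summability. -/
theorem degreeWeight_le {σ : ℝ} (hσ : 0 ≤ σ) (n : ℕ) :
    degreeWeight σ (n + 1) ≤ ((n + 1 : ℕ) : ℝ) ^ (1 - 2 * σ) := by
  set m : ℝ := ((n + 1 : ℕ) : ℝ) with hm
  have h1 : 1 ≤ m := by rw [hm]; push_cast; linarith [(Nat.cast_nonneg n : (0 : ℝ) ≤ n)]
  have h0 : 0 < m := by linarith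
  have hp : 3 < Real.pi := Real.pi_gt_three
  have h2 : (2 * m + 1) / (2 * Real.pi) ≤ m := by
    rw [div_le_iff₀ (by positivity)]; nlinarith
  have h3 : (1 + lam (n + 1)) ^ (-σ) ≤ m ^ (-(2 * σ)) := by
    have : m ^ (-(2 * σ)) = (m ^ 2) ^ (-σ) := by
      rw [← Real.rpow_natCast, ← Real.rpow_mul h0.le]; congr 1; push_cast; ring
    rw [this]
    refine Real.rpow_le_rpow_of_nonpos (by positivity) ?_ (by linarith)
    simp only [lam]
    rw [← hm]; nlinarith
  have hl : 0 ≤ 1 + lam (n + 1) := by have := lam_nonneg (n + 1); linarith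
  calc degreeWeight σ (n + 1) ≤ m * m ^ (-(2 * σ)) := by
        unfold degreeWeight
        exact mul_le_mul h2 h3 (Real.rpow_nonneg hl _) h0.le
    _ = m ^ (1 - 2 * σ) := by
        rw [sub_eq_add_neg, Real.rpow_add h0, Real.rpow_one]

theorem summable_degreeWeight {σ : ℝ} (hσ : 1 < σ) :
    Summable fun n : ℕ => degreeWeight σ (n + 1) := by
  refine Summable.of_nonneg_of_le (fun n => degreeWeight_nonneg _ _)
    (fun n => degreeWeight_le (by linarith) n) ?_
  exact (summable_nat_add_iff 1).2 (Real.summable_nat_rpow.2 (by linarith))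

/-- A discrete integral test: it bounds the terms of the tail by a telescoping difference. It
follows from `log((m+1)/m) ≥ 1/(m+1)` and `exp u ≥ 1 + u`; `m + 1 ≤ 2m` accounts for `2 ^ (1 + a)`.
-/
theorem rpow_neg_sub_rpow_neg_ge {a m : ℝ} (ha : 0 < a) (hm : 1 ≤ m) :
    m ^ (-1 - a) ≤ 2 ^ (1 + a) / a * (m ^ (-a) - (m + 1) ^ (-a)) := by
  have h0 : 0 < m := by linarith
  have h1 : 0 < m + 1 := by linarith
  have hlog : 1 / (m + 1) ≤ Real.log (m + 1) - Real.log m := by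
    rw [← Real.log_div h1.ne' h0.ne']
    refine le_trans (le_of_eq ?_) (Real.one_sub_inv_le_log_of_pos (by positivity))
    field_simp; ring
  have hexp : m ^ (-a) = (m + 1) ^ (-a) * Real.exp (a * (Real.log (m + 1) - Real.log m)) := by
    rw [Real.rpow_def_of_pos h0, Real.rpow_def_of_pos h1, ← Real.exp_add]
    congr 1; ring
  have h2 : (m + 1) ^ (-a) * (a / (m + 1)) ≤ m ^ (-a) - (m + 1) ^ (-a) := by
    have := Real.add_one_le_exp (a * (Real.log (m + 1) - Real.log m))
    have h3 : a / (m + 1) ≤ a * (Real.log (m + 1) - Real.log m) := by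
      rw [div_eq_mul_one_div]; gcongr
    have h4 : 0 < (m + 1) ^ (-a) := Real.rpow_pos_of_pos h1 _
    rw [hexp]
    nlinarith
  have h5 : (2 * m) ^ (-1 - a) ≤ (m + 1) ^ (-1 - a) :=
    Real.rpow_le_rpow_of_nonpos h1 (by linarith) (by linarith)
  have h6 : (m + 1) ^ (-1 - a) = (m + 1) ^ (-a) / (m + 1) := by
    rw [show -1 - a = -a - 1 by ring, Real.rpow_sub_one h1.ne']
  have h7 : (2 * m) ^ (-1 - a) = m ^ (-1 - a) / 2 ^ (1 + a) := by
    rw [Real.mul_rpow (by norm_num) h0.le, show -1 - a = -(1 + a) by ring,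
      Real.rpow_neg (by norm_num : (0 : ℝ) ≤ 2)]
    ring
  rw [h6, h7] at h5
  have h8 : (0 : ℝ) < 2 ^ (1 + a) := by positivity
  rw [div_mul_eq_mul_div, le_div_iff₀ ha]
  rw [div_le_iff₀ h8] at h5
  calc m ^ (-1 - a) * a ≤ ((m + 1) ^ (-a) / (m + 1) * 2 ^ (1 + a)) * a := by gcongr
    _ = 2 ^ (1 + a) * ((m + 1) ^ (-a) * (a / (m + 1))) := by ring
    _ ≤ _ := by gcongr

theorem sum_tail_rpow_le {a : ℝ} (ha : 0 < a) {M : ℕ} (hM : 1 ≤ M) (K : ℕ) :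
    ∑ n ∈ Finset.range K, (if M ≤ n + 1 then ((n + 1 : ℕ) : ℝ) ^ (-1 - a) else 0)
      ≤ 2 ^ (1 + a) / a * (M : ℝ) ^ (-a) := by
  -- The maximum makes the telescoped bound zero until the tail starts at `M`, so one induction
  -- covers both regimes.
  have key : ∑ n ∈ Finset.range K, (if M ≤ n + 1 then ((n + 1 : ℕ) : ℝ) ^ (-1 - a) else 0)
      ≤ 2 ^ (1 + a) / a * ((M : ℝ) ^ (-a) - ((max M (K + 1) : ℕ) : ℝ) ^ (-a)) := by
    induction K with
    | zero => simp [hM]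
    | succ K ih =>
      rw [Finset.sum_range_succ]
      split_ifs with h
      · rw [max_eq_right h] at ih
        rw [max_eq_right (by omega)]
        have := rpow_neg_sub_rpow_neg_ge ha (m := ((K + 1 : ℕ) : ℝ)) (by simp)
        push_cast at this ih ⊢
        linarith
      · rw [max_eq_left (by omega)] at ih ⊢
        linarith
  refine key.trans ?_
  have : 0 ≤ ((max M (K + 1) : ℕ) : ℝ) ^ (-a) := Real.rpow_nonneg (Nat.cast_nonneg _) _
  gcongr
  linarith

/-- The weighted sum of the squared multiplier errors of the kernel. -/
theorem sum_error_le {ψ : ℝ → ℝ → ℝ} {σ ρ₀ c₁ c₂ : ℝ} (hσ : 1 < σ) (hρ₀ : ρ₀ ≤ 1)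
    (hc₁ : 0 < c₁) (hc₂ : 0 < c₂) (hψ : KernelCondition ψ σ ρ₀ c₁ c₂) {ρ : ℝ} (h0 : 0 < ρ)
    (h1 : ρ < ρ₀) (K : ℕ) :
    ∑ n ∈ Finset.range K, (1 - zonalCoeff (ψ ρ) (n + 1)) ^ 2 * degreeWeight σ (n + 1)
      ≤ (c₁ ^ 2 + (1 + c₂) ^ 2 * (2 ^ (1 + (2 * σ - 2)) / (2 * σ - 2) * 2 ^ (2 * σ - 2)))
        * (ρ ^ (σ - 1)) ^ 2 := by
  have hρ1 : 1 < ρ⁻¹ := (one_lt_inv₀ h0).2 (h1.trans_le hρ₀)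
  have hfl : 0 ≤ ⌊ρ⁻¹ - 1⌋ := Int.floor_nonneg.2 (by linarith)
  obtain ⟨N, hN⟩ := Int.eq_ofNat_of_zero_le hfl
  have hN1 : (N : ℝ) ≤ ρ⁻¹ - 1 := by
    have := Int.floor_le (ρ⁻¹ - 1)
    rw [hN] at this; exact_mod_cast this
  have hN2 : ρ⁻¹ - 1 < N + 1 := by
    have := Int.lt_floor_add_one (ρ⁻¹ - 1)
    rw [hN] at this; exact_mod_cast this
  have ha : 0 < 2 * σ - 2 := by linarith
  have hsq : (ρ ^ (σ - 1)) ^ 2 = ρ ^ (2 * σ - 2) := by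
    rw [← Real.rpow_natCast, ← Real.rpow_mul h0.le]; congr 1; push_cast; ring
  -- For degree `ℓ = n + 1 ≤ N` the powers of `ℓ` combine to `ℓ^(2σ) ℓ^(1-2σ) = ℓ ≤ ρ⁻¹`, leaving
  -- `c₁² ρ^(2σ-1)`. Beyond `N` the multiplier error is at most `1 + c₂`, and the weight is written
  -- as `ℓ^(-1-a)` with `a = 2σ - 2`.
  have hterm : ∀ n : ℕ, (1 - zonalCoeff (ψ ρ) (n + 1)) ^ 2 * degreeWeight σ (n + 1)
      ≤ (if n < N then c₁ ^ 2 * ρ ^ (2 * σ - 1) else 0)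
        + (1 + c₂) ^ 2 *
          (if N + 1 ≤ n + 1 then ((n + 1 : ℕ) : ℝ) ^ (-1 - (2 * σ - 2)) else 0) := by
    intro n
    have hw := degreeWeight_le (by linarith : 0 ≤ σ) n
    have hm : (0 : ℝ) < ((n + 1 : ℕ) : ℝ) := by positivity
    rcases Nat.lt_or_ge n N with h | h
    · rw [if_pos h, if_neg (by omega), mul_zero, add_zero]
      have h2 := hψ.low ρ h0 h1 (n + 1) (by rw [hN]; exact_mod_cast h)
      have h3 : (1 - zonalCoeff (ψ ρ) (n + 1)) ^ 2
          ≤ c₁ ^ 2 * (((n + 1 : ℕ) : ℝ) ^ (2 * σ) * ρ ^ (2 * σ)) := by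
        rw [← sq_abs, ← Real.mul_rpow hm.le h0.le]
        calc _ ≤ (c₁ * (((n + 1 : ℕ) : ℝ) * ρ) ^ σ) ^ 2 := by gcongr
          _ = _ := by
            rw [mul_pow, ← Real.rpow_natCast ((_ : ℝ) ^ σ), ← Real.rpow_mul (by positivity)]
            congr 2; push_cast; ring
      have h4 : ((n + 1 : ℕ) : ℝ) * ρ ≤ 1 := by
        have : ((n + 1 : ℕ) : ℝ) ≤ N := by exact_mod_cast h
        have h5 : ((n + 1 : ℕ) : ℝ) ≤ ρ⁻¹ := by linarith
        calc _ ≤ ρ⁻¹ * ρ := by gcongr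
          _ = 1 := inv_mul_cancel₀ h0.ne'
      calc _ ≤ c₁ ^ 2 * (((n + 1 : ℕ) : ℝ) ^ (2 * σ) * ρ ^ (2 * σ))
            * ((n + 1 : ℕ) : ℝ) ^ (1 - 2 * σ) :=
            mul_le_mul h3 hw (degreeWeight_nonneg _ _) (by positivity)
        _ = c₁ ^ 2 * (ρ ^ (2 * σ)
            * (((n + 1 : ℕ) : ℝ) ^ (2 * σ) * ((n + 1 : ℕ) : ℝ) ^ (1 - 2 * σ))) := by ring
        _ = c₁ ^ 2 * (ρ ^ (2 * σ - 1) * (((n + 1 : ℕ) : ℝ) * ρ)) := by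
            rw [← Real.rpow_add hm, show 2 * σ + (1 - 2 * σ) = 1 by ring, Real.rpow_one,
              Real.rpow_sub_one h0.ne']
            field_simp
        _ ≤ c₁ ^ 2 * (ρ ^ (2 * σ - 1) * 1) := by gcongr
        _ = _ := by ring
    · rw [if_neg (by omega), if_pos (by omega), zero_add]
      have h2 := hψ.high ρ h0 h1 (n + 1) (by rw [hN]; exact_mod_cast Nat.lt_succ_of_le h)
      rw [show -1 - (2 * σ - 2) = 1 - 2 * σ by ring]
      refine mul_le_mul ?_ hw (degreeWeight_nonneg _ _) (by positivity)
      rw [← sq_abs (1 - _)]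
      have := abs_sub (1 : ℝ) (zonalCoeff (ψ ρ) (n + 1))
      rw [abs_one] at this
      gcongr
      linarith
  have hsum1 : ∑ n ∈ Finset.range K, (if n < N then c₁ ^ 2 * ρ ^ (2 * σ - 1) else 0)
      ≤ c₁ ^ 2 * ρ ^ (2 * σ - 2) := by
    rw [← Finset.sum_filter, Finset.sum_const, nsmul_eq_mul]
    have hcard : ((Finset.range K).filter (· < N)).card ≤ N := by
      calc _ ≤ (Finset.range N).card := Finset.card_le_card fun n hn => by
            rw [Finset.mem_filter] at hn; exact Finset.mem_range.2 hn.2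
        _ = N := Finset.card_range N
    have h2 : (((Finset.range K).filter (· < N)).card : ℝ) ≤ ρ⁻¹ := by
      have : (((Finset.range K).filter (· < N)).card : ℝ) ≤ N := by exact_mod_cast hcard
      linarith
    calc _ ≤ ρ⁻¹ * (c₁ ^ 2 * ρ ^ (2 * σ - 1)) := by gcongr
      _ = c₁ ^ 2 * ρ ^ (2 * σ - 2) := by
        rw [show 2 * σ - 2 = 2 * σ - 1 - 1 by ring, Real.rpow_sub_one h0.ne' (2 * σ - 1)]
        ring
  have hsum2 := sum_tail_rpow_le ha (M := N + 1) (by omega) K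
  -- Since `ρ⁻¹ < N + 2 ≤ 2(N + 1)`, the tail starts no earlier than `1/(2ρ)`; hence the factor `2 ^
  -- (2σ - 2)`.
  have hM : ((N + 1 : ℕ) : ℝ) ^ (-(2 * σ - 2)) ≤ 2 ^ (2 * σ - 2) * ρ ^ (2 * σ - 2) := by
    rw [← Real.mul_rpow (by norm_num) h0.le, Real.rpow_neg (by positivity),
      ← Real.inv_rpow (by positivity)]
    refine Real.rpow_le_rpow (by positivity) ?_ ha.le
    rw [inv_le_comm₀ (by positivity) (by positivity), mul_inv]
    push_cast
    linarith [(Nat.cast_nonneg N : (0 : ℝ) ≤ N)]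
  rw [hsq]
  calc _ ≤ ∑ n ∈ Finset.range K, ((if n < N then c₁ ^ 2 * ρ ^ (2 * σ - 1) else 0)
        + (1 + c₂) ^ 2 *
          (if N + 1 ≤ n + 1 then ((n + 1 : ℕ) : ℝ) ^ (-1 - (2 * σ - 2)) else 0)) :=
        Finset.sum_le_sum fun n _ => hterm n
    _ ≤ c₁ ^ 2 * ρ ^ (2 * σ - 2) + (1 + c₂) ^ 2 * (2 ^ (1 + (2 * σ - 2)) / (2 * σ - 2) *
        (2 ^ (2 * σ - 2) * ρ ^ (2 * σ - 2))) := by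
        rw [Finset.sum_add_distrib, ← Finset.mul_sum]
        refine add_le_add hsum1 ?_
        refine mul_le_mul_of_nonneg_left (hsum2.trans ?_) (by positivity)
        exact mul_le_mul_of_nonneg_left hM (by positivity)
    _ = _ := by ring

/-! ### Orthonormality of the vector spherical harmonics -/

theorem continuous_surfCurl (p : MvPolynomial (Fin 3) ℝ) : Continuous (surfCurl p) :=
  continuous_subtype_val.sphere_cross (continuous_grad_sphere p)

theorem continuous_surfGrad (p : MvPolynomial (Fin 3) ℝ) : Continuous (surfGrad p) :=
  (continuous_grad_sphere p).fun_sub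
    ((continuous_subtype_val.inner (continuous_grad_sphere p)).fun_smul continuous_subtype_val)

theorem continuous_vecDiv (ℓ : ℕ) (p : MvPolynomial (Fin 3) ℝ) : Continuous (vecDiv ℓ p) :=
  (continuous_surfCurl p).fun_const_smul _

theorem continuous_vecCurl (ℓ : ℕ) (p : MvPolynomial (Fin 3) ℝ) : Continuous (vecCurl ℓ p) :=
  (continuous_surfGrad p).fun_const_smul _

theorem continuous_fieldPart (Y : (ℓ : ℕ) → Fin (2 * ℓ + 1) → MvPolynomial (Fin 3) ℝ)
    (f : S2 → E3) (ℓ : ℕ) : Continuous (fieldPart Y f ℓ) :=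
  continuous_finsetSum _ fun _ _ =>
    ((continuous_vecDiv _ _).fun_const_smul _).fun_add ((continuous_vecCurl _ _).fun_const_smul _)

theorem inner_fieldPart_self (Y : (ℓ : ℕ) → Fin (2 * ℓ + 1) → MvPolynomial (Fin 3) ℝ)
    (f : S2 → E3) (ℓ : ℕ) (x : S2) : inner ℝ (x : E3) (fieldPart Y f ℓ x) = 0 := by
  simp [fieldPart, inner_sum, inner_add_right, inner_smul_right, vecDiv, vecCurl,
    inner_surfGrad_self, inner_surfCurl_self]

theorem ip_comm (f g : S2 → E3) : ip f g = ip g f := by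
  simp only [ip, real_inner_comm]

theorem ip_vecDiv_vecCurl (ℓ m : ℕ) (p q : MvPolynomial (Fin 3) ℝ) :
    ip (vecDiv ℓ p) (vecCurl m q) = 0 := by
  simp only [ip, vecDiv, vecCurl, inner_smul_left, inner_smul_right, integral_const_mul,
    integral_surfCurl_surfGrad, mul_zero]

theorem ip_vecDiv_vecDiv {Y : (ℓ : ℕ) → Fin (2 * ℓ + 1) → MvPolynomial (Fin 3) ℝ}
    (hY : ∀ ℓ, IsHarmonicBasis ℓ (Y ℓ)) {ℓ m : ℕ} (h : ℓ ≠ m) (k : Fin (2 * ℓ + 1))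
    (j : Fin (2 * m + 1)) : ip (vecDiv ℓ (Y ℓ k)) (vecDiv m (Y m j)) = 0 := by
  simp only [ip, vecDiv, inner_smul_left, inner_smul_right, integral_const_mul,
    integral_surfCurl_surfCurl ((hY ℓ).mem k),
    integral_harmonic_orthogonal h ((hY ℓ).mem k) ((hY m).mem j), mul_zero]

theorem ip_vecCurl_vecCurl {Y : (ℓ : ℕ) → Fin (2 * ℓ + 1) → MvPolynomial (Fin 3) ℝ}
    (hY : ∀ ℓ, IsHarmonicBasis ℓ (Y ℓ)) {ℓ m : ℕ} (h : ℓ ≠ m) (k : Fin (2 * ℓ + 1))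
    (j : Fin (2 * m + 1)) : ip (vecCurl ℓ (Y ℓ k)) (vecCurl m (Y m j)) = 0 := by
  simp only [ip, vecCurl, inner_smul_left, inner_smul_right, integral_const_mul,
    integral_surfGrad_surfGrad ((hY ℓ).mem k),
    integral_harmonic_orthogonal h ((hY ℓ).mem k) ((hY m).mem j), mul_zero]

theorem inv_sqrt_mul_inv_sqrt_mul {a : ℝ} (ha : 0 < a) (r : ℝ) :
    (√a)⁻¹ * ((√a)⁻¹ * (a * r)) = r := by
  have h := Real.sqrt_pos.2 ha
  nth_rewrite 3 [← Real.mul_self_sqrt ha.le]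
  field_simp

theorem ip_vecDiv_vecDiv_same {ℓ : ℕ} {Y : Fin (2 * ℓ + 1) → MvPolynomial (Fin 3) ℝ}
    (hY : IsHarmonicBasis ℓ Y) (hℓ : 1 ≤ ℓ) (k j : Fin (2 * ℓ + 1)) :
    ip (vecDiv ℓ (Y k)) (vecDiv ℓ (Y j)) = if k = j then 1 else 0 := by
  simp only [ip, vecDiv, inner_smul_left, inner_smul_right, integral_const_mul,
    integral_surfCurl_surfCurl (hY.mem k), hY.orthonormal, conj_trivial]
  exact inv_sqrt_mul_inv_sqrt_mul (lam_pos hℓ) _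

theorem ip_vecCurl_vecCurl_same {ℓ : ℕ} {Y : Fin (2 * ℓ + 1) → MvPolynomial (Fin 3) ℝ}
    (hY : IsHarmonicBasis ℓ Y) (hℓ : 1 ≤ ℓ) (k j : Fin (2 * ℓ + 1)) :
    ip (vecCurl ℓ (Y k)) (vecCurl ℓ (Y j)) = if k = j then 1 else 0 := by
  simp only [ip, vecCurl, inner_smul_left, inner_smul_right, integral_const_mul,
    integral_surfGrad_surfGrad (hY.mem k), hY.orthonormal, conj_trivial]
  exact inv_sqrt_mul_inv_sqrt_mul (lam_pos hℓ) _

theorem ip_fieldPart (Y : (ℓ : ℕ) → Fin (2 * ℓ + 1) → MvPolynomial (Fin 3) ℝ)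
    (f : S2 → E3) (ℓ : ℕ) {h : S2 → E3} (hh : Continuous h) :
    ip (fieldPart Y f ℓ) h = ∑ k, (ip f (vecDiv ℓ (Y ℓ k)) * ip (vecDiv ℓ (Y ℓ k)) h
      + ip f (vecCurl ℓ (Y ℓ k)) * ip (vecCurl ℓ (Y ℓ k)) h) := by
  have h1 : ∀ p, Integrable (fun x => inner ℝ (vecDiv ℓ p x) (h x)) surf := fun p =>
    integrable_of_continuous_sphere ((continuous_vecDiv ℓ p).inner hh)
  have h2 : ∀ p, Integrable (fun x => inner ℝ (vecCurl ℓ p x) (h x)) surf := fun p =>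
    integrable_of_continuous_sphere ((continuous_vecCurl ℓ p).inner hh)
  simp only [ip.eq_def (fieldPart _ _ _), ip.eq_def _ h, fieldPart, sum_inner, inner_add_left,
    inner_smul_left, conj_trivial]
  rw [integral_finsetSum _ fun k _ => ((h1 _).const_mul _).fun_add ((h2 _).const_mul _)]
  refine Finset.sum_congr rfl fun k _ => ?_
  rw [integral_add ((h1 _).const_mul _) ((h2 _).const_mul _), integral_const_mul,
    integral_const_mul]

theorem ip_fieldPart_vecDiv {Y : (ℓ : ℕ) → Fin (2 * ℓ + 1) → MvPolynomial (Fin 3) ℝ}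
    (hY : ∀ ℓ, IsHarmonicBasis ℓ (Y ℓ)) (f : S2 → E3) {ℓ m : ℕ} (hℓ : 1 ≤ ℓ)
    (j : Fin (2 * m + 1)) : ip (fieldPart Y f ℓ) (vecDiv m (Y m j))
      = if ℓ = m then ip f (vecDiv m (Y m j)) else 0 := by
  rw [ip_fieldPart Y f ℓ (continuous_vecDiv _ _)]
  simp_rw [ip_comm (vecCurl ℓ _), ip_vecDiv_vecCurl]
  split_ifs with h
  · subst h
    simp [ip_vecDiv_vecDiv_same (hY ℓ) hℓ]
  · simp [ip_vecDiv_vecDiv hY h]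

theorem ip_fieldPart_vecCurl {Y : (ℓ : ℕ) → Fin (2 * ℓ + 1) → MvPolynomial (Fin 3) ℝ}
    (hY : ∀ ℓ, IsHarmonicBasis ℓ (Y ℓ)) (f : S2 → E3) {ℓ m : ℕ} (hℓ : 1 ≤ ℓ)
    (j : Fin (2 * m + 1)) : ip (fieldPart Y f ℓ) (vecCurl m (Y m j))
      = if ℓ = m then ip f (vecCurl m (Y m j)) else 0 := by
  rw [ip_fieldPart Y f ℓ (continuous_vecCurl _ _)]
  simp_rw [ip_vecDiv_vecCurl]
  split_ifs with h
  · subst h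
    simp [ip_vecCurl_vecCurl_same (hY ℓ) hℓ]
  · simp [ip_vecCurl_vecCurl hY h]

/-! ### Expansion of a Sobolev field -/

theorem hasSum_ip_tsum {u : ℕ → S2 → E3} (hu : ∀ n, Continuous (u n)) {β : ℕ → ℝ}
    (hβ : Summable β) (hb : ∀ n x, ‖u n x‖ ≤ β n) {h : S2 → E3} (hh : Continuous h) :
    HasSum (fun n => ip (u n) h) (ip (fun x => ∑' n, u n x) h) := by
  refine hasSum_integral_of_dominated_convergence (fun n x => β n * ‖h x‖)
    (fun n => ((hu n).inner hh).aestronglyMeasurable) (fun n => .of_forall fun x => ?_)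
    (.of_forall fun x => hβ.mul_right _) ?_ (.of_forall fun x => ?_)
  · exact (norm_inner_le_norm _ _).trans (by gcongr; exact hb n x)
  · simp_rw [tsum_mul_right]
    exact (integrable_of_continuous_sphere hh.norm).const_mul _
  · have hs : Summable fun n => u n x := hβ.of_norm_bounded fun n => hb n x
    have := hs.hasSum.mapL (innerSL ℝ (h x))
    simpa only [innerSL_apply_apply, real_inner_comm (h x)] using this

theorem summable_fieldPart_bound {Y : (ℓ : ℕ) → Fin (2 * ℓ + 1) → MvPolynomial (Fin 3) ℝ}
    {σ : ℝ} (hσ : 1 < σ) {f : S2 → E3} (hf : MemSobolev Y σ f) :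
    Summable fun n : ℕ => √(degreeWeight σ (n + 1)) * √(sobolevTerm Y σ f (n + 1)) :=
  (summable_sqrt_mul_sqrt (fun _ => degreeWeight_nonneg _ _) (fun _ => sobolevTerm_nonneg _ _ _ _)
    (summable_degreeWeight hσ) hf.summable).1

/-- A Sobolev field of order `σ > 1` is almost everywhere the sum of its components. -/
theorem ae_eq_tsum_fieldPart {Y : (ℓ : ℕ) → Fin (2 * ℓ + 1) → MvPolynomial (Fin 3) ℝ}
    (hY : ∀ ℓ, IsHarmonicBasis ℓ (Y ℓ)) {σ : ℝ} (hσ : 1 < σ) {f : S2 → E3}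
    (hf : MemSobolev Y σ f) : f =ᵐ[surf] fun x => ∑' n, fieldPart Y f (n + 1) x := by
  have hβ := summable_fieldPart_bound hσ hf
  have hb : ∀ (n : ℕ) x, ‖fieldPart Y f (n + 1) x‖ ≤ _ := fun n x =>
    norm_fieldPart_le (hY (n + 1)) (by omega) σ f x
  have hu : ∀ n : ℕ, Continuous (fieldPart Y f (n + 1)) := fun n => continuous_fieldPart _ _ _
  set F : S2 → E3 := fun x => ∑' n, fieldPart Y f (n + 1) x
  have hF : Continuous F := continuous_tsum hu hβ hb
  have hF2 : MemLp F 2 surf :=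
    MemLp.of_bound hF.aestronglyMeasurable _ (.of_forall fun x => tsum_of_norm_bounded hβ.hasSum
      fun n => hb n x)
  have hfi : Integrable f surf := hf.memL2.memLp.integrable (by norm_num)
  have hsub : ∀ {h : S2 → E3}, Continuous h → ip (fun x => f x - F x) h = ip f h - ip F h := by
    intro h hh
    simp only [ip, inner_sub_left]
    refine integral_sub ?_ (integrable_of_continuous_sphere (hF.inner hh))
    simpa only [real_inner_comm] using hfi.continuous_inner_sphere hh
  -- The difference of `f` and its series is a square-integrable tangent field with all coefficients
  -- zero, so completeness applies.
  have key := ae_eq_zero_of_ip_eq_zero hY (g := fun x => f x - F x) ⟨hf.memL2.memLp.sub hF2, ?_⟩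
    (fun m hm j => ?_) (fun m hm j => ?_)
  · filter_upwards [key] with x hx
    exact sub_eq_zero.1 hx
  · filter_upwards [hf.memL2.tangential] with x hx
    have hs : Summable fun n : ℕ => fieldPart Y f (n + 1) x := hβ.of_norm_bounded fun n => hb n x
    have h1 : HasSum (fun _ : ℕ => (0 : ℝ)) (inner ℝ (x : E3) (F x)) := by
      simpa only [innerSL_apply_apply, inner_fieldPart_self] using
        hs.hasSum.mapL (innerSL ℝ (x : E3))
    rw [inner_sub_right, hx, h1.unique hasSum_zero, sub_self]
  · obtain ⟨m, rfl⟩ := Nat.exists_eq_add_of_le' hm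
    have h1 := hasSum_ip_tsum hu hβ hb (continuous_vecDiv (m + 1) (Y (m + 1) j))
    simp_rw [ip_fieldPart_vecDiv hY f (Nat.le_add_left 1 _), Nat.add_right_cancel_iff] at h1
    rw [hsub (continuous_vecDiv _ _), h1.unique (hasSum_ite_eq m _), sub_self]
  · obtain ⟨m, rfl⟩ := Nat.exists_eq_add_of_le' hm
    have h1 := hasSum_ip_tsum hu hβ hb (continuous_vecCurl (m + 1) (Y (m + 1) j))
    simp_rw [ip_fieldPart_vecCurl hY f (Nat.le_add_left 1 _), Nat.add_right_cancel_iff] at h1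
    rw [hsub (continuous_vecCurl _ _), h1.unique (hasSum_ite_eq m _), sub_self]

/-! ### The approximation error -/

/-- The second Cauchy–Schwarz, now over degrees. The bound `A` is asked of partial sums, so that it
also provides summability. -/
theorem norm_error_le {Y : (ℓ : ℕ) → Fin (2 * ℓ + 1) → MvPolynomial (Fin 3) ℝ}
    (hY : ∀ ℓ, IsHarmonicBasis ℓ (Y ℓ)) {σ : ℝ} {f : S2 → E3}
    (hf : MemSobolev Y σ f) {z : ℕ → ℝ} {A : ℝ}
    (hA : ∀ K, ∑ n ∈ Finset.range K, (z n) ^ 2 * degreeWeight σ (n + 1) ≤ A) (x : S2) :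
    ‖∑' n, z n • fieldPart Y f (n + 1) x‖ ≤ √A * sobolevNorm Y σ f := by
  have h0 : ∀ n, 0 ≤ z n ^ 2 * degreeWeight σ (n + 1) := fun n =>
    mul_nonneg (sq_nonneg _) (degreeWeight_nonneg _ _)
  obtain ⟨h1, h2⟩ := summable_sqrt_mul_sqrt h0 (fun n => sobolevTerm_nonneg Y σ f (n + 1))
    (summable_of_sum_range_le h0 hA) hf.summable
  refine (tsum_of_norm_bounded h1.hasSum fun n => ?_).trans (h2.trans ?_)
  · rw [norm_smul, Real.sqrt_mul (sq_nonneg _), Real.sqrt_sq_eq_abs, Real.norm_eq_abs, mul_assoc]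
    gcongr
    exact norm_fieldPart_le (hY (n + 1)) (by omega) σ f x
  · rw [sobolevNorm]
    gcongr
    exact Real.tsum_le_of_sum_range_le h0 hA

/-- The series formula for the convolution holds at every point, whereas `f` equals its own series
only almost everywhere. Continuity of the error series provides its measurability. -/
theorem sub_conv_ae_eq {Y : (ℓ : ℕ) → Fin (2 * ℓ + 1) → MvPolynomial (Fin 3) ℝ}
    (hY : ∀ ℓ, IsHarmonicBasis ℓ (Y ℓ)) {σ : ℝ} (hσ : 1 < σ) {f : S2 → E3}
    (hf : MemSobolev Y σ f) {φ : ℝ → ℝ} (hφ : Continuous φ) (h0 : zonalCoeff φ 0 = 1) :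
    Continuous (fun x => ∑' n, (1 - zonalCoeff φ (n + 1)) • fieldPart Y f (n + 1) x) ∧
      (fun x => f x - conv φ f x) =ᵐ[surf]
        fun x => ∑' n, (1 - zonalCoeff φ (n + 1)) • fieldPart Y f (n + 1) x := by
  obtain ⟨M, hM⟩ := abs_zonalCoeff_le hφ
  have hβ := summable_fieldPart_bound hσ hf
  have hb : ∀ (n : ℕ) x, ‖fieldPart Y f (n + 1) x‖ ≤ _ := fun n x =>
    norm_fieldPart_le (hY (n + 1)) (by omega) σ f x
  have hM0 : 0 ≤ M := (abs_nonneg _).trans (hM 0)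
  constructor
  · refine continuous_tsum (fun n => (continuous_fieldPart _ _ _).fun_const_smul _)
      (hβ.mul_left (1 + M)) fun n x => ?_
    rw [norm_smul]
    refine mul_le_mul ((norm_sub_le _ _).trans ?_) (hb n x) (norm_nonneg _) (by linarith)
    simpa using hM (n + 1)
  · filter_upwards [ae_eq_tsum_fieldPart hY hσ hf] with x hx
    have hs : Summable fun n => ‖fieldPart Y f (n + 1) x‖ :=
      .of_nonneg_of_le (fun _ => norm_nonneg _) (fun n => hb n x) hβ
    have hs2 : Summable fun n => zonalCoeff φ (n + 1) • fieldPart Y f (n + 1) x :=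
      (hs.mul_left M).of_norm_bounded fun n => by
        rw [norm_smul]; gcongr; exact hM _
    rw [conv_eq_tsum hY hφ h0 hf.memL2 hs]
    nth_rewrite 1 [hx]
    rw [← hs.of_norm.tsum_sub hs2]
    simp only [sub_smul, one_smul]

theorem convIntegrand_ae_congr {ψ φ : ℝ → ℝ} (h : ∀ s ∈ Set.Icc (-1 : ℝ) 1, ψ s = φ s)
    (f : S2 → E3) (x : S2) : convIntegrand ψ f x =ᵐ[surf] convIntegrand φ f x := by
  filter_upwards [ae_inner_mem_Ioo x] with y hy
  rw [convIntegrand_eq_kernelVec, convIntegrand_eq_kernelVec, kappa_congr h hy,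
    deriv_kappa_congr h hy]

/-- Degree zero is always in the low range because `ρ < 1`, and there the allowed error is `c₁ · 0^σ
= 0`. -/
theorem KernelCondition.zonalCoeff_zero_eq_one {ψ : ℝ → ℝ → ℝ} {σ ρ₀ c₁ c₂ ρ : ℝ}
    (hψ : KernelCondition ψ σ ρ₀ c₁ c₂) (hσ : σ ≠ 0) (hρ₀ : ρ₀ ≤ 1) (h0 : 0 < ρ) (h1 : ρ < ρ₀) :
    zonalCoeff (ψ ρ) 0 = 1 := by
  have hρ1 : 1 < ρ⁻¹ := (one_lt_inv₀ h0).2 (h1.trans_le hρ₀)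
  have := hψ.low ρ h0 h1 0 (Int.floor_nonneg.2 (sub_nonneg.2 hρ1.le))
  rw [Nat.cast_zero, zero_mul, Real.zero_rpow hσ, mul_zero] at this
  linarith [abs_nonpos_iff.1 this]

end SphereVec

/-! ### The uniform error estimate -/

theorem mainTheorem6
    (Y : (ℓ : ℕ) → Fin (2 * ℓ + 1) → MvPolynomial (Fin 3) ℝ)
    (hY : ∀ ℓ, SphereVec.IsHarmonicBasis ℓ (Y ℓ))
    (σ : ℝ) (hσ : 1 < σ)
    (ψ : ℝ → ℝ → ℝ) (ρ₀ c₁ c₂ : ℝ) (hρ₀ : 0 < ρ₀) (hρ₀' : ρ₀ ≤ 1) (hc₁ : 0 < c₁) (hc₂ : 0 < c₂)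
    (hψ : SphereVec.KernelCondition ψ σ ρ₀ c₁ c₂) :
    ∃ C : ℝ, 0 < C ∧ ∀ ρ : ℝ, 0 < ρ → ρ < ρ₀ →
      ∀ f : SphereVec.S2 → SphereVec.E3, SphereVec.MemSobolev Y σ f →
        (∀ x, MeasureTheory.Integrable (SphereVec.convIntegrand (ψ ρ) f x) SphereVec.surf) ∧
        MeasureTheory.MemLp (fun x => f x - SphereVec.conv (ψ ρ) f x) ⊤ SphereVec.surf ∧
        MeasureTheory.eLpNorm (fun x => f x - SphereVec.conv (ψ ρ) f x) ⊤ SphereVec.surf ≤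
          ENNReal.ofReal (C * ρ ^ (σ - 1) * SphereVec.sobolevNorm Y σ f) := by
  have hσ2 : 0 < 2 * σ - 2 := by linarith
  -- The square root of the constant in `sum_error_le`, which depends only on `σ`, `c₁` and `c₂`.
  refine ⟨√(c₁ ^ 2 + (1 + c₂) ^ 2 *
    (2 ^ (1 + (2 * σ - 2)) / (2 * σ - 2) * 2 ^ (2 * σ - 2))), by positivity,
    fun ρ h0 h1 f hf => ?_⟩
  -- The kernel is continuous on `[-1, 1]` only, so it is continued by its endpoint values to a
  -- continuous function on the line; coefficients and convolution do not change.
  set φ : ℝ → ℝ := Set.IccExtend (neg_le_self zero_le_one : (-1 : ℝ) ≤ 1)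
    ((Set.Icc (-1 : ℝ) 1).domRestrict (ψ ρ)) with hφdef
  have hφ : Continuous φ := (hψ.continuousOn ρ h0 h1).domRestrict.Icc_extend'
  have hφψ : ∀ s ∈ Set.Icc (-1 : ℝ) 1, ψ ρ s = φ s := fun s hs =>
    (Set.IccExtend_of_mem _ ((Set.Icc (-1 : ℝ) 1).domRestrict (ψ ρ)) hs).symm
  have hz : SphereVec.zonalCoeff φ 0 = 1 := by
    rw [← SphereVec.zonalCoeff_congr hφψ]
    exact hψ.zonalCoeff_zero_eq_one (by linarith) hρ₀' h0 h1
  have hint : ∀ x, Integrable (SphereVec.convIntegrand (ψ ρ) f x) SphereVec.surf := fun x =>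
    (SphereVec.integrable_convIntegrand hφ hz (hf.memL2.memLp.integrable (by norm_num)) x).congr
      (SphereVec.convIntegrand_ae_congr hφψ f x).symm
  have hconv : SphereVec.conv (ψ ρ) f = SphereVec.conv φ f :=
    funext fun x => integral_congr_ae (SphereVec.convIntegrand_ae_congr hφψ f x)
  obtain ⟨hc, hae⟩ := SphereVec.sub_conv_ae_eq hY hσ hf hφ hz
  have hA := SphereVec.sum_error_le hσ hρ₀' hc₁ hc₂ hψ h0 h1
  simp_rw [SphereVec.zonalCoeff_congr hφψ] at hA
  have hb := SphereVec.norm_error_le hY hf hA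
  rw [Real.sqrt_mul (by positivity), Real.sqrt_sq (by positivity)] at hb
  rw [hconv]
  refine ⟨hint, (memLp_congr_ae hae).2
    (memLp_top_of_bound hc.aestronglyMeasurable _ (.of_forall hb)), ?_⟩
  rw [eLpNorm_congr_ae hae, eLpNorm_exponent_top]
  exact eLpNormEssSup_le_of_ae_bound (.of_forall hb)

end
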